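/- **Setting.** Let $X=\{0,1\}^d$. A database is a finite multiset $D$ over $X$; two databases are neighbours if their symmetric difference has at most one element. For $S\subseteq[d]$ the conjunction $Q_S$ has the value $Q_S(D)=\frac1{|D|}\sum_{x\in D}\prod_{i\in S}x_i$, and $C_{d-k}=\{Q_S : |S|=d-k\}$ (empty if $k>d$). A randomized mechanism $M$ is $(\varepsilon,\delta)$-differentially private if $\Pr[M(D)\in A]\le e^{\varepsilon}\Pr[M(D')\in A]+\delta$ for all neighbouring $D,D'$ (of any sizes) and all sets $A$ of outputs. Programs run on a random access machine on natural numbers, with unit-cost addition and truncated subtraction and with fair coin tosses; a database is given to it as a list, in any order, to which the guarantees below are insensitive. **Statement.** There are a randomized program $M$, a program $\mathrm{Eval}$ and a polynomial $P$ with the following property. For every $\delta_0<1$ there is a constant $c>0$ such that for all integers $n\ge 1$, $d\ge 0$ and all rational $0<\varepsilon<1$, $0<\delta\le\delta_0$, $0<\beta<1$ (the public parameters, which both programs receive as input): 1. On every database $D$, of any size, $M$ always halts within $P(n+d+|D|)$ steps and outputs a finite sequence of natural numbers (the data structure). 2. $M$ is $(\varepsilon,\delta)$-differentially private. 3. For every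 database $D$ of size $n$, every possible output $r$ of $M$ on $D$ and every $Q\in C_{d-\lfloor\log_2 n\rfloor}$, $\mathrm{Eval}$, started on $Q$ and $r$, halts within $P(n+d)$ steps with an answer $\mathrm{Eval}(Q,r)\in\mathbb Q$ that is determined by $Q$, $r$ and the public parameters. 4. $M$ is $(\alpha,\beta)$-accurate for $C_{d-\lfloor\log_2 n\rfloor}$: for every database $D$ of size $n$, with probability at least $1-\beta$ over the output $r$ of $M$ on $D$, $|Q(D)-\mathrm{Eval}(Q,r)|\le\alpha$ for all $Q\in C_{d-\lfloor\log_2 n\rfloor}$ simultaneously, where $$\alpha=c\,(1+\log n)\left(\log n\,\log d+\log\frac1\beta\right)\frac{\sqrt{\log(1/\delta)}}{\varepsilon\sqrt n}\qquad(\text{with }\log 0:=0).$$ -/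

import Mathlib

/-! ### The machine model

Programs are structured programs for a probabilistic random access machine.  The machine has a
read-only input and a write-only output (both sequences of natural numbers), a work memory that is
addressed indirectly, and registers.  Its arithmetic is addition and truncated subtraction of
natural numbers; each elementary instruction, each test and each unfolding of a sequential
composition takes one step.  Since there is no multiplication, the bit length of the numbers grows
by at most one per step, so that running times are polynomially related to those of probabilistic
Turing machines.  The only source of randomness is the tossing of fair coins. -/

inductive Program : Type
  /-- do nothing -/
  | skip : Program
  /-- `reg i := c` -/
  | const (i c : ℕ) : Program
  /-- `reg i := reg j + reg k` -/
  | add (i j k : ℕ) : Program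
  /-- `reg i := reg j - reg k` (and `0` if `reg j < reg k`) -/
  | sub (i j k : ℕ) : Program
  /-- `reg i := input[reg j]` (and `0` beyond the end of the input) -/
  | read (i j : ℕ) : Program
  /-- `reg i := mem[reg j]` -/
  | load (i j : ℕ) : Program
  /-- `mem[reg i] := reg j` -/
  | store (i j : ℕ) : Program
  /-- append `reg j` to the output -/
  | emit (j : ℕ) : Program
  /-- `reg i :=` the result (`0` or `1`) of the toss of a fair coin -/
  | flip (i : ℕ) : Program
  /-- first `p`, then `q` -/
  | seq (p q : Program) : Program
  /-- if `reg i ≠ 0` then `p` else `q` -/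
  | cond (i : ℕ) (p q : Program) : Program
  /-- while `reg i ≠ 0` do `p` -/
  | loop (i : ℕ) (p : Program) : Program

/-- A configuration: the stack of the programs that remain to be executed, the registers, the work
memory and the output written so far.  The machine has halted if the stack is empty. -/
structure Config where
  todo : List Program
  reg : ℕ → ℕ
  mem : ℕ → ℕ
  out : List ℕ

/-- One step of the machine on the input `inp`. A configuration that has halted does not change. -/
noncomputable def Config.step (inp : List ℕ) : Config → PMF Config
  | ⟨[], r, m, o⟩ => PMF.pure ⟨[], r, m, o⟩
  | ⟨Program.skip :: s, r, m, o⟩ => PMF.pure ⟨s, r, m, o⟩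
  | ⟨Program.const i c :: s, r, m, o⟩ => PMF.pure ⟨s, Function.update r i c, m, o⟩
  | ⟨Program.add i j k :: s, r, m, o⟩ => PMF.pure ⟨s, Function.update r i (r j + r k), m, o⟩
  | ⟨Program.sub i j k :: s, r, m, o⟩ => PMF.pure ⟨s, Function.update r i (r j - r k), m, o⟩
  | ⟨Program.read i j :: s, r, m, o⟩ =>
      PMF.pure ⟨s, Function.update r i (inp.getD (r j) 0), m, o⟩
  | ⟨Program.load i j :: s, r, m, o⟩ => PMF.pure ⟨s, Function.update r i (m (r j)), m, o⟩
  | ⟨Program.store i j :: s, r, m, o⟩ => PMF.pure ⟨s, r, Function.update m (r i) (r j), o⟩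
  | ⟨Program.emit j :: s, r, m, o⟩ => PMF.pure ⟨s, r, m, o ++ [r j]⟩
  | ⟨Program.flip i :: s, r, m, o⟩ =>
      (PMF.uniformOfFintype Bool).map fun b => ⟨s, Function.update r i b.toNat, m, o⟩
  | ⟨Program.seq p q :: s, r, m, o⟩ => PMF.pure ⟨p :: q :: s, r, m, o⟩
  | ⟨Program.cond i p q :: s, r, m, o⟩ =>
      PMF.pure ⟨(if r i ≠ 0 then p else q) :: s, r, m, o⟩
  | ⟨Program.loop i p :: s, r, m, o⟩ =>
      PMF.pure ⟨if r i ≠ 0 then p :: Program.loop i p :: s else s, r, m, o⟩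

/-- The distribution of the configuration after `t` steps. -/
noncomputable def Config.run (inp : List ℕ) : ℕ → Config → PMF Config
  | 0, c => PMF.pure c
  | t + 1, c => (c.step inp).bind (Config.run inp t)

/-- The distribution of the configuration `t` steps after `p` is started on the input `inp`, with
all registers and the memory set to `0` and an empty output. -/
noncomputable def Program.run (p : Program) (inp : List ℕ) (t : ℕ) : PMF Config :=
  Config.run inp t ⟨[p], fun _ => 0, fun _ => 0, []⟩

/-- On the input `inp`, the program `p` halts within `t` steps, whatever the coins show. -/
def Program.HaltsWithin (p : Program) (inp : List ℕ) (t : ℕ) : Prop :=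
  ∀ c ∈ (p.run inp t).support, c.todo = []

/-- The distribution of what `p` has output on `inp` after `t` steps; if `p` halts within `t`
steps, this is the distribution of its final output. -/
noncomputable def Program.outputLaw (p : Program) (inp : List ℕ) (t : ℕ) : PMF (List ℕ) :=
  (p.run inp t).map Config.out

/-- On the input `inp`, the program `p` halts within `t` steps and its output is `o`, whatever the
coins show. -/
def Program.Returns (p : Program) (inp : List ℕ) (t : ℕ) (o : List ℕ) : Prop :=
  ∀ c ∈ (p.run inp t).support, c.todo = [] ∧ c.out = o

/-! ### Databases, queries, privacy and accuracy

A database is a multiset of elements of the universe `X`.  A mechanism receives it as a list, in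
an arbitrary order, and its guarantees have to hold for every order. -/

/-- The value of a linear query on a database: the average over the elements of the database. -/
noncomputable def queryValue {X : Type*} (Q : X → ℝ) (D : Multiset X) : ℝ :=
  (D.map Q).sum / (D.card : ℝ)

/-- Two databases are neighbours if their symmetric difference has at most one element. -/
def Neighboring {X : Type*} [DecidableEq X] (D D' : Multiset X) : Prop :=
  ((D - D') + (D' - D)).card ≤ 1

/-- `(ε, δ)`-differential privacy. -/
def IsDifferentiallyPrivate {X R : Type*} [DecidableEq X] (M : List X → PMF R) (ε δ : ℝ) : Prop :=
  ∀ l l' : List X, Neighboring (l : Multiset X) (l' : Multiset X) → ∀ A : Set R,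
    (M l).toOuterMeasure A ≤
      ENNReal.ofReal (Real.exp ε) * (M l').toOuterMeasure A + ENNReal.ofReal δ

/-- `(α, β)`-accuracy on databases of size `n`, for the queries `query S` with `S ∈ 𝒬`, if queries
are evaluated on the output of the mechanism `M` by means of `Eval`. -/
def IsAccurate {X R ι : Type*} (n : ℕ) (M : List X → PMF R) (query : ι → X → ℝ) (𝒬 : Set ι)
    (Eval : ι → R → ℝ) (α β : ℝ) : Prop :=
  ∀ l : List X, l.length = n →
    ENNReal.ofReal (1 - β) ≤ (M l).toOuterMeasure
      {r | ∀ S ∈ 𝒬, |queryValue (query S) (l : Multiset X) - Eval S r| ≤ α}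

/-! ### Conjunctions -/

/-- The conjunction `x ↦ ∏ i ∈ S, x i` on the hypercube `{0,1}^d`. -/
noncomputable def conjunction {d : ℕ} (S : Finset (Fin d)) (x : Fin d → Bool) : ℝ :=
  ∏ i ∈ S, if x i then (1 : ℝ) else 0

/-- The conjunctions with exactly `d - k` of `d` literals (none if `k > d`). -/
def conjunctionsOmitting (d k : ℕ) : Set (Finset (Fin d)) :=
  {S | S.card + k = d}

/-! ### Inputs and outputs of the programs -/

/-- The public parameters, as a sequence of natural numbers. Intended for positive `ε`, `δ`, `β`. -/
def encodeParams (n d : ℕ) (ε δ β : ℚ) : List ℕ :=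
  [n, d, ε.num.toNat, ε.den, δ.num.toNat, δ.den, β.num.toNat, β.den]

/-- A point of the hypercube, as a sequence of `d` bits. -/
def encodePoint {d : ℕ} (x : Fin d → Bool) : List ℕ :=
  List.ofFn fun i => (x i).toNat

/-- The input of the mechanism: the public parameters, the number of elements of the database, and
these elements one after the other. -/
def mechanismInput {d : ℕ} (n : ℕ) (ε δ β : ℚ) (l : List (Fin d → Bool)) : List ℕ :=
  encodeParams n d ε δ β ++ [l.length] ++ l.flatMap encodePoint

/-- The input of the evaluation program: the public parameters, the `d` bits of the indicator
function of `S`, the length of the data structure `r`, and `r` itself. -/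
def evalInput {d : ℕ} (n : ℕ) (ε δ β : ℚ) (S : Finset (Fin d)) (r : List ℕ) : List ℕ :=
  encodeParams n d ε δ β ++ encodePoint (fun i => decide (i ∈ S)) ++ [r.length] ++ r

/-- The output `[a, b, c]` stands for the rational number `(a - b) / c`. -/
noncomputable def decodeAnswer : List ℕ → ℝ
  | [a, b, c] => ((a : ℝ) - (b : ℝ)) / (c : ℝ)
  | _ => 0

open scoped ENNReal

/-! ### A program logic for the machine -/

/-- The part of a configuration that programs act on. -/
structure State where
  reg : ℕ → ℕ
  mem : ℕ → ℕ
  out : List ℕ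

/-- The configuration with a given stack and a given state. -/
def State.conf (σ : State) (s : List Program) : Config := ⟨s, σ.reg, σ.mem, σ.out⟩

/-- Assign a value to a register. -/
def State.set (σ : State) (i v : ℕ) : State := ⟨Function.update σ.reg i v, σ.mem, σ.out⟩

@[simp] theorem State.set_reg (σ : State) (i v j : ℕ) :
    (σ.set i v).reg j = if j = i then v else σ.reg j := by
  simp [State.set, Function.update_apply]

@[simp] theorem State.set_mem (σ : State) (i v : ℕ) : (σ.set i v).mem = σ.mem := rfl

@[simp] theorem State.set_out (σ : State) (i v : ℕ) : (σ.set i v).out = σ.out := rfl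

/-- A bound for the running time of a program all of whose loops take at most `X` rounds. -/
noncomputable def Program.cost : Program → Polynomial ℕ
  | seq p q => p.cost + q.cost + 1
  | cond _ p q => p.cost + q.cost + 1
  | loop _ p => Polynomial.X * (p.cost + 1) + 1
  | _ => 1

/-- Whether the program has an instruction that assigns to register `i`. -/
def Program.writes (i : ℕ) : Program → Bool
  | const j _ => i == j
  | add j _ _ => i == j
  | sub j _ _ => i == j
  | read j _ => i == j
  | load j _ => i == j
  | flip j => i == j
  | seq p q => p.writes i || q.writes i
  | cond _ p q => p.writes i || q.writes i
  | loop _ p => p.writes i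
  | _ => false

/-- Whether the program has a `store` instruction. -/
def Program.stores : Program → Bool
  | store _ _ => true
  | seq p q => p.stores || q.stores
  | cond _ p q => p.stores || q.stores
  | loop _ p => p.stores
  | _ => false

/-- Whether the program has an `emit` instruction. -/
def Program.emits : Program → Bool
  | emit _ => true
  | seq p q => p.emits || q.emits
  | cond _ p q => p.emits || q.emits
  | loop _ p => p.emits
  | _ => false

/-- `σ'` differs from `σ` only where `p` can write. -/
def Frame (p : Program) (σ σ' : State) : Prop :=
  (∀ i, p.writes i = false → σ'.reg i = σ.reg i) ∧ (p.stores = false → σ'.mem = σ.mem) ∧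
    (p.emits = false → σ'.out = σ.out)

theorem Config.run_frame (inp : List ℕ) (P : Program → Prop) (F : State → State → Prop)
    (hP : ∀ (c : Config) (σ : State), (∀ p ∈ c.todo, P p) → F σ ⟨c.reg, c.mem, c.out⟩ →
      ∀ c' ∈ (c.step inp).support, (∀ p ∈ c'.todo, P p) ∧ F σ ⟨c'.reg, c'.mem, c'.out⟩)
    (σ : State) (t : ℕ) (c : Config) (hc : ∀ p ∈ c.todo, P p) (hF : F σ ⟨c.reg, c.mem, c.out⟩) :
    ∀ c' ∈ (Config.run inp t c).support, F σ ⟨c'.reg, c'.mem, c'.out⟩ := by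
  induction t generalizing c with
  | zero => intro c' h; simp [Config.run] at h; subst h; exact hF
  | succ t ih =>
    intro c' h
    simp only [Config.run, PMF.mem_support_bind_iff] at h
    obtain ⟨c₁, h₁, h₂⟩ := h
    obtain ⟨a, b⟩ := hP c σ hc hF c₁ h₁
    exact ih c₁ a b c' h₂

theorem Config.run_reg (inp : List ℕ) (i v : ℕ) (t : ℕ) (c : Config)
    (hc : ∀ p ∈ c.todo, p.writes i = false) (hF : c.reg i = v) :
    ∀ c' ∈ (Config.run inp t c).support, c'.reg i = v := by
  refine Config.run_frame inp (fun p => p.writes i = false) (fun _ σ => σ.reg i = v) ?_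
    ⟨c.reg, c.mem, c.out⟩ t c hc hF
  rintro ⟨_ | ⟨p, s⟩, r, m, o⟩ σ h1 h2 c' hc'
  · simp [Config.step] at hc'; subst hc'; exact ⟨h1, h2⟩
  · cases p <;> simp [Config.step, Program.writes] at hc' h1 h2 <;>
      (try rcases hc' with rfl | rfl) <;> (try simp_all) <;>
      (try split_ifs) <;> (try simp_all [Program.writes])

theorem Config.run_mem (inp : List ℕ) (v : ℕ → ℕ) (t : ℕ) (c : Config)
    (hc : ∀ p ∈ c.todo, p.stores = false) (hF : c.mem = v) :
    ∀ c' ∈ (Config.run inp t c).support, c'.mem = v := by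
  refine Config.run_frame inp (fun p => p.stores = false) (fun _ σ => σ.mem = v) ?_
    ⟨c.reg, c.mem, c.out⟩ t c hc hF
  rintro ⟨_ | ⟨p, s⟩, r, m, o⟩ σ h1 h2 c' hc'
  · simp [Config.step] at hc'; subst hc'; exact ⟨h1, h2⟩
  · cases p <;> simp [Config.step, Program.stores] at hc' h1 h2 <;>
      (try rcases hc' with rfl | rfl) <;> (try simp_all) <;>
      (try split_ifs) <;> (try simp_all [Program.stores])

theorem Config.run_out (inp : List ℕ) (v : List ℕ) (t : ℕ) (c : Config)
    (hc : ∀ p ∈ c.todo, p.emits = false) (hF : c.out = v) :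
    ∀ c' ∈ (Config.run inp t c).support, c'.out = v := by
  refine Config.run_frame inp (fun p => p.emits = false) (fun _ σ => σ.out = v) ?_
    ⟨c.reg, c.mem, c.out⟩ t c hc hF
  rintro ⟨_ | ⟨p, s⟩, r, m, o⟩ σ h1 h2 c' hc'
  · simp [Config.step] at hc'; subst hc'; exact ⟨h1, h2⟩
  · cases p <;> simp [Config.step, Program.emits] at hc' h1 h2 <;>
      (try rcases hc' with rfl | rfl) <;> (try simp_all) <;>
      (try split_ifs) <;> (try simp_all [Program.emits])

theorem Config.run_halted (inp : List ℕ) (t : ℕ) (σ : State) :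
    Config.run inp t (σ.conf []) = PMF.pure (σ.conf []) := by
  induction t with
  | zero => rfl
  | succ t ih => simpa [Config.run, Config.step, State.conf] using ih

theorem PMF.bind_congr_support {α β : Type*} (μ : PMF α) (f g : α → PMF β)
    (h : ∀ a ∈ μ.support, f a = g a) : μ.bind f = μ.bind g := by
  ext b
  simp only [PMF.bind_apply]
  refine tsum_congr fun a => ?_
  by_cases ha : a ∈ μ.support
  · rw [h a ha]
  · rw [(PMF.apply_eq_zero_iff μ a).2 ha]; simp

/-- Started in the state `σ`, the program `p` halts within `T` steps, and it samples `a` from `μ`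
and ends in a state that is related to `a` by `R`. -/
def SamplesIn {A : Type} (inp : List ℕ) (p : Program) (σ : State) (T : ℕ) (μ : PMF A)
    (R : A → State → Prop) : Prop :=
  ∃ κ : PMF (A × State × ℕ), κ.map Prod.fst = μ ∧ (∀ x ∈ κ.support, R x.1 x.2.1 ∧ x.2.2 ≤ T) ∧
    ∀ s t, T ≤ t → Config.run inp t (σ.conf (p :: s)) =
      κ.bind fun x => Config.run inp (t - x.2.2) (x.2.1.conf s)

namespace SamplesIn

variable {A B : Type} {inp : List ℕ} {p q : Program} {σ : State} {T T₁ T₂ : ℕ} {μ : PMF A}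
  {R : A → State → Prop}

theorem mono (h : SamplesIn inp p σ T₁ μ R) (hT : T₁ ≤ T₂) : SamplesIn inp p σ T₂ μ R := by
  obtain ⟨κ, h1, h2, h3⟩ := h
  exact ⟨κ, h1, fun x hx => ⟨(h2 x hx).1, (h2 x hx).2.trans hT⟩,
    fun s t ht => h3 s t (hT.trans ht)⟩

theorem frame (h : SamplesIn inp p σ T μ R) :
    SamplesIn inp p σ T μ (fun a σ' => a ∈ μ.support ∧ Frame p σ σ' ∧ R a σ') := by
  obtain ⟨κ, h1, h2, h3⟩ := h
  refine ⟨κ, h1, fun x hx => ⟨⟨?_, ?_, (h2 x hx).1⟩, (h2 x hx).2⟩, h3⟩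
  · rw [← h1]; exact (PMF.mem_support_map_iff _ _ _).2 ⟨x, hx, rfl⟩
  · have key : x.2.1.conf [] ∈ (Config.run inp T (σ.conf [p])).support := by
      rw [h3 [] T le_rfl, PMF.mem_support_bind_iff]
      exact ⟨x, hx, by rw [Config.run_halted]; simp⟩
    refine ⟨fun i hi => ?_, fun hi => ?_, fun hi => ?_⟩
    · exact Config.run_reg inp i (σ.reg i) T _ (by simpa [State.conf] using hi) rfl _ key
    · exact Config.run_mem inp σ.mem T _ (by simpa [State.conf] using hi) rfl _ key
    · exact Config.run_out inp σ.out T _ (by simpa [State.conf] using hi) rfl _ key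

theorem conseq {R' : A → State → Prop} (h : SamplesIn inp p σ T μ R)
    (hR : ∀ a σ', a ∈ μ.support → Frame p σ σ' → R a σ' → R' a σ') :
    SamplesIn inp p σ T μ R' := by
  obtain ⟨κ, h1, h2, h3⟩ := h.frame
  exact ⟨κ, h1, fun x hx => ⟨hR _ _ (h2 x hx).1.1 (h2 x hx).1.2.1 (h2 x hx).1.2.2,
    (h2 x hx).2⟩, h3⟩

/-- One deterministic step. -/
theorem of_step {σ' : State} {a : A} (hR : R a σ')
    (h : ∀ s, (σ.conf (p :: s)).step inp = PMF.pure (σ'.conf s)) :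
    SamplesIn inp p σ 1 (PMF.pure a) R := by
  refine ⟨PMF.pure (a, σ', 1), by rw [PMF.pure_map], ?_, ?_⟩
  · simpa using hR
  · rintro s (_ | t) ht
    · omega
    · simp [Config.run, h]

theorem seq_aux {ν : A → PMF B} {R₁ : A → State → Prop} {R₂ : B → State → Prop}
    (h₁ : SamplesIn inp p σ T₁ μ R₁)
    (h₂ : ∀ a σ', a ∈ μ.support → Frame p σ σ' → R₁ a σ' → SamplesIn inp q σ' T₂ (ν a) R₂)
    {r : Program} {σ₀ : State}
    (h : ∀ s, (σ₀.conf (r :: s)).step inp = PMF.pure (σ.conf (p :: q :: s))) :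
    SamplesIn inp r σ₀ (T₁ + T₂ + 1) (μ.bind ν) R₂ := by
  obtain ⟨κ, k1, k2, k3⟩ := h₁.frame
  have h₂' : ∀ x ∈ κ.support, SamplesIn inp q x.2.1 T₂ (ν x.1) R₂ := fun x hx =>
    h₂ _ _ (k2 x hx).1.1 (k2 x hx).1.2.1 (k2 x hx).1.2.2
  obtain ⟨x₀, hx₀⟩ := κ.support_nonempty
  obtain ⟨κ₀, -⟩ := h₂' x₀ hx₀
  have : Nonempty (PMF (B × State × ℕ)) := ⟨κ₀⟩
  unfold SamplesIn at h₂'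
  choose! f f1 f2 f3 using h₂'
  refine ⟨κ.bind fun x => (f x).map fun y => (y.1, y.2.1, x.2.2 + y.2.2 + 1), ?_, ?_, ?_⟩
  · rw [PMF.map_bind, ← k1, PMF.bind_map]
    refine PMF.bind_congr_support _ _ _ fun x hx => ?_
    rw [PMF.map_comp, Function.comp_apply, ← f1 x hx]; rfl
  · intro z hz
    simp only [PMF.mem_support_bind_iff, PMF.mem_support_map_iff] at hz
    obtain ⟨x, hx, y, hy, rfl⟩ := hz
    have a := k2 x hx
    have b := f2 x hx y hy
    refine ⟨b.1, ?_⟩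
    dsimp only
    omega
  · rintro s (_ | t) ht
    · omega
    · rw [Config.run, h, PMF.pure_bind, k3 (q :: s) t (by omega), PMF.bind_bind]
      refine PMF.bind_congr_support _ _ _ fun x hx => ?_
      have a := (k2 x hx).2
      rw [f3 x hx s (t - x.2.2) (by omega), PMF.bind_map]
      refine PMF.bind_congr_support _ _ _ fun y hy => ?_
      simp only [Function.comp_apply]
      congr 1; omega

theorem step_aux {r : Program} {σ₀ : State} (h₁ : SamplesIn inp p σ T μ R)
    (h : ∀ s, (σ₀.conf (r :: s)).step inp = PMF.pure (σ.conf (p :: s))) :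
    SamplesIn inp r σ₀ (T + 1) μ R := by
  obtain ⟨κ, k1, k2, k3⟩ := h₁
  refine ⟨κ.map fun x => (x.1, x.2.1, x.2.2 + 1), ?_, ?_, ?_⟩
  · rw [PMF.map_comp, ← k1]; rfl
  · intro z hz
    obtain ⟨x, hx, rfl⟩ := (PMF.mem_support_map_iff _ _ _).1 hz
    exact ⟨(k2 x hx).1, Nat.succ_le_succ (k2 x hx).2⟩
  · rintro s (_ | t) ht
    · omega
    · rw [Config.run, h, PMF.pure_bind, k3 s t (by omega), PMF.bind_map]
      refine PMF.bind_congr_support _ _ _ fun x hx => ?_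
      simp only [Function.comp_apply]
      congr 1; omega

end SamplesIn

/-- Started in the state `σ`, with all loops taking at most `M` rounds, the program `p` samples `a`
from `μ` and ends in a state that is related to `a` by `R`. -/
def Samples {A : Type} (M : ℕ) (inp : List ℕ) (p : Program) (σ : State) (μ : PMF A)
    (R : A → State → Prop) : Prop :=
  SamplesIn inp p σ (p.cost.eval M) μ R

/-- `Samples` for deterministic programs. -/
def Computes (M : ℕ) (inp : List ℕ) (p : Program) (σ : State) (Q : State → Prop) : Prop :=
  Samples M inp p σ (PMF.pure ()) fun _ => Q

/-- The toss of a fair coin. -/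
noncomputable def coin : PMF ℕ := (PMF.uniformOfFintype Bool).map Bool.toNat

/-- The law of the result of `m` rounds of a random iteration. -/
noncomputable def iterLaw {A : Type*} (ν : ℕ → A → PMF A) : ℕ → A → PMF A
  | 0, a => PMF.pure a
  | m + 1, a => (iterLaw ν m a).bind (ν m)

theorem iterLaw_succ' {A : Type*} (ν : ℕ → A → PMF A) (m : ℕ) (a : A) :
    iterLaw ν (m + 1) a = (ν 0 a).bind (iterLaw (fun i => ν (i + 1)) m) := by
  induction m with
  | zero =>
    simp only [iterLaw, PMF.pure_bind]
    exact (PMF.bind_pure _).symm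
  | succ m ih => rw [iterLaw, ih, PMF.bind_bind]; rfl

theorem iterLaw_pure {A : Type*} (f : ℕ → A → A) (m : ℕ) (a : A) :
    iterLaw (fun i x => PMF.pure (f i x)) m a = PMF.pure (Nat.rec a f m) := by
  induction m with
  | zero => rfl
  | succ m ih => simp [iterLaw, ih]

/-- Repeat `body` as often as register `c` says; register `1` is supposed to contain `1`. -/
def forDo (c : ℕ) (body : Program) : Program := Program.loop c (Program.seq body (Program.sub c c 1))

/-- The sequential composition of a list of programs. -/
def block : List Program → Program
  | [] => Program.skip
  | p :: ps => Program.seq p (block ps)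

/-- Programs without loops and coin tosses. -/
def Program.straight : Program → Bool
  | seq p q => p.straight && q.straight
  | cond _ p q => p.straight && q.straight
  | loop _ _ => false
  | flip _ => false
  | _ => true

/-- The effect of a program without loops and coin tosses. -/
def Program.exec (inp : List ℕ) : Program → State → State
  | const i c, σ => σ.set i c
  | add i j k, σ => σ.set i (σ.reg j + σ.reg k)
  | sub i j k, σ => σ.set i (σ.reg j - σ.reg k)
  | read i j, σ => σ.set i (inp.getD (σ.reg j) 0)
  | load i j, σ => σ.set i (σ.mem (σ.reg j))
  | store i j, σ => ⟨σ.reg, Function.update σ.mem (σ.reg i) (σ.reg j), σ.out⟩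
  | emit j, σ => ⟨σ.reg, σ.mem, σ.out ++ [σ.reg j]⟩
  | seq p q, σ => q.exec inp (p.exec inp σ)
  | cond i p q, σ => if σ.reg i ≠ 0 then p.exec inp σ else q.exec inp σ
  | _, σ => σ

namespace Samples

variable {A B : Type} {M : ℕ} {inp : List ℕ} {p q : Program} {σ : State} {μ : PMF A}
  {R : A → State → Prop}

theorem conseq {R' : A → State → Prop} (h : Samples M inp p σ μ R)
    (hR : ∀ a σ', a ∈ μ.support → Frame p σ σ' → R a σ' → R' a σ') : Samples M inp p σ μ R' :=
  SamplesIn.conseq h hR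

theorem seq {ν : A → PMF B} {R₁ : A → State → Prop} {R₂ : B → State → Prop}
    (h₁ : Samples M inp p σ μ R₁)
    (h₂ : ∀ a σ', a ∈ μ.support → Frame p σ σ' → R₁ a σ' → Samples M inp q σ' (ν a) R₂) :
    Samples M inp (p.seq q) σ (μ.bind ν) R₂ := by
  have := SamplesIn.seq_aux h₁ h₂ (r := p.seq q) (σ₀ := σ) (fun s => rfl)
  exact this.mono (by simp [Program.cost])

theorem straight {a : A} (hp : p.straight = true) (hR : R a (p.exec inp σ)) :
    Samples M inp p σ (PMF.pure a) R := by
  induction p generalizing A a σ R with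
  | seq p q ihp ihq =>
    simp only [Program.straight, Bool.and_eq_true] at hp
    have := Samples.seq (μ := PMF.pure ()) (ν := fun _ => PMF.pure a)
      (R₁ := fun _ σ' => σ' = p.exec inp σ) (ihp (a := ()) hp.1 rfl) (fun _ σ' _ _ h => by
        subst h; exact ihq hp.2 hR)
    simpa using this
  | cond i p q ihp ihq =>
    simp only [Program.straight, Bool.and_eq_true] at hp
    simp only [Program.exec] at hR
    by_cases hi : σ.reg i ≠ 0
    · rw [if_pos hi] at hR
      refine (SamplesIn.step_aux (ihp hp.1 hR) (r := p.cond i q) (σ₀ := σ) ?_).mono ?_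
      · intro s; simp only [State.conf, Config.step, if_pos hi]
      · simp [Program.cost]
    · rw [if_neg hi] at hR
      refine (SamplesIn.step_aux (ihq hp.2 hR) (r := p.cond i q) (σ₀ := σ) ?_).mono ?_
      · intro s; simp only [State.conf, Config.step, if_neg hi]
      · simp [Program.cost]
  | loop i p ih => simp [Program.straight] at hp
  | flip i => simp [Program.straight] at hp
  | _ =>
    exact SamplesIn.mono (SamplesIn.of_step hR fun s => rfl) (by simp [Program.cost])

theorem cond {i : ℕ} (h₁ : σ.reg i ≠ 0 → Samples M inp p σ μ R)
    (h₂ : σ.reg i = 0 → Samples M inp q σ μ R) : Samples M inp (p.cond i q) σ μ R := by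
  by_cases hi : σ.reg i ≠ 0
  · refine (SamplesIn.step_aux (h₁ hi) (r := p.cond i q) (σ₀ := σ) ?_).mono ?_
    · intro s; simp only [State.conf, Config.step, if_pos hi]
    · simp [Program.cost]
  · refine (SamplesIn.step_aux (h₂ (not_not.1 hi)) (r := p.cond i q) (σ₀ := σ) ?_).mono ?_
    · intro s; simp only [State.conf, Config.step, if_neg hi]
    · simp [Program.cost]

theorem flip {i : ℕ} {R : ℕ → State → Prop}
    (hR : ∀ b ≤ 1, R b (σ.set i b)) : Samples M inp (Program.flip i) σ coin R := by
  refine ⟨(PMF.uniformOfFintype Bool).map fun b => (b.toNat, σ.set i b.toNat, 1), ?_, ?_, ?_⟩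
  · rw [PMF.map_comp]; rfl
  · intro x hx
    obtain ⟨b, -, rfl⟩ := (PMF.mem_support_map_iff _ _ _).1 hx
    exact ⟨hR _ (Bool.toNat_le b), by simp [Program.cost]⟩
  · rintro s (_ | t) ht
    · simp [Program.cost] at ht
    · simp only [Config.run, State.conf, Config.step, PMF.bind_map]; rfl

theorem flip_seq {i : ℕ} {f : ℕ → A}
    (h : ∀ b ≤ 1, Samples M inp p (σ.set i b) (PMF.pure (f b)) R) :
    Samples M inp ((Program.flip i).seq p) σ (coin.map f) R := by
  have := Samples.seq (M := M) (inp := inp) (q := p) (ν := fun b => PMF.pure (f b))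
    (R₁ := fun b σ' => b ≤ 1 ∧ σ' = σ.set i b) (flip (i := i) (σ := σ) fun b hb => ⟨hb, rfl⟩)
    (R₂ := R) (fun b σ' _ _ h' => by obtain ⟨hb, rfl⟩ := h'; exact h b hb)
  rwa [← PMF.bind_pure_comp]

theorem loop_zero {i : ℕ} {a : A} (hi : σ.reg i = 0) (hR : R a σ) :
    SamplesIn inp (p.loop i) σ 1 (PMF.pure a) R :=
  SamplesIn.of_step hR fun s => by simp [State.conf, Config.step, hi]

theorem loop_aux {c : ℕ} {body : Program} (hc : body.writes c = false)
    (h1 : body.writes 1 = false) (hc1 : c ≠ 1) {σ₀ : State} {m : ℕ} (j : ℕ) :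
    ∀ (i : ℕ) (I : ℕ → A → State → Prop) (ν : ℕ → A → PMF A) (σ : State) (a : A),
      i + j = m → σ.reg 1 = 1 → σ.reg c = j → Frame (forDo c body) σ₀ σ → I i a σ →
      (∀ i a σ, i < m → Frame (forDo c body) σ₀ σ → σ.reg 1 = 1 → I i a σ →
        Samples M inp body σ (ν i a) (fun a' σ' => ∀ v, I (i + 1) a' (σ'.set c v))) →
      SamplesIn inp (forDo c body) σ (j * (body.cost.eval M + 3) + 1)
        (iterLaw (fun r => ν (i + r)) j a) (I m) := by
  induction j with
  | zero =>
    intro i I ν σ a hi _ hσ _ hI _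
    obtain rfl : i = m := by omega
    rw [zero_mul, zero_add]
    exact loop_zero hσ hI
  | succ j ih =>
    intro i I ν σ a hi hσ1 hσc hF hI step
    rw [iterLaw_succ']
    have hb := step i a σ (by omega) hF hσ1 hI
    have hb' : Samples M inp (body.seq (Program.sub c c 1)) σ (ν i a) (fun a' σ' =>
        I (i + 1) a' σ' ∧ σ'.reg c = j ∧ σ'.reg 1 = 1 ∧ Frame (forDo c body) σ₀ σ') := by
      have := Samples.seq (ν := PMF.pure) hb (q := Program.sub c c 1) (R₂ := fun a' σ' =>
          I (i + 1) a' σ' ∧ σ'.reg c = j ∧ σ'.reg 1 = 1 ∧ Frame (forDo c body) σ₀ σ') ?_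
      · rwa [PMF.bind_pure] at this
      · intro a' σ' _ hF' hI'
        refine straight rfl ⟨hI' _, ?_, ?_, ?_⟩
        · simp [Program.exec, hF'.1 c hc, hF'.1 1 h1, hσc, hσ1]
        · simp [Program.exec, hF'.1 1 h1, hσ1, hc1.symm]
        · refine ⟨fun r hr => ?_, fun hr => ?_, fun hr => ?_⟩
          · have hr' := hr
            simp only [forDo, Program.writes, Bool.or_eq_false_iff, beq_eq_false_iff_ne] at hr'
            simp [Program.exec, hr'.2, hF'.1 r hr'.1, hF.1 r hr]
          · have hr' := hr
            simp only [forDo, Program.stores, Bool.or_false] at hr'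
            simp [Program.exec, hF'.2.1 hr', hF.2.1 hr]
          · have hr' := hr
            simp only [forDo, Program.emits, Bool.or_false] at hr'
            simp [Program.exec, hF'.2.2 hr', hF.2.2 hr]
    have := SamplesIn.seq_aux (ν := iterLaw (fun r => ν (i + (r + 1))) j)
      (T₂ := j * (body.cost.eval M + 3) + 1) (R₂ := I m) hb' (q := forDo c body) ?_
      (r := forDo c body) (σ₀ := σ) ?_
    · refine SamplesIn.mono this ?_
      simp [Program.cost]; ring_nf; omega
    · rintro a' σ' - - ⟨k1, k2, k3, k4⟩
      have := ih (i + 1) I ν σ' a' (by omega) k3 k2 k4 k1 step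
      convert this using 4 with r
      ring
    · intro s
      simp [State.conf, Config.step, forDo, hσc]

/-- The rule for loops with the invariant `I`. -/
theorem forDo {c : ℕ} {body : Program} (I : ℕ → A → State → Prop) (ν : ℕ → A → PMF A) (m : ℕ)
    (a : A) (hc : body.writes c = false) (h1 : body.writes 1 = false) (hc1 : c ≠ 1) (hm : m ≤ M)
    (hσ1 : σ.reg 1 = 1) (hσc : σ.reg c = m) (h0 : I 0 a σ)
    (step : ∀ i a σ', i < m → Frame (forDo c body) σ σ' → σ'.reg 1 = 1 → I i a σ' →
      Samples M inp body σ' (ν i a) (fun a' σ'' => ∀ v, I (i + 1) a' (σ''.set c v))) :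
    Samples M inp (_root_.forDo c body) σ (iterLaw ν m a) (I m) := by
  have := loop_aux (M := M) (inp := inp) hc h1 hc1 (σ₀ := σ) m 0 I ν σ a (by omega) hσ1 hσc
    ⟨fun _ _ => rfl, fun _ => rfl, fun _ => rfl⟩ h0 step
  simp only [zero_add] at this
  refine SamplesIn.mono this ?_
  have : (_root_.forDo c body).cost.eval M = M * (body.cost.eval M + 3) + 1 := by
    simp [_root_.forDo, Program.cost, add_assoc]
  rw [this]
  gcongr

theorem map {f : A → B} {R' : B → State → Prop} (h : Samples M inp p σ μ R)
    (hR : ∀ a σ', R a σ' → R' (f a) σ') : Samples M inp p σ (μ.map f) R' := by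
  obtain ⟨κ, k1, k2, k3⟩ := h
  refine ⟨κ.map fun x => (f x.1, x.2), ?_, ?_, ?_⟩
  · rw [← k1, PMF.map_comp, PMF.map_comp]; rfl
  · intro z hz
    obtain ⟨x, hx, rfl⟩ := (PMF.mem_support_map_iff _ _ _).1 hz
    exact ⟨hR _ _ (k2 x hx).1, (k2 x hx).2⟩
  · intro s t ht
    rw [k3 s t ht, PMF.bind_map]; rfl

theorem straight_seq (hp : p.straight = true) (h : Samples M inp q (p.exec inp σ) μ R) :
    Samples M inp (p.seq q) σ μ R := by
  have := Samples.seq (μ := PMF.pure ()) (ν := fun _ => μ)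
    (R₁ := fun _ σ' => σ' = p.exec inp σ) (straight (M := M) (inp := inp) hp rfl)
    (fun _ σ' _ _ h' => by subst h'; exact h)
  rwa [PMF.pure_bind] at this

theorem seq_straight {f : A → B} {R' : B → State → Prop} (h : Samples M inp p σ μ R)
    (hq : q.straight = true)
    (hR : ∀ a σ', a ∈ μ.support → Frame p σ σ' → R a σ' → R' (f a) (q.exec inp σ')) :
    Samples M inp (p.seq q) σ (μ.map f) R' := by
  rw [← PMF.bind_pure_comp]
  exact Samples.seq h fun a σ' h1 h2 h3 => straight hq (hR a σ' h1 h2 h3)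

theorem block_nil {a : A} (hR : R a σ) : Samples M inp (block []) σ (PMF.pure a) R :=
  straight rfl hR

end Samples

namespace Computes

variable {A : Type} {M : ℕ} {inp : List ℕ} {p q : Program} {σ : State} {μ : PMF A}
  {R : A → State → Prop} {Q Q' : State → Prop}

theorem conseq (h : Computes M inp p σ Q) (hQ : ∀ σ', Frame p σ σ' → Q σ' → Q' σ') :
    Computes M inp p σ Q' :=
  Samples.conseq h fun _ σ' _ => hQ σ'

theorem straight (hp : p.straight = true) (hR : Q (p.exec inp σ)) : Computes M inp p σ Q :=
  Samples.straight hp hR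

theorem seq_samples (h₁ : Computes M inp p σ Q)
    (h₂ : ∀ σ', Frame p σ σ' → Q σ' → Samples M inp q σ' μ R) :
    Samples M inp (p.seq q) σ μ R := by
  have := Samples.seq (ν := fun _ => μ) h₁ (fun _ σ' _ => h₂ σ')
  rwa [PMF.pure_bind] at this

theorem seq (h₁ : Computes M inp p σ Q) (h₂ : ∀ σ', Frame p σ σ' → Q σ' → Computes M inp q σ' Q') :
    Computes M inp (p.seq q) σ Q' :=
  seq_samples h₁ h₂

/-- The rule for deterministic loops with the invariant `I`. -/
theorem forDo {c : ℕ} {body : Program} (I : ℕ → State → Prop) (m : ℕ)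
    (hc : body.writes c = false) (h1 : body.writes 1 = false) (hc1 : c ≠ 1) (hm : m ≤ M)
    (hσ1 : σ.reg 1 = 1) (hσc : σ.reg c = m) (h0 : I 0 σ)
    (step : ∀ i σ', i < m → Frame (forDo c body) σ σ' → σ'.reg 1 = 1 → I i σ' →
      Computes M inp body σ' (fun σ'' => ∀ v, I (i + 1) (σ''.set c v))) :
    Computes M inp (_root_.forDo c body) σ (I m) := by
  have := Samples.forDo (M := M) (inp := inp) (fun i (_ : Unit) σ => I i σ)
    (fun _ a => PMF.pure a) m () hc h1 hc1 hm hσ1 hσc h0 (fun i _ σ' => step i σ')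
  rw [iterLaw_pure (fun _ a => a)] at this
  exact this

theorem straight_seq (hp : p.straight = true) (h : Computes M inp q (p.exec inp σ) Q) :
    Computes M inp (p.seq q) σ Q :=
  Samples.straight_seq hp h

theorem block_nil (h : Q σ) : Computes M inp (block []) σ Q := Samples.block_nil h

end Computes

/-- A program that samples halts, and the law of its output is the law of what it samples. -/
theorem Samples.halts {A : Type} {M : ℕ} {inp : List ℕ} {p : Program} {μ : PMF A}
    {enc : A → List ℕ} (h : Samples M inp p ⟨fun _ => 0, fun _ => 0, []⟩ μ
      fun a σ => σ.out = enc a) {t : ℕ} (ht : p.cost.eval M ≤ t) :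
    p.HaltsWithin inp t ∧ p.outputLaw inp t = μ.map enc := by
  obtain ⟨κ, k1, k2, k3⟩ := h
  have key : p.run inp t = κ.map fun x => x.2.1.conf [] := by
    rw [Program.run]
    refine (k3 [] t ht).trans ?_
    rw [← PMF.bind_pure_comp]
    exact PMF.bind_congr_support _ _ _ fun x _ => by rw [Config.run_halted]; rfl
  constructor
  · intro c hc
    rw [key] at hc
    obtain ⟨x, -, rfl⟩ := (PMF.mem_support_map_iff _ _ _).1 hc
    rfl
  · rw [Program.outputLaw, key, PMF.map_comp, ← k1, PMF.map_comp, ← PMF.bind_pure_comp,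
      ← PMF.bind_pure_comp]
    refine PMF.bind_congr_support _ _ _ fun x hx => ?_
    simp only [Function.comp_apply, State.conf, (k2 x hx).1]

theorem Computes.returns {M : ℕ} {inp : List ℕ} {p : Program} {o : List ℕ}
    (h : Computes M inp p ⟨fun _ => 0, fun _ => 0, []⟩ fun σ => σ.out = o) {t : ℕ}
    (ht : p.cost.eval M ≤ t) : p.Returns inp t o := by
  obtain ⟨h1, h2⟩ := Samples.halts (enc := fun _ => o) h ht
  intro c hc
  refine ⟨h1 c hc, ?_⟩
  have : c.out ∈ (p.outputLaw inp t).support := (PMF.mem_support_map_iff _ _ _).2 ⟨c, hc, rfl⟩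
  rw [h2, PMF.pure_map] at this
  simpa using this

/-! ### Arithmetic on the machine -/

/-- The number of times that `a` has to be doubled to reach `b`, but at most `m`. -/
def doublings (a b : ℕ) : ℕ → ℕ
  | 0 => 0
  | m + 1 => if a * 2 ^ doublings a b m < b then doublings a b m + 1 else doublings a b m

theorem doublings_le (a b m : ℕ) : doublings a b m ≤ m := by
  induction m with
  | zero => rfl
  | succ m ih => rw [doublings]; split_ifs <;> omega

theorem lt_of_lt_doublings {a b m i : ℕ} (hi : i < doublings a b m) : a * 2 ^ i < b := by
  induction m with
  | zero => simp [doublings] at hi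
  | succ m ih =>
    rw [doublings] at hi
    split_ifs at hi with h
    · refine lt_of_le_of_lt ?_ h
      gcongr
      · norm_num
      · omega
    · exact ih hi

theorem le_mul_pow_doublings {a b m j : ℕ} (hj : j ≤ m) (h : b ≤ a * 2 ^ j) :
    b ≤ a * 2 ^ doublings a b m := by
  induction m generalizing j with
  | zero => obtain rfl : j = 0 := by omega
            exact h
  | succ m ih =>
    rw [doublings]
    split_ifs with h'
    · by_cases hlt : doublings a b m < m
      · exfalso
        have key : ∀ m, doublings a b m < m → b ≤ a * 2 ^ doublings a b m := by
          intro m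
          induction m with
          | zero => omega
          | succ m ih =>
            intro h
            rw [doublings] at h ⊢
            split_ifs at h ⊢ with h1
            · by_contra h2
              have := ih (by omega)
              omega
            · omega
        have := key m hlt
        omega
      · have := doublings_le a b m
        obtain h0 : doublings a b m = m := by omega
        rw [h0]
        refine h.trans ?_
        gcongr
        norm_num
    · omega

/-- Double register `20` until it is at least register `21`, but at most as often as register `22`
says; count in register `23`, and add to register `25` what is lacking at the end. -/
def doubleP : Program :=
  block [.const 23 0,
    forDo 22 (block [.sub 24 21 20,
      .cond 24 (block [.add 20 20 20, .add 23 23 1]) .skip]),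
    .sub 24 21 20, .add 25 25 24]

/-- Multiply registers `20` and `22`, with the result in register `23`. -/
def mulP : Program := block [.const 23 0, forDo 22 (.add 23 23 20)]

/-- Double register `20` as often as register `22` says. -/
def shiftP : Program := forDo 22 (.add 20 20 20)

theorem doubleP_spec {M : ℕ} {inp : List ℕ} {σ : State} {a b m : ℕ} (h1 : σ.reg 1 = 1)
    (ha : σ.reg 20 = a) (hb : σ.reg 21 = b) (hm : σ.reg 22 = m) (hM : m ≤ M) :
    Computes M inp doubleP σ fun σ' => σ'.reg 23 = doublings a b m ∧
      σ'.reg 25 = σ.reg 25 + (b - a * 2 ^ doublings a b m) := by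
  refine Computes.seq (Q := fun σ' => σ' = σ.set 23 0) (Computes.straight rfl rfl) ?_
  rintro σ' hF rfl
  refine Computes.seq (Q := fun σ' => σ'.reg 23 = doublings a b m ∧ σ'.reg 21 = b ∧
      σ'.reg 20 = a * 2 ^ doublings a b m ∧ σ'.reg 25 = σ.reg 25) (Computes.forDo
    (fun i σ' => σ'.reg 23 = doublings a b i ∧ σ'.reg 21 = b ∧
      σ'.reg 20 = a * 2 ^ doublings a b i ∧ σ'.reg 25 = σ.reg 25) m rfl rfl (by decide) hM
    (by simp [h1]) (by simp [hm]) (by simp [doublings, ha, hb]) ?_) ?_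
  · rintro i σ' hi hF h1 ⟨k1, k2, k3, k4⟩
    refine Computes.straight rfl fun v => ?_
    by_cases h : a * 2 ^ doublings a b i < b
    · have : b - a * 2 ^ doublings a b i ≠ 0 := by omega
      simp only [block, Program.exec, State.set_reg, k1, k2, k3, h1]
      simp [doublings, this, h, k2, k4]
      ring
    · have : b - a * 2 ^ doublings a b i = 0 := by omega
      simp [block, Program.exec, doublings, this, h, k1, k2, k3, k4]
  · rintro σ' hF' ⟨k1, k2, k3, k4⟩
    exact Computes.straight rfl (by simp [block, Program.exec, k1, k2, k3, k4])

theorem mulP_spec {M : ℕ} {inp : List ℕ} {σ : State} {a m : ℕ} (h1 : σ.reg 1 = 1)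
    (ha : σ.reg 20 = a) (hm : σ.reg 22 = m) (hM : m ≤ M) :
    Computes M inp mulP σ fun σ' => σ'.reg 23 = a * m := by
  refine Computes.seq (Q := fun σ' => σ' = σ.set 23 0) (Computes.straight rfl rfl) ?_
  rintro σ' hF rfl
  refine Computes.seq (Computes.forDo (fun i σ' => σ'.reg 23 = a * i ∧ σ'.reg 20 = a) m rfl rfl
    (by decide) hM (by simp [h1]) (by simp [hm]) (by simp [ha]) ?_) ?_
  · rintro i σ' hi hF h1 ⟨k1, k2⟩
    exact Computes.straight rfl fun v => by simp [Program.exec, k1, k2, mul_add]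
  · rintro σ' hF' ⟨k1, k2⟩
    exact Computes.block_nil k1

theorem shiftP_spec {M : ℕ} {inp : List ℕ} {σ : State} {a m : ℕ} (h1 : σ.reg 1 = 1)
    (ha : σ.reg 20 = a) (hm : σ.reg 22 = m) (hM : m ≤ M) :
    Computes M inp shiftP σ fun σ' => σ'.reg 20 = a * 2 ^ m := by
  refine Computes.forDo (fun i σ' => σ'.reg 20 = a * 2 ^ i) m rfl rfl
    (by decide) hM (by simp [h1]) (by simp [hm]) (by simp [ha]) ?_
  intro i σ' hi hF h1 k1
  refine Computes.straight rfl fun v => ?_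
  simp [Program.exec, k1, pow_succ]
  ring

/-- The registers have the values that are listed. -/
def Holds (σ : State) (L : List (ℕ × ℕ)) : Prop := ∀ x ∈ L, σ.reg x.1 = x.2

@[simp] theorem holds_nil (σ : State) : Holds σ [] := by simp [Holds]

@[simp] theorem holds_cons (σ : State) (x : ℕ × ℕ) (L : List (ℕ × ℕ)) :
    Holds σ (x :: L) ↔ σ.reg x.1 = x.2 ∧ Holds σ L := by simp [Holds]

/-- Program the assignment `i := doublings a b m`, where registers `20`, `21`, `22` are prepared by
`pre`. -/
theorem Computes.doubleInto {M : ℕ} {inp : List ℕ} {σ : State} {i a b m r : ℕ}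
    {L : List (ℕ × ℕ)} {pre : Program} (hpre : pre.straight = true)
    (hσ : Holds (pre.exec inp σ) ((1, 1) :: (20, a) :: (21, b) :: (22, m) :: (25, r) :: (0, 0) :: L))
    (hM : m ≤ M) (hL : (L.all fun x => !(doubleP.writes x.1 || i == x.1)) = true)
    (hi : 25 ≠ i ∧ 1 ≠ i ∧ 0 ≠ i) :
    Computes M inp (block [pre, doubleP, .add i 23 0]) σ fun σ' =>
      Holds σ' ((i, doublings a b m) :: (25, r + (b - a * 2 ^ doublings a b m)) :: (0, 0) ::
        (1, 1) :: L) := by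
  refine Computes.seq (Q := fun σ' => σ' = pre.exec inp σ) (Computes.straight hpre rfl) ?_
  rintro σ₁ - rfl
  simp only [holds_cons] at hσ
  obtain ⟨h1, ha, hb, hm, hr, h0, hσL⟩ := hσ
  refine Computes.seq (doubleP_spec h1 ha hb hm hM) ?_
  rintro σ₂ hF ⟨k1, k2⟩
  have e0 : σ₂.reg 0 = 0 := by rw [hF.1 0 rfl, h0]
  have e1 : σ₂.reg 1 = 1 := by rw [hF.1 1 rfl, h1]
  refine Computes.straight rfl ?_
  simp only [block, Program.exec, holds_cons, State.set_reg, if_neg hi.1, if_neg hi.2.1,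
    if_neg hi.2.2, k1, k2, hr, e0, e1]
  refine ⟨by simp, trivial, trivial, trivial, fun x hx => ?_⟩
  have := List.all_eq_true.1 hL x hx
  simp only [Bool.not_eq_true', Bool.or_eq_false_iff, beq_eq_false_iff_ne] at this
  rw [State.set_reg, if_neg (Ne.symm this.2), hF.1 _ this.1, hσL x hx]

theorem Computes.mulInto {M : ℕ} {inp : List ℕ} {σ : State} {i a m : ℕ}
    {L : List (ℕ × ℕ)} {pre : Program} (hpre : pre.straight = true)
    (hσ : Holds (pre.exec inp σ) ((1, 1) :: (20, a) :: (22, m) :: (0, 0) :: L))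
    (hM : m ≤ M) (hL : (L.all fun x => !(mulP.writes x.1 || i == x.1)) = true)
    (hi : 1 ≠ i ∧ 0 ≠ i) :
    Computes M inp (block [pre, mulP, .add i 23 0]) σ fun σ' =>
      Holds σ' ((i, a * m) :: (0, 0) :: (1, 1) :: L) := by
  refine Computes.seq (Q := fun σ' => σ' = pre.exec inp σ) (Computes.straight hpre rfl) ?_
  rintro σ₁ - rfl
  simp only [holds_cons] at hσ
  obtain ⟨h1, ha, hm, h0, hσL⟩ := hσ
  refine Computes.seq (mulP_spec h1 ha hm hM) ?_
  rintro σ₂ hF k1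
  have e0 : σ₂.reg 0 = 0 := by rw [hF.1 0 rfl, h0]
  have e1 : σ₂.reg 1 = 1 := by rw [hF.1 1 rfl, h1]
  refine Computes.straight rfl ?_
  simp only [block, Program.exec, holds_cons, State.set_reg, if_neg hi.1, if_neg hi.2,
    k1, e0, e1]
  refine ⟨by simp, trivial, trivial, fun x hx => ?_⟩
  have := List.all_eq_true.1 hL x hx
  simp only [Bool.not_eq_true', Bool.or_eq_false_iff, beq_eq_false_iff_ne] at this
  rw [State.set_reg, if_neg (Ne.symm this.2), hF.1 _ this.1, hσL x hx]

theorem Computes.shiftInto {M : ℕ} {inp : List ℕ} {σ : State} {i a m : ℕ}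
    {L : List (ℕ × ℕ)} {pre : Program} (hpre : pre.straight = true)
    (hσ : Holds (pre.exec inp σ) ((1, 1) :: (20, a) :: (22, m) :: (0, 0) :: L))
    (hM : m ≤ M) (hL : (L.all fun x => !(shiftP.writes x.1 || i == x.1)) = true)
    (hi : 1 ≠ i ∧ 0 ≠ i) :
    Computes M inp (block [pre, shiftP, .add i 20 0]) σ fun σ' =>
      Holds σ' ((i, a * 2 ^ m) :: (0, 0) :: (1, 1) :: L) := by
  refine Computes.seq (Q := fun σ' => σ' = pre.exec inp σ) (Computes.straight hpre rfl) ?_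
  rintro σ₁ - rfl
  simp only [holds_cons] at hσ
  obtain ⟨h1, ha, hm, h0, hσL⟩ := hσ
  refine Computes.seq (shiftP_spec h1 ha hm hM) ?_
  rintro σ₂ hF k1
  have e0 : σ₂.reg 0 = 0 := by rw [hF.1 0 rfl, h0]
  have e1 : σ₂.reg 1 = 1 := by rw [hF.1 1 rfl, h1]
  refine Computes.straight rfl ?_
  simp only [block, Program.exec, holds_cons, State.set_reg, if_neg hi.1, if_neg hi.2,
    k1, e0, e1]
  refine ⟨by simp, trivial, trivial, fun x hx => ?_⟩
  have := List.all_eq_true.1 hL x hx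
  simp only [Bool.not_eq_true', Bool.or_eq_false_iff, beq_eq_false_iff_ne] at this
  rw [State.set_reg, if_neg (Ne.symm this.2), hF.1 _ this.1, hσL x hx]

/-! ### The parameters of the mechanism -/

/-- The public parameters: `ε = e₁ / e₂`, `δ = d₁ / d₂`, `β = b₁ / b₂`. -/
structure Params where
  (n d e₁ e₂ d₁ d₂ b₁ b₂ : ℕ)

namespace Params

variable (p : Params)

/-- The public parameters as part of the input. -/
def toList : List ℕ := [p.n, p.d, p.e₁, p.e₂, p.d₁, p.d₂, p.b₁, p.b₂]

/-- The number of literals that a query omits. -/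
def k : ℕ := doublings 2 (p.n + 1) p.n

/-- The logarithm of the dimension. -/
def logDim : ℕ := doublings 1 p.d p.d

/-- The logarithm of `1 / β`. -/
def logConf : ℕ := doublings p.b₁ p.b₂ p.n

/-- The number of repetitions. -/
def reps : ℕ := p.logDim * p.k + p.logConf

/-- The logarithm of `reps / δ`. -/
def logDelta : ℕ := doublings p.d₁ (p.d₂ * p.reps) (4 * p.n)

/-- The logarithm of `1 / ε`. -/
def logEps : ℕ := doublings p.e₁ p.e₂ (p.k + 1)

/-- The number of coins that are added to a cell. -/
def coins : ℕ := p.reps * p.reps * (p.logDelta + 1) * 2 ^ (2 * p.logEps + 7)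

/-- The number of bits of a coordinate of the hash function. -/
def bits : ℕ := 2 * p.k + 10

/-- The number of cells of a table. -/
def cells : ℕ := 2 ^ p.bits * p.d

/-- The number of coins that are added to the cells that belong to a query. -/
def offset : ℕ := p.coins * 2 ^ p.k

/-- This is zero if and only if the mechanism uses the data. -/
def defect : ℕ :=
  (p.n + 1 - 2 * 2 ^ p.k) + (p.d - 1 * 2 ^ p.logDim) + (p.b₂ - p.b₁ * 2 ^ p.logConf) +
    (p.d₂ * p.reps - p.d₁ * 2 ^ p.logDelta) + (p.e₂ - p.e₁ * 2 ^ p.logEps) + (2 - p.n) + (2 - p.d)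

end Params

/-- Compute the parameters. -/
def paramsP : Program :=
  block [
    block [.const 1 1, .const 2 0, .read 10 2, .const 2 1, .read 11 2, .const 2 8, .read 12 2],
    block [block [.const 20 2, .add 21 10 1, .add 22 10 0], doubleP, .add 13 23 0],
    block [block [.const 20 1, .add 21 11 0, .add 22 11 0], doubleP, .add 14 23 0],
    block [block [.const 2 6, .read 20 2, .const 2 7, .read 21 2, .add 22 10 0], doubleP,
      .add 15 23 0],
    block [block [.add 20 14 0, .add 22 13 0], mulP, .add 16 23 0],
    block [block [.add 16 16 15, .const 2 5, .read 20 2, .add 22 16 0], mulP, .add 17 23 0],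
    block [block [.const 2 4, .read 20 2, .add 21 17 0, .add 22 10 10, .add 22 22 22], doubleP,
      .add 17 23 0],
    block [block [.const 2 2, .read 20 2, .const 2 3, .read 21 2, .add 22 13 1], doubleP,
      .add 18 23 0],
    block [block [.add 20 16 0, .add 22 16 0], mulP, .add 19 23 0],
    block [block [.add 20 19 0, .add 22 17 1], mulP, .add 19 23 0],
    block [block [.add 20 19 0, .const 2 7, .add 22 18 18, .add 22 22 2], shiftP, .add 19 20 0],
    block [block [.const 20 1, .add 22 13 0], shiftP, .add 26 20 0],
    block [block [.const 2 10, .add 27 13 13, .add 27 27 2, .const 20 1, .add 22 27 0], shiftP,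
      .add 28 20 0],
    block [block [.add 20 28 0, .add 22 11 0], mulP, .add 28 23 0],
    block [block [.add 20 19 0, .add 22 26 0], mulP, .add 29 23 0],
    block [.const 2 2, .sub 24 2 10, .add 25 25 24, .sub 24 2 11, .add 25 25 24]]

theorem paramsP_spec {M len : ℕ} {p : Params} {w : List ℕ}
    (hM : p.n + p.d + 4 * p.n + (p.k + 1) + p.reps + (p.logDelta + 1) +
      (2 * p.logEps + 7) + p.bits ≤ M) (hM' : 2 ^ p.k ≤ M) :
    Computes M (p.toList ++ [len] ++ w) paramsP ⟨fun _ => 0, fun _ => 0, []⟩ fun σ =>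
      Holds σ [(0, 0), (1, 1), (10, p.n), (11, p.d), (12, len), (16, p.reps), (19, p.coins),
        (25, p.defect), (27, p.bits), (28, p.cells), (29, p.offset)] := by
  refine Computes.seq (Q := fun σ => Holds σ [(0, 0), (1, 1), (10, p.n), (11, p.d), (12, len),
    (25, 0)]) (Computes.straight rfl (by simp [block, Program.exec, Params.toList])) ?_
  intro σ _ h
  simp only [holds_cons] at h
  refine Computes.seq (Computes.doubleInto (a := 2) (b := p.n + 1) (m := p.n) (r := 0) 
    (L := [(10, p.n), (11, p.d), (12, len)]) rfl
    (by simp [block, Program.exec, h]) (by omega) rfl (by decide)) ?_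
  clear h; clear * - hM hM'
  intro σ _ (h : Holds σ ((13, p.k) :: (25, 0 + (p.n + 1 - 2 * 2 ^ p.k)) :: (0, 0) :: (1, 1) :: [(10, p.n), (11, p.d), (12, len)]))
  simp only [holds_cons] at h
  refine Computes.seq (Computes.doubleInto (a := 1) (b := p.d) (m := p.d) (r := 0 + (p.n + 1 - 2 * 2 ^ p.k)) 
    (L := [(10, p.n), (11, p.d), (12, len), (13, p.k)]) rfl
    (by simp [block, Program.exec, h]) (by omega) rfl (by decide)) ?_
  clear h; clear * - hM hM'
  intro σ _ (h : Holds σ ((14, p.logDim) :: (25, 0 + (p.n + 1 - 2 * 2 ^ p.k) + (p.d - 1 * 2 ^ p.logDim)) :: (0, 0) :: (1, 1) :: [(10, p.n), (11, p.d), (12, len), (13, p.k)]))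
  simp only [holds_cons] at h
  refine Computes.seq (Computes.doubleInto (a := p.b₁) (b := p.b₂) (m := p.n) (r := 0 + (p.n + 1 - 2 * 2 ^ p.k) + (p.d - 1 * 2 ^ p.logDim)) 
    (L := [(10, p.n), (11, p.d), (12, len), (13, p.k), (14, p.logDim)]) rfl
    (by simp [block, Program.exec, Params.toList, h]) (by omega) rfl (by decide)) ?_
  clear h; clear * - hM hM'
  intro σ _ (h : Holds σ ((15, p.logConf) :: (25, 0 + (p.n + 1 - 2 * 2 ^ p.k) + (p.d - 1 * 2 ^ p.logDim) + (p.b₂ - p.b₁ * 2 ^ p.logConf)) :: (0, 0) :: (1, 1) :: [(10, p.n), (11, p.d), (12, len), (13, p.k), (14, p.logDim)]))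
  simp only [holds_cons] at h
  refine Computes.seq (Computes.mulInto (a := p.logDim) (m := p.k) 
    (L := [(10, p.n), (11, p.d), (12, len), (13, p.k), (14, p.logDim), (15, p.logConf), (25, 0 + (p.n + 1 - 2 * 2 ^ p.k) + (p.d - 1 * 2 ^ p.logDim) + (p.b₂ - p.b₁ * 2 ^ p.logConf))]) rfl
    (by simp [block, Program.exec, h]) (by omega) rfl (by decide)) ?_
  clear h; clear * - hM hM'
  intro σ _ (h : Holds σ ((16, p.logDim * p.k) :: (0, 0) :: (1, 1) :: [(10, p.n), (11, p.d), (12, len), (13, p.k), (14, p.logDim), (15, p.logConf), (25, 0 + (p.n + 1 - 2 * 2 ^ p.k) + (p.d - 1 * 2 ^ p.logDim) + (p.b₂ - p.b₁ * 2 ^ p.logConf))]))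
  simp only [holds_cons] at h
  refine Computes.seq (Computes.mulInto (a := p.d₂) (m := p.reps) 
    (L := [(10, p.n), (11, p.d), (12, len), (13, p.k), (14, p.logDim), (16, p.reps), (25, 0 + (p.n + 1 - 2 * 2 ^ p.k) + (p.d - 1 * 2 ^ p.logDim) + (p.b₂ - p.b₁ * 2 ^ p.logConf))]) rfl
    (by simp [block, Program.exec, Params.toList, h]; rfl) (by omega) rfl (by decide)) ?_
  clear h; clear * - hM hM'
  intro σ _ (h : Holds σ ((17, p.d₂ * p.reps) :: (0, 0) :: (1, 1) :: [(10, p.n), (11, p.d), (12, len), (13, p.k), (14, p.logDim), (16, p.reps), (25, 0 + (p.n + 1 - 2 * 2 ^ p.k) + (p.d - 1 * 2 ^ p.logDim) + (p.b₂ - p.b₁ * 2 ^ p.logConf))]))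
  simp only [holds_cons] at h
  refine Computes.seq (Computes.doubleInto (a := p.d₁) (b := p.d₂ * p.reps) (m := 4 * p.n) (r := 0 + (p.n + 1 - 2 * 2 ^ p.k) + (p.d - 1 * 2 ^ p.logDim) + (p.b₂ - p.b₁ * 2 ^ p.logConf)) 
    (L := [(10, p.n), (11, p.d), (12, len), (13, p.k), (14, p.logDim), (16, p.reps)]) rfl
    (by simp [block, Program.exec, Params.toList, h]; omega) (by omega) rfl (by decide)) ?_
  clear h; clear * - hM hM'
  intro σ _ (h : Holds σ ((17, p.logDelta) :: (25, 0 + (p.n + 1 - 2 * 2 ^ p.k) + (p.d - 1 * 2 ^ p.logDim) + (p.b₂ - p.b₁ * 2 ^ p.logConf) + (p.d₂ * p.reps - p.d₁ * 2 ^ p.logDelta)) :: (0, 0) :: (1, 1) :: [(10, p.n), (11, p.d), (12, len), (13, p.k), (14, p.logDim), (16, p.reps)]))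
  simp only [holds_cons] at h
  refine Computes.seq (Computes.doubleInto (a := p.e₁) (b := p.e₂) (m := p.k + 1) (r := 0 + (p.n + 1 - 2 * 2 ^ p.k) + (p.d - 1 * 2 ^ p.logDim) + (p.b₂ - p.b₁ * 2 ^ p.logConf) + (p.d₂ * p.reps - p.d₁ * 2 ^ p.logDelta)) 
    (L := [(10, p.n), (11, p.d), (12, len), (13, p.k), (14, p.logDim), (16, p.reps), (17, p.logDelta)]) rfl
    (by simp [block, Program.exec, Params.toList, h]) (by omega) rfl (by decide)) ?_
  clear h; clear * - hM hM'
  intro σ _ (h : Holds σ ((18, p.logEps) :: (25, 0 + (p.n + 1 - 2 * 2 ^ p.k) + (p.d - 1 * 2 ^ p.logDim) + (p.b₂ - p.b₁ * 2 ^ p.logConf) + (p.d₂ * p.reps - p.d₁ * 2 ^ p.logDelta) + (p.e₂ - p.e₁ * 2 ^ p.logEps)) :: (0, 0) :: (1, 1) :: [(10, p.n), (11, p.d), (12, len), (13, p.k), (14, p.logDim), (16, p.reps), (17, p.logDelta)]))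
  simp only [holds_cons] at h
  refine Computes.seq (Computes.mulInto (a := p.reps) (m := p.reps) 
    (L := [(10, p.n), (11, p.d), (12, len), (13, p.k), (14, p.logDim), (16, p.reps), (17, p.logDelta), (18, p.logEps), (25, 0 + (p.n + 1 - 2 * 2 ^ p.k) + (p.d - 1 * 2 ^ p.logDim) + (p.b₂ - p.b₁ * 2 ^ p.logConf) + (p.d₂ * p.reps - p.d₁ * 2 ^ p.logDelta) + (p.e₂ - p.e₁ * 2 ^ p.logEps))]) rfl
    (by simp [block, Program.exec, h]) (by omega) rfl (by decide)) ?_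
  clear h; clear * - hM hM'
  intro σ _ (h : Holds σ ((19, p.reps * p.reps) :: (0, 0) :: (1, 1) :: [(10, p.n), (11, p.d), (12, len), (13, p.k), (14, p.logDim), (16, p.reps), (17, p.logDelta), (18, p.logEps), (25, 0 + (p.n + 1 - 2 * 2 ^ p.k) + (p.d - 1 * 2 ^ p.logDim) + (p.b₂ - p.b₁ * 2 ^ p.logConf) + (p.d₂ * p.reps - p.d₁ * 2 ^ p.logDelta) + (p.e₂ - p.e₁ * 2 ^ p.logEps))]))
  simp only [holds_cons] at h
  refine Computes.seq (Computes.mulInto (a := p.reps * p.reps) (m := p.logDelta + 1) 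
    (L := [(10, p.n), (11, p.d), (12, len), (13, p.k), (14, p.logDim), (16, p.reps), (17, p.logDelta), (18, p.logEps), (25, 0 + (p.n + 1 - 2 * 2 ^ p.k) + (p.d - 1 * 2 ^ p.logDim) + (p.b₂ - p.b₁ * 2 ^ p.logConf) + (p.d₂ * p.reps - p.d₁ * 2 ^ p.logDelta) + (p.e₂ - p.e₁ * 2 ^ p.logEps))]) rfl
    (by simp [block, Program.exec, h]) (by omega) rfl (by decide)) ?_
  clear h; clear * - hM hM'
  intro σ _ (h : Holds σ ((19, p.reps * p.reps * (p.logDelta + 1)) :: (0, 0) :: (1, 1) :: [(10, p.n), (11, p.d), (12, len), (13, p.k), (14, p.logDim), (16, p.reps), (17, p.logDelta), (18, p.logEps), (25, 0 + (p.n + 1 - 2 * 2 ^ p.k) + (p.d - 1 * 2 ^ p.logDim) + (p.b₂ - p.b₁ * 2 ^ p.logConf) + (p.d₂ * p.reps - p.d₁ * 2 ^ p.logDelta) + (p.e₂ - p.e₁ * 2 ^ p.logEps))]))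
  simp only [holds_cons] at h
  refine Computes.seq (Computes.shiftInto (a := p.reps * p.reps * (p.logDelta + 1)) (m := 2 * p.logEps + 7) 
    (L := [(10, p.n), (11, p.d), (12, len), (13, p.k), (14, p.logDim), (16, p.reps), (17, p.logDelta), (18, p.logEps), (25, 0 + (p.n + 1 - 2 * 2 ^ p.k) + (p.d - 1 * 2 ^ p.logDim) + (p.b₂ - p.b₁ * 2 ^ p.logConf) + (p.d₂ * p.reps - p.d₁ * 2 ^ p.logDelta) + (p.e₂ - p.e₁ * 2 ^ p.logEps))]) rfl
    (by simp [block, Program.exec, h]; omega) (by omega) rfl (by decide)) ?_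
  clear h; clear * - hM hM'
  intro σ _ (h : Holds σ ((19, p.coins) :: (0, 0) :: (1, 1) :: [(10, p.n), (11, p.d), (12, len), (13, p.k), (14, p.logDim), (16, p.reps), (17, p.logDelta), (18, p.logEps), (25, 0 + (p.n + 1 - 2 * 2 ^ p.k) + (p.d - 1 * 2 ^ p.logDim) + (p.b₂ - p.b₁ * 2 ^ p.logConf) + (p.d₂ * p.reps - p.d₁ * 2 ^ p.logDelta) + (p.e₂ - p.e₁ * 2 ^ p.logEps))]))
  simp only [holds_cons] at h
  refine Computes.seq (Computes.shiftInto (a := 1) (m := p.k) 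
    (L := [(10, p.n), (11, p.d), (12, len), (13, p.k), (14, p.logDim), (16, p.reps), (17, p.logDelta), (18, p.logEps), (19, p.coins), (25, 0 + (p.n + 1 - 2 * 2 ^ p.k) + (p.d - 1 * 2 ^ p.logDim) + (p.b₂ - p.b₁ * 2 ^ p.logConf) + (p.d₂ * p.reps - p.d₁ * 2 ^ p.logDelta) + (p.e₂ - p.e₁ * 2 ^ p.logEps))]) rfl
    (by simp [block, Program.exec, h]) (by omega) rfl (by decide)) ?_
  clear h; clear * - hM hM'
  intro σ _ (h : Holds σ ((26, 1 * 2 ^ p.k) :: (0, 0) :: (1, 1) :: [(10, p.n), (11, p.d), (12, len), (13, p.k), (14, p.logDim), (16, p.reps), (17, p.logDelta), (18, p.logEps), (19, p.coins), (25, 0 + (p.n + 1 - 2 * 2 ^ p.k) + (p.d - 1 * 2 ^ p.logDim) + (p.b₂ - p.b₁ * 2 ^ p.logConf) + (p.d₂ * p.reps - p.d₁ * 2 ^ p.logDelta) + (p.e₂ - p.e₁ * 2 ^ p.logEps))]))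
  simp only [holds_cons] at h
  refine Computes.seq (Computes.shiftInto (a := 1) (m := p.bits) 
    (L := [(10, p.n), (11, p.d), (12, len), (13, p.k), (14, p.logDim), (16, p.reps), (17, p.logDelta), (18, p.logEps), (19, p.coins), (26, 1 * 2 ^ p.k), (27, p.bits), (25, 0 + (p.n + 1 - 2 * 2 ^ p.k) + (p.d - 1 * 2 ^ p.logDim) + (p.b₂ - p.b₁ * 2 ^ p.logConf) + (p.d₂ * p.reps - p.d₁ * 2 ^ p.logDelta) + (p.e₂ - p.e₁ * 2 ^ p.logEps))]) rfl
    (by simp [block, Program.exec, Params.bits, h]; omega) (by omega) rfl (by decide)) ?_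
  clear h; clear * - hM hM'
  intro σ _ (h : Holds σ ((28, 1 * 2 ^ p.bits) :: (0, 0) :: (1, 1) :: [(10, p.n), (11, p.d), (12, len), (13, p.k), (14, p.logDim), (16, p.reps), (17, p.logDelta), (18, p.logEps), (19, p.coins), (26, 1 * 2 ^ p.k), (27, p.bits), (25, 0 + (p.n + 1 - 2 * 2 ^ p.k) + (p.d - 1 * 2 ^ p.logDim) + (p.b₂ - p.b₁ * 2 ^ p.logConf) + (p.d₂ * p.reps - p.d₁ * 2 ^ p.logDelta) + (p.e₂ - p.e₁ * 2 ^ p.logEps))]))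
  simp only [holds_cons] at h
  refine Computes.seq (Computes.mulInto (a := 2 ^ p.bits) (m := p.d) 
    (L := [(10, p.n), (11, p.d), (12, len), (13, p.k), (14, p.logDim), (16, p.reps), (17, p.logDelta), (18, p.logEps), (19, p.coins), (26, 1 * 2 ^ p.k), (27, p.bits), (25, 0 + (p.n + 1 - 2 * 2 ^ p.k) + (p.d - 1 * 2 ^ p.logDim) + (p.b₂ - p.b₁ * 2 ^ p.logConf) + (p.d₂ * p.reps - p.d₁ * 2 ^ p.logDelta) + (p.e₂ - p.e₁ * 2 ^ p.logEps))]) rfl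
    (by simp [block, Program.exec, h]) (by omega) rfl (by decide)) ?_
  clear h; clear * - hM hM'
  intro σ _ (h : Holds σ ((28, p.cells) :: (0, 0) :: (1, 1) :: [(10, p.n), (11, p.d), (12, len), (13, p.k), (14, p.logDim), (16, p.reps), (17, p.logDelta), (18, p.logEps), (19, p.coins), (26, 1 * 2 ^ p.k), (27, p.bits), (25, 0 + (p.n + 1 - 2 * 2 ^ p.k) + (p.d - 1 * 2 ^ p.logDim) + (p.b₂ - p.b₁ * 2 ^ p.logConf) + (p.d₂ * p.reps - p.d₁ * 2 ^ p.logDelta) + (p.e₂ - p.e₁ * 2 ^ p.logEps))]))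
  simp only [holds_cons] at h
  refine Computes.seq (Computes.mulInto (a := p.coins) (m := 2 ^ p.k) 
    (L := [(10, p.n), (11, p.d), (12, len), (13, p.k), (14, p.logDim), (16, p.reps), (17, p.logDelta), (18, p.logEps), (19, p.coins), (26, 1 * 2 ^ p.k), (27, p.bits), (28, p.cells), (25, 0 + (p.n + 1 - 2 * 2 ^ p.k) + (p.d - 1 * 2 ^ p.logDim) + (p.b₂ - p.b₁ * 2 ^ p.logConf) + (p.d₂ * p.reps - p.d₁ * 2 ^ p.logDelta) + (p.e₂ - p.e₁ * 2 ^ p.logEps))]) rfl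
    (by simp [block, Program.exec, h]) (by omega) rfl (by decide)) ?_
  clear h; clear * - hM hM'
  intro σ _ (h : Holds σ ((29, p.offset) :: (0, 0) :: (1, 1) :: [(10, p.n), (11, p.d), (12, len), (13, p.k), (14, p.logDim), (16, p.reps), (17, p.logDelta), (18, p.logEps), (19, p.coins), (26, 1 * 2 ^ p.k), (27, p.bits), (28, p.cells), (25, 0 + (p.n + 1 - 2 * 2 ^ p.k) + (p.d - 1 * 2 ^ p.logDim) + (p.b₂ - p.b₁ * 2 ^ p.logConf) + (p.d₂ * p.reps - p.d₁ * 2 ^ p.logDelta) + (p.e₂ - p.e₁ * 2 ^ p.logEps))]))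
  simp only [holds_cons] at h
  refine Computes.seq (Q := fun σ => _) (Computes.straight rfl ?_) fun σ _ h => Computes.block_nil h
  simp only [block, Program.exec, holds_cons, State.set_reg, Params.defect]
  simp [h]

/-! ### The laws from which the mechanism samples -/

/-- The law of a uniform number with `s` bits. -/
noncomputable def bitsLaw (s : ℕ) : PMF ℕ := iterLaw (fun _ v => coin.map fun b => v + v + b) s 0

/-- The law of the number of successes in `N` tosses of a coin. -/
noncomputable def binLaw (N : ℕ) : PMF ℕ := iterLaw (fun _ v => coin.map fun b => v + b) N 0

/-- The law of a list of `m` independent entries, where entry `i` has the law `f i`. -/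
noncomputable def listLaw {A : Type*} (f : ℕ → PMF A) (m : ℕ) : PMF (List A) :=
  iterLaw (fun i l => (f i).map fun y => l ++ [y]) m []

/-- The hash value of a set of coordinates. -/
def hashVal (h : List ℕ) (Z : Finset ℕ) : ℕ := ∑ i ∈ Z, h.getD i 0

/-- The set of the coordinates at which a point is zero. -/
def zeroSet {d : ℕ} (x : Fin d → Bool) : Finset ℕ :=
  (Finset.range d).filter fun i => (encodePoint x).getD i 0 = 0

/-- The number of elements of the database with a given hash value. -/
def cellCount {d : ℕ} (l : List (Fin d → Bool)) (h : List ℕ) (b : ℕ) : ℕ :=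
  l.countP fun x => hashVal h (zeroSet x) = b

/-- The law of the hash function. -/
noncomputable def hashLaw (d s : ℕ) : PMF (List ℕ) := listLaw (fun _ => bitsLaw s) d

/-- The law of the table with binomial noise. -/
noncomputable def tableLaw (cnt : ℕ → ℕ) (N T : ℕ) : PMF (List ℕ) :=
  listLaw (fun b => (binLaw N).map fun y => cnt b + y) T

/-- The law of one repetition: a hash function and a table. -/
noncomputable def repLaw {d : ℕ} (l : List (Fin d → Bool)) (s N T : ℕ) :
    PMF (List ℕ × List ℕ) :=
  (hashLaw d s).bind fun h => (tableLaw (cellCount l h) N T).map fun c => (h, c)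

/-! ### The mechanism -/

/-- Sample and emit the hash function. -/
def hashP : Program :=
  block [block [.const 31 0, .add 32 11 0],
    forDo 32 (block [block [.const 33 0, .add 34 27 0],
      forDo 34 (block [.flip 35, .add 33 33 33, .add 33 33 35]),
      .store 31 33, .emit 33, .add 31 31 1])]

/-- Compute the table. -/
def countP : Program :=
  block [block [.const 31 9, .add 32 12 0],
    forDo 32 (block [block [.add 36 11 0, .const 33 0, .add 34 11 0],
      forDo 34 (block [.read 35 31, .add 31 31 1,
        .cond 35 .skip (block [.load 37 33, .add 36 36 37]), .add 33 33 1]),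
      .load 37 36, .add 37 37 1, .store 36 37])]

/-- Add noise to the table, emit it, and erase it. -/
def noiseP : Program :=
  block [block [.add 31 11 0, .add 32 28 0],
    forDo 32 (block [block [.load 33 31, .store 31 0, .add 34 19 0],
      forDo 34 (block [.flip 35, .add 33 33 35]),
      .emit 33, .add 31 31 1])]

theorem hashP_spec {M d s : ℕ} {inp : List ℕ} {σ : State} (h0 : σ.reg 0 = 0) (h1 : σ.reg 1 = 1)
    (hd : σ.reg 11 = d) (hs : σ.reg 27 = s) (hdM : d ≤ M) (hsM : s ≤ M) :
    Samples M inp hashP σ (hashLaw d s) fun h σ' => σ'.out = σ.out ++ h ∧ h.length = d ∧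
      (∀ y ∈ h, y < 2 ^ s) ∧ (∀ i < d, σ'.mem i = h.getD i 0) ∧
      ∀ i, d ≤ i → σ'.mem i = σ.mem i := by
  refine Samples.straight_seq rfl ?_
  have := Samples.seq_straight (q := block []) (f := id) (R' := fun h σ' => σ'.out = σ.out ++ h ∧
      h.length = d ∧ (∀ y ∈ h, y < 2 ^ s) ∧ (∀ i < d, σ'.mem i = h.getD i 0) ∧
      ∀ i, d ≤ i → σ'.mem i = σ.mem i) (M := M) (inp := inp)
    (σ := (block [Program.const 31 0, Program.add 32 11 0]).exec inp σ) (Samples.forDo (c := 32)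
      (body := block [block [.const 33 0, .add 34 27 0],
        forDo 34 (block [.flip 35, .add 33 33 33, .add 33 33 35]),
        .store 31 33, .emit 33, .add 31 31 1])
      (fun i h σ' => (σ'.out = σ.out ++ h ∧ h.length = i ∧
        (∀ y ∈ h, y < 2 ^ s) ∧ (∀ i' < i, σ'.mem i' = h.getD i' 0) ∧
        ∀ i', i ≤ i' → σ'.mem i' = σ.mem i') ∧ σ'.reg 31 = i)
      (fun _ h => (bitsLaw s).map fun y => h ++ [y]) d [] rfl rfl (by decide) hdM
      (by simp [block, Program.exec, h1]) (by simp [block, Program.exec, hd, h0])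
      (by simp [block, Program.exec]) ?_) rfl ?_
  · rwa [PMF.map_id] at this
  · rintro i h σ' hi hF h1' ⟨⟨k1, k2, k3, k4, k5⟩, k6⟩
    have e0 : σ'.reg 0 = 0 := by rw [hF.1 0 rfl]; simp [block, Program.exec, h0]
    have e27 : σ'.reg 27 = s := by rw [hF.1 27 rfl]; simp [block, Program.exec, hs]
    refine Samples.straight_seq rfl ?_
    refine Samples.seq_straight (Samples.forDo (fun j v σ'' => σ''.reg 33 = v ∧ v < 2 ^ j)
      _ s 0 rfl rfl (by decide) hsM (by simp [block, Program.exec, h1'])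
      (by simp [block, Program.exec, e0, e27]) (by simp [block, Program.exec]) ?_) rfl ?_
    · rintro j v σ'' hj hF' h1'' ⟨m1, m2⟩
      refine Samples.flip_seq fun b hb => Samples.straight rfl fun w => ?_
      simp [block, Program.exec, m1, pow_succ]
      omega
    · rintro v σ'' - hF' ⟨m1, m2⟩ w
      have f1 : σ''.reg 1 = 1 := by rw [hF'.1 1 rfl]; simp [block, Program.exec, h1']
      have f31 : σ''.reg 31 = i := by rw [hF'.1 31 rfl]; simp [block, Program.exec, k6]
      have fm : σ''.mem = σ'.mem := by rw [hF'.2.1 rfl]; simp [block, Program.exec]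
      have fo : σ''.out = σ.out ++ h := by rw [hF'.2.2 rfl]; simp [block, Program.exec, k1]
      refine ⟨⟨?_, ?_, ?_, ?_, ?_⟩, ?_⟩
      · simp [block, Program.exec, fo, m1]
      · simp [k2]
      · intro y hy
        rcases List.mem_append.1 hy with hy | hy
        · exact k3 y hy
        · obtain rfl : y = v := by simpa using hy
          exact m2
      · intro i' hi'
        simp only [block, Program.exec, State.set_mem, f31, m1, fm]
        rcases Nat.lt_succ_iff_lt_or_eq.1 hi' with hlt | rfl
        · rw [Function.update_of_ne (by omega), k4 i' hlt, List.getD_append _ _ _ _ (by omega)]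
        · simp [k2]
      · intro i' hi'
        simp only [block, Program.exec, State.set_mem, f31, fm]
        rw [Function.update_of_ne (by omega), k5 i' (by omega)]
      · simp [block, Program.exec, f1, f31]
  · intro h σ' _ _ hh
    exact hh.1

theorem countP_spec {M d : ℕ} {inp : List ℕ} {σ : State} {l : List (Fin d → Bool)} {h : List ℕ}
    (h0 : σ.reg 0 = 0) (h1 : σ.reg 1 = 1) (hd : σ.reg 11 = d) (hl : σ.reg 12 = l.length)
    (hdM : d ≤ M) (hlM : l.length ≤ M) (hh : ∀ i < d, σ.mem i = h.getD i 0)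
    (hz : ∀ b, σ.mem (d + b) = 0)
    (hin : ∀ j (hj : j < l.length), ∀ i < d,
      inp.getD (9 + d * j + i) 0 = (encodePoint l[j]).getD i 0) :
    Computes M inp countP σ fun σ' => ∀ b, σ'.mem (d + b) = cellCount l h b := by
  refine Computes.straight_seq rfl ?_
  refine Computes.seq (Computes.forDo (fun j σ' => σ'.reg 31 = 9 + d * j ∧
    (∀ i < d, σ'.mem i = h.getD i 0) ∧ ∀ b, σ'.mem (d + b) = cellCount (l.take j) h b) l.length
    rfl rfl (by decide) hlM (by simp [block, Program.exec, h1])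
    (by simp [block, Program.exec, hl, h0]) ?_ ?_) fun σ' _ k => Computes.block_nil ?_
  · simpa [block, Program.exec, cellCount] using ⟨hh, hz⟩
  · rintro j σ' hj hF h1' ⟨k1, k2, k3⟩
    have e0 : σ'.reg 0 = 0 := by rw [hF.1 0 rfl]; simp [block, Program.exec, h0]
    have e11 : σ'.reg 11 = d := by rw [hF.1 11 rfl]; simp [block, Program.exec, hd]
    refine Computes.straight_seq rfl ?_
    refine Computes.seq (Computes.forDo (fun i σ'' => σ''.reg 31 = 9 + d * j + i ∧ σ''.reg 33 = i ∧
      σ''.reg 36 = d + ∑ r ∈ Finset.range i,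
        if (encodePoint l[j]).getD r 0 = 0 then h.getD r 0 else 0) d rfl rfl (by decide) hdM
      (by simp [block, Program.exec, h1']) (by simp [block, Program.exec, e0, e11])
      (by simp [block, Program.exec, e0, e11, k1]) ?_) ?_
    · rintro i σ'' hi hF' h1'' ⟨m1, m2, m3⟩
      have fm : σ''.mem = σ'.mem := by rw [hF'.2.1 rfl]; simp [block, Program.exec]
      refine Computes.straight rfl fun w => ?_
      have hb := hin j hj i hi
      simp only [block, Program.exec, State.set_reg, m1, hb]
      by_cases hx : (encodePoint l[j]).getD i 0 = 0
      · simp [m2, m3, fm, k2 i hi, h1'', Finset.sum_range_succ, hx,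
          -List.getD_eq_getElem?_getD]
        omega
      · simp [m2, m3, h1'', Finset.sum_range_succ, hx,
          -List.getD_eq_getElem?_getD]
        omega
    · rintro σ'' hF' ⟨m1, m2, m3⟩
      have fm : σ''.mem = σ'.mem := by rw [hF'.2.1 rfl]; simp [block, Program.exec]
      have f1 : σ''.reg 1 = 1 := by rw [hF'.1 1 rfl]; simp [block, Program.exec, h1']
      have m3' : σ''.reg 36 = d + hashVal h (zeroSet l[j]) := by
        rw [m3, hashVal, zeroSet, Finset.sum_filter]
      refine Computes.straight rfl fun w => ?_
      refine ⟨?_, fun i hi => ?_, fun b => ?_⟩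
      · simp [block, Program.exec, m1, mul_add]; omega
      · simp only [block, Program.exec, State.set_mem, State.set_reg, m3', fm]
        rw [Function.update_of_ne (by simp; omega), k2 i hi]
      · have hcount : cellCount (l.take (j + 1)) h b = cellCount (l.take j) h b +
            if hashVal h (zeroSet l[j]) = b then 1 else 0 := by
          rw [show l.take (j + 1) = l.take j ++ [l[j]] by simp, cellCount, List.countP_append]
          simp [cellCount, List.countP_singleton]
        simp only [block, Program.exec, State.set_mem, State.set_reg, m3', fm, k3, hcount]
        by_cases hb : hashVal h (zeroSet l[j]) = b
        · subst hb
          simp [f1]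
        · rw [Function.update_of_ne (by simp; omega), k3, if_neg hb, add_zero]
  · intro b
    rw [k.2.2 b, List.take_length]

theorem noiseP_spec {M d N T : ℕ} {inp : List ℕ} {σ : State} {cnt : ℕ → ℕ}
    (h0 : σ.reg 0 = 0) (h1 : σ.reg 1 = 1) (hd : σ.reg 11 = d) (hN : σ.reg 19 = N)
    (hT : σ.reg 28 = T) (hNM : N ≤ M) (hTM : T ≤ M) (hc : ∀ b, σ.mem (d + b) = cnt b) :
    Samples M inp noiseP σ (tableLaw cnt N T) fun c σ' => σ'.out = σ.out ++ c ∧ c.length = T ∧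
      (∀ b < T, σ'.mem (d + b) = 0) ∧ ∀ b, T ≤ b → σ'.mem (d + b) = cnt b := by
  refine Samples.straight_seq rfl ?_
  have := Samples.seq_straight (q := block []) (f := id) (R' := fun c σ' => σ'.out = σ.out ++ c ∧
      c.length = T ∧ (∀ b < T, σ'.mem (d + b) = 0) ∧ ∀ b, T ≤ b → σ'.mem (d + b) = cnt b)
    (M := M) (inp := inp)
    (σ := (block [Program.add 31 11 0, Program.add 32 28 0]).exec inp σ) (Samples.forDo (c := 32)
      (body := block [block [.load 33 31, .store 31 0, .add 34 19 0],
        forDo 34 (block [.flip 35, .add 33 33 35]), .emit 33, .add 31 31 1])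
      (fun i c σ' => (σ'.out = σ.out ++ c ∧ c.length = i ∧ (∀ b < i, σ'.mem (d + b) = 0) ∧
        ∀ b, i ≤ b → σ'.mem (d + b) = cnt b) ∧ σ'.reg 31 = d + i)
      (fun b c => ((binLaw N).map fun y => cnt b + y).map fun y => c ++ [y]) T [] rfl rfl
      (by decide) hTM
      (by simp [block, Program.exec, h1]) (by simp [block, Program.exec, hT, h0])
      (by simpa [block, Program.exec, hd, h0] using hc) ?_) rfl ?_
  · rwa [PMF.map_id] at this
  · rintro i c σ' hi hF h1' ⟨⟨k1, k2, k3, k4⟩, k5⟩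
    have e0 : σ'.reg 0 = 0 := by rw [hF.1 0 rfl]; simp [block, Program.exec, h0]
    have e19 : σ'.reg 19 = N := by rw [hF.1 19 rfl]; simp [block, Program.exec, hN]
    refine Samples.straight_seq rfl ?_
    rw [PMF.map_comp]
    refine Samples.seq_straight (Samples.forDo (fun j v σ'' => σ''.reg 33 = cnt i + v)
      _ N 0 rfl rfl (by decide) hNM (by simp [block, Program.exec, h1'])
      (by simp [block, Program.exec, e0, e19])
      (by simp [block, Program.exec, k5, k4 i le_rfl]) ?_) rfl ?_
    · rintro j v σ'' hj hF' h1'' m1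
      refine Samples.flip_seq fun b hb => Samples.straight rfl fun w => ?_
      simp [block, Program.exec, m1]
      omega
    · rintro v σ'' - hF' m1 w
      have f1 : σ''.reg 1 = 1 := by rw [hF'.1 1 rfl]; simp [block, Program.exec, h1']
      have f31 : σ''.reg 31 = d + i := by rw [hF'.1 31 rfl]; simp [block, Program.exec, k5]
      have fm : σ''.mem = Function.update σ'.mem (d + i) 0 := by
        rw [hF'.2.1 rfl]; simp [block, Program.exec, k5, e0]
      have fo : σ''.out = σ.out ++ c := by rw [hF'.2.2 rfl]; simp [block, Program.exec, k1]
      refine ⟨⟨?_, ?_, ?_, ?_⟩, ?_⟩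
      · simp [block, Program.exec, fo, m1]
      · simp [k2]
      · intro b hb
        simp only [block, Program.exec, State.set_mem, fm]
        rcases Nat.lt_succ_iff_lt_or_eq.1 hb with hlt | rfl
        · rw [Function.update_of_ne (by omega), k3 b hlt]
        · simp
      · intro b hb
        simp only [block, Program.exec, State.set_mem, fm]
        rw [Function.update_of_ne (by omega), k4 b (by omega)]
      · simp [block, Program.exec, f1, f31, add_assoc]
  · intro h σ' _ _ hh
    exact hh.1

theorem hashVal_lt {d s : ℕ} {h : List ℕ} (hd : 0 < d) (hh : ∀ y ∈ h, y < 2 ^ s) {Z : Finset ℕ}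
    (hZ : Z ⊆ Finset.range d) : hashVal h Z < 2 ^ s * d := by
  have hb : ∀ i, h.getD i 0 ≤ 2 ^ s - 1 := by
    intro i
    have hp := Nat.two_pow_pos s
    by_cases hi : i < h.length
    · have := hh _ (List.getElem_mem hi)
      rw [List.getD_eq_getElem _ _ hi]
      omega
    · rw [List.getD_eq_default _ _ (by omega)]
      omega
  calc hashVal h Z ≤ ∑ i ∈ Z, (2 ^ s - 1) := Finset.sum_le_sum fun i _ => hb i
    _ = Z.card * (2 ^ s - 1) := by simp
    _ ≤ d * (2 ^ s - 1) := by
      gcongr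
      simpa using Finset.card_le_card hZ
    _ < d * 2 ^ s := by
      have hp := Nat.two_pow_pos s
      exact Nat.mul_lt_mul_of_pos_left (by omega) hd
    _ = 2 ^ s * d := mul_comm _ _

theorem zeroSet_subset {d : ℕ} (x : Fin d → Bool) : zeroSet x ⊆ Finset.range d :=
  Finset.filter_subset _ _

theorem cellCount_eq_zero {d s : ℕ} {h : List ℕ} (hd : 0 < d) (hh : ∀ y ∈ h, y < 2 ^ s)
    (l : List (Fin d → Bool)) {b : ℕ} (hb : 2 ^ s * d ≤ b) : cellCount l h b = 0 := by
  rw [cellCount, List.countP_eq_zero]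
  intro x _
  have := hashVal_lt hd hh (zeroSet_subset x)
  simp only [decide_eq_true_eq]
  omega

/-- One repetition. -/
def repP : Program := block [hashP, countP, noiseP]

/-- The part of the mechanism that uses the data. -/
def releaseP : Program :=
  block [block [.emit 1, .emit 16, .emit 28, .emit 29, .add 30 16 0], forDo 30 repP]

/-- What the mechanism does if there is nothing to be gained from the data. -/
def trivialP : Program :=
  block [.flip 2, block [.emit 0, .sub 23 10 1, .cond 23 (.emit 1) (.emit 2)]]

/-- The mechanism. -/
def mechP : Program := block [paramsP, .cond 25 trivialP releaseP]

theorem Samples.block_singleton {A : Type} {M : ℕ} {inp : List ℕ} {p : Program} {σ : State}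
    {μ : PMF A} {R : A → State → Prop} (h : Samples M inp p σ μ R) :
    Samples M inp (block [p]) σ μ R := by
  have := Samples.seq_straight (q := block []) (f := id) h rfl (R' := R) fun a σ' _ _ h => h
  rwa [PMF.map_id] at this

theorem repP_spec {M d s N : ℕ} {inp : List ℕ} {σ : State} {l : List (Fin d → Bool)}
    (h0 : σ.reg 0 = 0) (h1 : σ.reg 1 = 1) (hd : σ.reg 11 = d) (hl : σ.reg 12 = l.length)
    (hN : σ.reg 19 = N) (hs : σ.reg 27 = s) (hT : σ.reg 28 = 2 ^ s * d) (hd0 : 0 < d)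
    (hdM : d ≤ M) (hlM : l.length ≤ M) (hNM : N ≤ M) (hsM : s ≤ M) (hTM : 2 ^ s * d ≤ M)
    (hz : ∀ b, σ.mem (d + b) = 0)
    (hin : ∀ j (hj : j < l.length), ∀ i < d,
      inp.getD (9 + d * j + i) 0 = (encodePoint l[j]).getD i 0) :
    Samples M inp repP σ (repLaw l s N (2 ^ s * d)) fun r σ' =>
      σ'.out = σ.out ++ (r.1 ++ r.2) ∧ (∀ b, σ'.mem (d + b) = 0) ∧
        (r.1.length = d ∧ (∀ y ∈ r.1, y < 2 ^ s) ∧ r.2.length = 2 ^ s * d) := by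
  refine Samples.seq (hashP_spec h0 h1 hd hs hdM hsM) ?_
  rintro h σ₁ - hF₁ ⟨k1, k2, k3, k4, k5⟩
  have r0 := (hF₁.1 0 rfl).trans h0
  have r1 := (hF₁.1 1 rfl).trans h1
  have r11 := (hF₁.1 11 rfl).trans hd
  have r19 := (hF₁.1 19 rfl).trans hN
  have r28 := (hF₁.1 28 rfl).trans hT
  refine Computes.seq_samples (countP_spec (l := l) (h := h) r0 r1 r11
    ((hF₁.1 12 rfl).trans hl) hdM hlM k4 (fun b => by rw [k5 _ (by omega), hz]) hin) ?_
  rintro σ₂ hF₂ hc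
  refine Samples.block_singleton (Samples.map (noiseP_spec (cnt := cellCount l h) (M := M)
    ((hF₂.1 0 rfl).trans r0) ((hF₂.1 1 rfl).trans r1) ((hF₂.1 11 rfl).trans r11)
    ((hF₂.1 19 rfl).trans r19) ((hF₂.1 28 rfl).trans r28) hNM hTM hc) ?_)
  rintro c σ₃ ⟨m1, m2, m3, m4⟩
  refine ⟨?_, fun b => ?_, k2, k3, m2⟩
  · rw [m1, hF₂.2.2 rfl, k1, List.append_assoc]
  · by_cases hb : b < 2 ^ s * d
    · exact m3 b hb
    · rw [m4 b (by omega), cellCount_eq_zero hd0 k3 l (by omega)]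

/-- The encoding of the output of the mechanism. -/
def encodeOutput (t T W : ℕ) (reps : List (List ℕ × List ℕ)) : List ℕ :=
  [1, t, T, W] ++ reps.flatMap fun r => r.1 ++ r.2

/-- The law of the output of the mechanism. -/
noncomputable def mechLaw (p : Params) (l : List (Fin p.d → Bool)) : PMF (List ℕ) :=
  if p.defect = 0 then
    (listLaw (fun _ => repLaw l p.bits p.coins p.cells) p.reps).map
      (encodeOutput p.reps p.cells p.offset)
  else coin.map fun b => [0, if p.n ≤ 1 then b else 1]

theorem getD_flatMap {A : Type*} (f : A → List ℕ) (d : ℕ) (l : List A)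
    (hf : ∀ x ∈ l, (f x).length = d) {j i : ℕ} (hj : j < l.length) (hi : i < d) :
    (l.flatMap f).getD (d * j + i) 0 = (f l[j]).getD i 0 := by
  induction l generalizing j with
  | nil => simp at hj
  | cons x l ih =>
    rw [List.flatMap_cons]
    have hx := hf x (by simp)
    cases j with
    | zero =>
      rw [List.getD_append _ _ _ _ (by omega)]
      simp
    | succ j =>
      rw [List.getD_append_right _ _ _ _ (by rw [hx, mul_add]; omega)]
      rw [show d * (j + 1) + i - (f x).length = d * j + i by rw [hx, mul_add]; omega]
      simpa using ih (fun y hy => hf y (by simp [hy])) (by simpa using hj)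

/-- All that is known about each possible output of the mechanism. -/
def GoodReps (p : Params) (reps : List (List ℕ × List ℕ)) : Prop :=
  reps.length = p.reps ∧
    ∀ r ∈ reps, r.1.length = p.d ∧ (∀ y ∈ r.1, y < 2 ^ p.bits) ∧ r.2.length = p.cells

theorem releaseP_spec {M : ℕ} {p : Params} {l : List (Fin p.d → Bool)} {σ : State}
    (hσ : Holds σ [(0, 0), (1, 1), (10, p.n), (11, p.d), (12, l.length), (16, p.reps),
      (19, p.coins), (25, p.defect), (27, p.bits), (28, p.cells), (29, p.offset)])
    (hmem : σ.mem = fun _ => 0) (hout : σ.out = []) (hd0 : 0 < p.d)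
    (hdM : p.d ≤ M) (hlM : l.length ≤ M) (hNM : p.coins ≤ M) (hsM : p.bits ≤ M)
    (hTM : p.cells ≤ M) (htM : p.reps ≤ M) :
    Samples M (p.toList ++ [l.length] ++ l.flatMap encodePoint) releaseP σ
      (listLaw (fun _ => repLaw l p.bits p.coins p.cells) p.reps) fun reps σ' =>
        σ'.out = encodeOutput p.reps p.cells p.offset reps ∧ GoodReps p reps := by
  simp only [holds_cons] at hσ
  refine Samples.straight_seq rfl (Samples.block_singleton ?_)
  refine Samples.conseq (Samples.forDo (fun i reps σ' =>
    σ'.out = encodeOutput p.reps p.cells p.offset reps ∧ (∀ b, σ'.mem (p.d + b) = 0) ∧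
      reps.length = i ∧
      ∀ r ∈ reps, r.1.length = p.d ∧ (∀ y ∈ r.1, y < 2 ^ p.bits) ∧ r.2.length = p.cells)
    _ p.reps [] rfl rfl (by decide) htM (by simp [block, Program.exec, hσ])
    (by simp [block, Program.exec, hσ])
    (by simp [block, Program.exec, hσ, hmem, hout, encodeOutput]) ?_) ?_
  · rintro i reps σ' hi hF h1 ⟨k1, k2, k3, k4⟩
    have e : ∀ r ∈ [0, 11, 12, 19, 27, 28], σ'.reg r = σ.reg r := by
      intro r hr
      simp only [List.mem_cons, List.not_mem_nil, or_false] at hr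
      rcases hr with rfl | rfl | rfl | rfl | rfl | rfl <;> rw [hF.1 _ rfl] <;>
        simp [block, Program.exec]
    simp only [List.mem_cons, List.not_mem_nil, or_false, forall_eq_or_imp, forall_eq, hσ] at e
    refine Samples.map (repP_spec (l := l) (s := p.bits) (N := p.coins) (M := M) e.1 h1 e.2.1
      e.2.2.1 e.2.2.2.1 e.2.2.2.2.1 e.2.2.2.2.2 hd0 hdM hlM hNM hsM hTM k2 ?_) ?_
    · intro j hj i' hi'
      rw [List.getD_append_right _ _ _ _ (by simp [Params.toList]; omega)]
      rw [← getD_flatMap encodePoint p.d l (by simp [encodePoint]) hj hi']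
      congr 1
      simp [Params.toList]
      omega
    · rintro r σ'' ⟨m1, m2, m3⟩ v
      refine ⟨?_, m2, by simp [k3], ?_⟩
      · simp [m1, k1, encodeOutput]
      · intro r' hr'
        rcases List.mem_append.1 hr' with hr' | hr'
        · exact k4 r' hr'
        · obtain rfl : r' = r := by simpa using hr'
          exact m3
  · rintro reps σ' - - ⟨k1, k2, k3, k4⟩
    exact ⟨k1, k3, k4⟩

/-- A bound for the number of rounds of each loop of the mechanism. -/
def Params.Bounded (p : Params) (M : ℕ) : Prop :=
  p.n + p.d + 4 * p.n + (p.k + 1) + p.reps + (p.logDelta + 1) + (2 * p.logEps + 7) + p.bits ≤ M ∧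
    2 ^ p.k ≤ M ∧ p.coins ≤ M ∧ p.cells ≤ M

theorem Params.pos_of_defect {p : Params} (h : p.defect = 0) : 2 ≤ p.n ∧ 2 ≤ p.d := by
  unfold Params.defect at h
  omega

theorem mechP_spec {M : ℕ} {p : Params} {l : List (Fin p.d → Bool)} (hM : p.Bounded M)
    (hl : l.length ≤ M) :
    Samples M (p.toList ++ [l.length] ++ l.flatMap encodePoint) mechP
      ⟨fun _ => 0, fun _ => 0, []⟩ (mechLaw p l) fun o σ => σ.out = o := by
  obtain ⟨hM1, hM2, hM3, hM4⟩ := hM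
  refine Computes.seq_samples (paramsP_spec hM1 hM2) ?_
  rintro σ hF hσ
  have hσ' := hσ
  simp only [holds_cons] at hσ'
  have hout : σ.out = [] := hF.2.2 rfl
  refine Samples.block_singleton (Samples.cond (fun h => ?_) fun h => ?_)
  · rw [mechLaw, if_neg (by simpa [hσ'] using h)]
    refine Samples.flip_seq fun b _ => Samples.straight rfl ?_
    have e : (p.n - 1 = 0) ↔ p.n ≤ 1 := by omega
    by_cases hn : p.n ≤ 1 <;> simp [block, Program.exec, hσ', hout, e, hn]
  · have hdef : p.defect = 0 := by simpa [hσ'] using h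
    rw [mechLaw, if_pos hdef]
    refine Samples.map (releaseP_spec (M := M) hσ (hF.2.1 rfl) hout
      (by have := (Params.pos_of_defect hdef).2; omega) (by omega) hl hM3 (by omega) hM4
      (by omega)) ?_
    rintro reps σ' ⟨k1, -⟩
    exact k1

theorem goodReps_of_mem_support {p : Params} {l : List (Fin p.d → Bool)} (hd : 0 < p.d)
    {reps : List (List ℕ × List ℕ)}
    (h : reps ∈ (listLaw (fun _ => repLaw l p.bits p.coins p.cells) p.reps).support) :
    GoodReps p reps := by
  obtain ⟨κ, k1, k2, -⟩ := releaseP_spec (M := p.d + l.length + p.coins + p.bits + p.cells + p.reps)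
    (p := p) (l := l) (σ := ⟨fun i => if i = 0 then 0 else if i = 1 then 1 else if i = 10 then p.n
      else if i = 11 then p.d else if i = 12 then l.length else if i = 16 then p.reps
      else if i = 19 then p.coins else if i = 25 then p.defect else if i = 27 then p.bits
      else if i = 28 then p.cells else p.offset, fun _ => 0, []⟩) (by simp) rfl rfl hd
    (by omega) (by omega) (by omega) (by omega) (by omega) (by omega)
  rw [← k1] at h
  obtain ⟨x, hx, rfl⟩ := (PMF.mem_support_map_iff _ _ _).1 h
  exact (k2 x hx).1.2

/-! ### The evaluation of queries -/

/-- The coordinates below `i` at which `u` is zero. -/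
def zerosBelow (u : ℕ → ℕ) (i : ℕ) : Finset ℕ := (Finset.range i).filter fun j => u j = 0

/-- The hash values of all sets of zeros of `u` below `i`. -/
def subsetSums (u : ℕ → ℕ) (h : List ℕ) : ℕ → List ℕ
  | 0 => [0]
  | i + 1 => if u i = 0 then subsetSums u h i ++ (subsetSums u h i).map fun v => v + h.getD i 0
      else subsetSums u h i

theorem sum_subsetSums (u : ℕ → ℕ) (h : List ℕ) (i : ℕ) (g : ℕ → ℕ) :
    ((subsetSums u h i).map g).sum = ∑ Z ∈ (zerosBelow u i).powerset, g (hashVal h Z) := by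
  induction i generalizing g with
  | zero => simp [subsetSums, zerosBelow, hashVal]
  | succ i ih =>
    rw [subsetSums]
    split_ifs with hu
    · have hz : zerosBelow u (i + 1) = insert i (zerosBelow u i) := by
        rw [zerosBelow, Finset.range_add_one, Finset.filter_insert, if_pos hu, zerosBelow]
      have hi : i ∉ zerosBelow u i := by simp [zerosBelow]
      rw [List.map_append, List.sum_append, List.map_map, ih, ih (g ∘ _), hz,
        Finset.sum_powerset_insert hi]
      congr 1
      refine Finset.sum_congr rfl fun Z hZ => ?_
      rw [Finset.mem_powerset] at hZ
      rw [hashVal, hashVal, Finset.sum_insert fun h => hi (hZ h), Function.comp_apply, add_comm]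
    · have hz : zerosBelow u (i + 1) = zerosBelow u i := by
        rw [zerosBelow, Finset.range_add_one, Finset.filter_insert, if_neg hu, zerosBelow]
      rw [ih, hz]

theorem length_subsetSums (u : ℕ → ℕ) (h : List ℕ) (i : ℕ) :
    (subsetSums u h i).length = 2 ^ (zerosBelow u i).card := by
  have := sum_subsetSums u h i fun _ => 1
  simpa using this

theorem exists_of_mem_subsetSums {u : ℕ → ℕ} {h : List ℕ} {i v : ℕ} (hv : v ∈ subsetSums u h i) :
    ∃ Z ⊆ zerosBelow u i, v = hashVal h Z := by
  by_contra! hne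
  have h1 := sum_subsetSums u h i fun w => if w = v then 1 else 0
  rw [Finset.sum_eq_zero fun Z hZ => if_neg (hne Z (Finset.mem_powerset.1 hZ)).symm] at h1
  have := List.sum_eq_zero_iff.1 h1 1 (List.mem_map.2 ⟨v, hv, by simp⟩)
  omega

theorem length_subsetSums_mono (u : ℕ → ℕ) (h : List ℕ) {i j : ℕ} (hij : i ≤ j) :
    (subsetSums u h i).length ≤ (subsetSums u h j).length := by
  rw [length_subsetSums, length_subsetSums]
  refine Nat.pow_le_pow_right (by norm_num) (Finset.card_le_card ?_)
  exact Finset.filter_subset_filter _ (Finset.range_subset_range.2 hij)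

/-- The sum of the cells of a table that belong to a query. -/
def cellSum (u : ℕ → ℕ) (d : ℕ) (r : List ℕ × List ℕ) : ℕ :=
  ((subsetSums u r.1 d).map fun v => r.2.getD v 0).sum

/-- Update the minimum `best` of the entries of `V` that are not less than half of the entries. -/
def medianStep (V : List ℕ) (best v : ℕ) : ℕ :=
  if V.length ≤ 2 * V.countP (· ≤ v) then min best v else best

/-- A median. -/
def median (V : List ℕ) : ℕ := V.foldl (medianStep V) V.sum

/-- The numerator of the answer. -/
def answerNum (n W best : ℕ) : ℕ := min (2 * best - W) (2 * n)

def subsetsP : Program :=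
  block [block [.const 20 1, .const 21 8, .const 2 0, .store 2 0, .add 22 11 0],
    forDo 22 (block [block [.read 26 21, .add 21 21 1, .read 27 16, .add 16 16 1],
      .cond 26 .skip (block [block [.add 23 20 0, .const 24 0, .add 25 20 0],
        forDo 23 (block [.load 28 24, .add 28 28 27, .store 25 28, .add 24 24 1, .add 25 25 1]),
        .add 20 20 20])])]

def sumP : Program :=
  block [block [.const 29 0, .const 24 0, .add 23 20 0],
    forDo 23 (block [.load 28 24, .add 28 28 16, .read 26 28, .add 29 29 26, .add 24 24 1]),
    block [.store 18 29, .add 18 18 1, .add 16 16 14, .add 19 19 29]]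

def medianP : Program :=
  block [block [.add 30 10 0, .add 31 13 0],
    forDo 31 (block [block [.load 32 30, .add 30 30 1, .const 33 0, .add 34 10 0, .add 35 13 0],
      forDo 35 (block [.load 36 34, .add 34 34 1, .sub 37 36 32, .cond 37 .skip (.add 33 33 1)]),
      block [.add 33 33 33, .sub 37 13 33,
        .cond 37 .skip (block [.sub 38 19 32, .sub 19 19 38])]])]

def answerP : Program :=
  block [block [.add 4 12 1, .read 13 4, .add 4 4 1, .read 14 4, .add 4 4 1, .read 15 4,
      .add 16 4 1, .const 19 0, .add 18 10 0, .add 17 13 0],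
    forDo 17 (block [subsetsP, sumP]),
    medianP,
    block [.add 40 19 19, .sub 40 40 15, .add 41 10 10, .sub 42 40 41, .sub 40 40 42,
      .emit 40, .emit 0, .emit 41]]

/-- The evaluation program. -/
def evalP : Program :=
  block [block [.const 1 1, .const 2 0, .read 10 2, .const 2 1, .read 11 2, .const 2 9,
      .add 12 2 11, .read 3 12],
    .cond 3 answerP (block [.add 4 12 1, .read 5 4, .emit 5, .emit 0, .emit 1])]

theorem subsetsP_spec {M n d ptr : ℕ} {inp h : List ℕ} {u : ℕ → ℕ} {σ : State}
    (h0 : σ.reg 0 = 0) (h1 : σ.reg 1 = 1) (hd : σ.reg 11 = d) (hptr : σ.reg 16 = ptr)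
    (hdM : d ≤ M) (hnM : n ≤ M) (hu : ∀ i < d, inp.getD (8 + i) 0 = u i)
    (hh : ∀ i < d, inp.getD (ptr + i) 0 = h.getD i 0)
    (hn : (subsetSums u h d).length ≤ n) :
    Computes M inp subsetsP σ fun σ' => σ'.reg 20 = (subsetSums u h d).length ∧
      σ'.reg 16 = ptr + d ∧ (∀ j < (subsetSums u h d).length,
        σ'.mem j = (subsetSums u h d).getD j 0) ∧ ∀ j, n ≤ j → σ'.mem j = σ.mem j := by
  have hpos : ∀ i, 0 < (subsetSums u h i).length := fun i => by
    rw [length_subsetSums]; positivity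
  refine Computes.straight_seq rfl ?_
  refine Computes.seq (Computes.forDo (fun i σ' => (σ'.reg 20 = (subsetSums u h i).length ∧
      σ'.reg 16 = ptr + i ∧ (∀ j < (subsetSums u h i).length,
        σ'.mem j = (subsetSums u h i).getD j 0) ∧ ∀ j, n ≤ j → σ'.mem j = σ.mem j) ∧
        σ'.reg 21 = 8 + i) d rfl rfl
      (by decide) hdM (by simp [block, Program.exec, h1]) (by simp [block, Program.exec, hd, h0])
      ?_ ?_) fun σ' _ k => Computes.block_nil k.1
  · have := hpos d
    refine ⟨⟨rfl, by simp [block, Program.exec, hptr], ?_, fun j hj => ?_⟩, rfl⟩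
    · simp [block, Program.exec, subsetSums, h0]
    · have hj0 : j ≠ 0 := by omega
      simp [block, Program.exec, hj0]
  · rintro i σ' hi hF h1' ⟨⟨k1, k2, k3, k4⟩, k5⟩
    have e0 : σ'.reg 0 = 0 := by rw [hF.1 0 rfl]; simp [block, Program.exec, h0]
    have bi := hu i hi
    have bh := hh i hi
    refine Computes.straight_seq rfl (Samples.block_singleton (Samples.cond (fun hc => ?_)
      fun hc => ?_))
    · have hui : u i ≠ 0 := by
        simpa [block, Program.exec, k5, bi, -List.getD_eq_getElem?_getD] using hc
      refine Computes.straight rfl fun v => ?_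
      simpa [block, Program.exec, subsetSums, hui, k1, k2, k5, h1', add_assoc] using ⟨k3, k4⟩
    · have hui : u i = 0 := by
        simpa [block, Program.exec, k5, bi, -List.getD_eq_getElem?_getD] using hc
      have hlen : (subsetSums u h (i + 1)).length =
          (subsetSums u h i).length + (subsetSums u h i).length := by
        simp [subsetSums, hui]
      have hle := (length_subsetSums_mono u h (Nat.succ_le_of_lt hi)).trans hn
      rw [hlen] at hle
      have hm := hpos i
      refine Computes.straight_seq rfl ?_
      refine Computes.seq (Computes.forDo (fun j σ'' => σ''.reg 24 = j ∧
        σ''.reg 25 = (subsetSums u h i).length + j ∧ σ''.reg 27 = h.getD i 0 ∧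
        (∀ r < (subsetSums u h i).length, σ''.mem r = (subsetSums u h i).getD r 0) ∧
        (∀ r < j, σ''.mem ((subsetSums u h i).length + r) =
          (subsetSums u h i).getD r 0 + h.getD i 0) ∧
        ∀ r, n ≤ r → σ''.mem r = σ.mem r) (subsetSums u h i).length rfl rfl (by decide) (by omega)
        (by simp [block, Program.exec, h1']) (by simp [block, Program.exec, k1, e0]) ?_ ?_) ?_
      · refine ⟨rfl, by simp [block, Program.exec, k1, e0], ?_, k3, fun r hr => by omega, k4⟩
        simpa [block, Program.exec, k2, -List.getD_eq_getElem?_getD] using bh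
      · rintro j σ'' hj hF' h1'' ⟨m1, m2, m3, m4, m5, m6⟩
        refine Computes.straight rfl fun v => ⟨?_, ?_, ?_, fun r hr => ?_, fun r hr => ?_,
          fun r hr => ?_⟩
        · simp [block, Program.exec, m1, h1'']
        · simp [block, Program.exec, m2, h1'', add_assoc]
        · simpa [block, Program.exec] using m3
        · have : r ≠ (subsetSums u h i).length + j := by omega
          simpa [block, Program.exec, m2, this] using m4 r hr
        · rcases Nat.lt_succ_iff_lt_or_eq.1 hr with hlt | rfl
          · have : r ≠ j := by omega
            simpa [block, Program.exec, m2, this] using m5 r hlt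
          · simp [block, Program.exec, m1, m2, m3, m4 r hj, -List.getD_eq_getElem?_getD]
        · have : r ≠ (subsetSums u h i).length + j := by omega
          simpa [block, Program.exec, m2, this] using m6 r hr
      · rintro σ'' hF' ⟨m1, m2, m3, m4, m5, m6⟩
        have f1 : σ''.reg 20 = (subsetSums u h i).length := by
          rw [hF'.1 20 rfl]; simp [block, Program.exec, k1]
        have f16 : σ''.reg 16 = ptr + (i + 1) := by
          rw [hF'.1 16 rfl]; simp [block, Program.exec, k2, h1', add_assoc]
        have f21 : σ''.reg 21 = 8 + (i + 1) := by
          rw [hF'.1 21 rfl]; simp [block, Program.exec, k5, h1', add_assoc]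
        refine Computes.straight rfl fun v => ⟨⟨?_, ?_, fun j hj => ?_, m6⟩, ?_⟩
        · simp [block, Program.exec, f1, hlen]
        · simpa [block, Program.exec] using f16
        · rw [hlen] at hj
          simp only [block, Program.exec, State.set_mem]
          rw [subsetSums, if_pos hui]
          by_cases hjl : j < (subsetSums u h i).length
          · rw [m4 j hjl, List.getD_append _ _ _ _ hjl]
          · rw [List.getD_append_right _ _ _ _ (by omega)]
            have := m5 (j - (subsetSums u h i).length) (by omega)
            rw [show (subsetSums u h i).length + (j - (subsetSums u h i).length) = j by omega]
              at this
            have hr : j - (subsetSums u h i).length < (subsetSums u h i).length := by omega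
            generalize j - (subsetSums u h i).length = r at *
            have hA : (subsetSums u h i).getD r 0 = (subsetSums u h i)[r] :=
              List.getD_eq_getElem _ _ hr
            rw [this, hA, List.getD_eq_getElem (l := (subsetSums u h i).map _) (hn := by simpa),
              List.getElem_map]
        · simpa [block, Program.exec] using f21

theorem sumP_spec {M ptr T vptr S : ℕ} {inp c L : List ℕ} {σ : State}
    (h0 : σ.reg 0 = 0) (h1 : σ.reg 1 = 1) (h14 : σ.reg 14 = T) (h16 : σ.reg 16 = ptr)
    (h18 : σ.reg 18 = vptr) (h19 : σ.reg 19 = S) (h20 : σ.reg 20 = L.length)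
    (hLM : L.length ≤ M) (hL : ∀ j < L.length, σ.mem j = L.getD j 0)
    (hc : ∀ v ∈ L, inp.getD (ptr + v) 0 = c.getD v 0) :
    Computes M inp sumP σ fun σ' => σ'.reg 18 = vptr + 1 ∧ σ'.reg 16 = ptr + T ∧
      σ'.reg 19 = S + (L.map fun v => c.getD v 0).sum ∧
      σ'.mem = Function.update σ.mem vptr (L.map fun v => c.getD v 0).sum := by
  refine Computes.straight_seq rfl ?_
  refine Computes.seq (Computes.forDo (fun j σ' => σ'.reg 24 = j ∧
    σ'.reg 29 = ((L.take j).map fun v => c.getD v 0).sum) L.length rfl rfl (by decide) hLM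
    (by simp [block, Program.exec, h1]) (by simp [block, Program.exec, h20, h0])
    (by simp [block, Program.exec]) ?_) ?_
  · rintro j σ' hj hF h1' ⟨k1, k2⟩
    have e16 : σ'.reg 16 = ptr := by rw [hF.1 16 rfl]; simp [block, Program.exec, h16]
    have em : σ'.mem j = L[j] := by
      rw [hF.2.1 rfl]; simp only [block, Program.exec, State.set_mem]
      rw [hL j hj, List.getD_eq_getElem _ _ hj]
    have hcj := hc _ (List.getElem_mem hj)
    refine Computes.straight rfl fun v => ⟨?_, ?_⟩
    · simp [block, Program.exec, k1, h1']
    · have hs : ((L.take (j + 1)).map fun v => c.getD v 0).sum =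
          ((L.take j).map fun v => c.getD v 0).sum + c.getD L[j] 0 := by
        rw [show L.take (j + 1) = L.take j ++ [L[j]] by simp, List.map_append, List.sum_append]
        simp
      rw [add_comm] at hcj
      rw [hs]
      simp [block, Program.exec, k1, k2, e16, em, hcj, -List.getD_eq_getElem?_getD, -List.map_take]
  · rintro σ' hF ⟨k1, k2⟩
    have e : ∀ r ∈ [1, 14, 16, 18, 19], σ'.reg r = σ.reg r := by
      intro r hr
      simp only [List.mem_cons, List.not_mem_nil, or_false] at hr
      rcases hr with rfl | rfl | rfl | rfl | rfl <;> rw [hF.1 _ rfl] <;>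
        simp [block, Program.exec]
    simp only [List.mem_cons, List.not_mem_nil, or_false, forall_eq_or_imp, forall_eq] at e
    have em : σ'.mem = σ.mem := by rw [hF.2.1 rfl]; simp [block, Program.exec]
    rw [List.take_length] at k2
    refine Computes.straight rfl ?_
    simp [block, Program.exec, e, em, k2, h1, h14, h16, h18, h19, -List.getD_eq_getElem?_getD]

theorem medianP_spec {M n : ℕ} {inp V : List ℕ} {σ : State}
    (h0 : σ.reg 0 = 0) (h1 : σ.reg 1 = 1) (h10 : σ.reg 10 = n) (h13 : σ.reg 13 = V.length)
    (h19 : σ.reg 19 = V.sum) (hVM : V.length ≤ M)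
    (hV : ∀ j < V.length, σ.mem (n + j) = V.getD j 0) :
    Computes M inp medianP σ fun σ' => σ'.reg 19 = median V := by
  refine Computes.straight_seq rfl ?_
  refine Computes.seq (Q := fun σ' => σ'.reg 19 = median V) ?_ fun σ' _ k => Computes.block_nil k
  refine Computes.conseq (Computes.forDo (fun i σ' => σ'.reg 30 = n + i ∧
    σ'.reg 19 = (V.take i).foldl (medianStep V) V.sum) V.length rfl rfl (by decide) hVM
    (by simp [block, Program.exec, h1]) (by simp [block, Program.exec, h13, h0])
    (by simp [block, Program.exec, h10, h0, h19]) ?_) ?_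
  · rintro i σ' hi hF h1' ⟨k1, k2⟩
    have e0 : σ'.reg 0 = 0 := by rw [hF.1 0 rfl]; simp [block, Program.exec, h0]
    have e10 : σ'.reg 10 = n := by rw [hF.1 10 rfl]; simp [block, Program.exec, h10]
    have e13 : σ'.reg 13 = V.length := by rw [hF.1 13 rfl]; simp [block, Program.exec, h13]
    have em : ∀ j (hj : j < V.length), σ'.mem (n + j) = V[j] := fun j hj => by
      rw [hF.2.1 rfl]; simp only [block, Program.exec, State.set_mem]
      rw [hV j hj, List.getD_eq_getElem _ _ hj]
    refine Computes.straight_seq rfl ?_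
    refine Computes.seq (Computes.forDo (fun j σ'' => σ''.reg 34 = n + j ∧
      σ''.reg 33 = (V.take j).countP (· ≤ V[i])) V.length rfl rfl (by decide) hVM
      (by simp [block, Program.exec, h1']) (by simp [block, Program.exec, e13, e0])
      (by simp [block, Program.exec, e10, e0]) ?_) ?_
    · rintro j σ'' hj hF' h1'' ⟨m1, m2⟩
      have f32 : σ''.reg 32 = V[i] := by
        rw [hF'.1 32 rfl]; simp [block, Program.exec, k1, em i hi]
      have fm : σ''.mem (n + j) = V[j] := by
        rw [hF'.2.1 rfl]; simpa [block, Program.exec] using em j hj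
      refine Computes.straight rfl fun v => ?_
      rw [show V.take (j + 1) = V.take j ++ [V[j]] by simp, List.countP_append,
        List.countP_singleton]
      by_cases hle : V[j] ≤ V[i]
      · have : V[j] - V[i] = 0 := by omega
        simp [block, Program.exec, m1, m2, f32, fm, this, h1'', hle, add_assoc]
      · have : V[j] - V[i] ≠ 0 := by omega
        simp [block, Program.exec, m1, m2, f32, fm, this, h1'', hle, add_assoc]
    · rintro σ'' hF' ⟨m1, m2⟩
      have f32 : σ''.reg 32 = V[i] := by
        rw [hF'.1 32 rfl]; simp [block, Program.exec, k1, em i hi]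
      have f13 : σ''.reg 13 = V.length := by
        rw [hF'.1 13 rfl]; simp [block, Program.exec, e13]
      have f19 : σ''.reg 19 = (V.take i).foldl (medianStep V) V.sum := by
        rw [hF'.1 19 rfl]; simp [block, Program.exec, k2]
      have f30 : σ''.reg 30 = n + (i + 1) := by
        rw [hF'.1 30 rfl]; simp [block, Program.exec, k1, h1', add_assoc]
      rw [List.take_length] at m2
      refine Computes.straight rfl fun v => ?_
      rw [show V.take (i + 1) = V.take i ++ [V[i]] by simp, List.foldl_append]
      simp only [List.foldl_cons, List.foldl_nil]
      generalize (V.take i).foldl (medianStep V) V.sum = best at *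
      rw [medianStep]
      by_cases hle : V.length ≤ 2 * V.countP (· ≤ V[i])
      · have : V.length - (V.countP (· ≤ V[i]) + V.countP (· ≤ V[i])) = 0 := by omega
        rw [if_pos hle]
        simp [block, Program.exec, m2, f13, f19, f32, f30, this]
        omega
      · have : V.length - (V.countP (· ≤ V[i]) + V.countP (· ≤ V[i])) ≠ 0 := by omega
        rw [if_neg hle]
        simp [block, Program.exec, m2, f13, f19, f30, this]
  · rintro σ' - ⟨-, k⟩
    rw [k, List.take_length, median]

/-- The input of the evaluation program. -/
def evalIn (p : Params) (bits r : List ℕ) : List ℕ := p.toList ++ bits ++ [r.length] ++ r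

theorem getD_evalIn_bits (p : Params) {bits r : List ℕ} {i : ℕ} (hi : i < bits.length) :
    (evalIn p bits r).getD (8 + i) 0 = bits.getD i 0 := by
  rw [evalIn, List.append_assoc, List.getD_append _ _ _ _ (by simp [Params.toList]; omega),
    List.getD_append_right _ _ _ _ (by simp [Params.toList])]
  simp [Params.toList]

theorem getD_evalIn (p : Params) {bits r : List ℕ} (i : ℕ) :
    (evalIn p bits r).getD (9 + bits.length + i) 0 = r.getD i 0 := by
  rw [evalIn, List.getD_append_right _ _ _ _ (by simp [Params.toList]; omega)]
  congr 1
  simp [Params.toList]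
  omega

theorem GoodReps.getD_encodeOutput {p : Params} {reps : List (List ℕ × List ℕ)}
    (h : GoodReps p reps) {j i : ℕ} (hj : j < reps.length) (hi : i < p.d + p.cells) (t T W : ℕ) :
    (encodeOutput t T W reps).getD (4 + (p.d + p.cells) * j + i) 0 =
      (reps[j].1 ++ reps[j].2).getD i 0 := by
  rw [encodeOutput, List.getD_append_right _ _ _ _ (by simp; omega), ← getD_flatMap
    (fun r => r.1 ++ r.2) (p.d + p.cells) reps (fun r hr => ?_) hj hi]
  · congr 1
    simp
    omega
  · rw [List.length_append, (h.2 r hr).1, (h.2 r hr).2.2]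

theorem answerP_spec {M : ℕ} {p : Params} {bits : List ℕ} {reps : List (List ℕ × List ℕ)}
    {σ : State} (hreps : GoodReps p reps) (hb : bits.length = p.d) (hd0 : 0 < p.d)
    (hk : 2 ^ (zerosBelow (fun i => bits.getD i 0) p.d).card ≤ p.n)
    (hdM : p.d ≤ M) (hnM : p.n ≤ M) (htM : p.reps ≤ M)
    (hσ : Holds σ [(0, 0), (1, 1), (10, p.n), (11, p.d), (12, 9 + p.d)]) (hout : σ.out = []) :
    Computes M (evalIn p bits (encodeOutput p.reps p.cells p.offset reps)) answerP σ fun σ' =>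
      σ'.out = [answerNum p.n p.offset
        (median (reps.map (cellSum (fun i => bits.getD i 0) p.d))), 0, 2 * p.n] := by
  simp only [holds_cons] at hσ
  set inp := evalIn p bits (encodeOutput p.reps p.cells p.offset reps) with hinp
  set u : ℕ → ℕ := fun i => bits.getD i 0 with hu
  have hget : ∀ i, inp.getD (9 + p.d + i) 0 =
      (encodeOutput p.reps p.cells p.offset reps).getD i 0 := fun i => by
    rw [← hb]; exact getD_evalIn p i
  have g1 : inp.getD (9 + p.d + 1) 0 = p.reps := by rw [hget]; simp [encodeOutput]
  have g2 : inp.getD (9 + p.d + 1 + 1) 0 = p.cells := by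
    rw [show 9 + p.d + 1 + 1 = 9 + p.d + 2 by omega, hget]; simp [encodeOutput]
  have g3 : inp.getD (9 + p.d + 1 + 1 + 1) 0 = p.offset := by
    rw [show 9 + p.d + 1 + 1 + 1 = 9 + p.d + 3 by omega, hget]; simp [encodeOutput]
  have hbits : ∀ i < p.d, inp.getD (8 + i) 0 = u i := fun i hi =>
    getD_evalIn_bits p (by omega)
  refine Computes.seq (Q := fun σ' => Holds σ' [(0, 0), (1, 1), (10, p.n), (11, p.d),
    (13, p.reps), (14, p.cells), (15, p.offset), (16, 13 + p.d), (17, p.reps), (18, p.n),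
    (19, 0)] ∧ σ'.out = []) (Computes.straight rfl ?_) ?_
  · simp [block, Program.exec, hσ, hout, g1, g2, g3, -List.getD_eq_getElem?_getD]
    omega
  clear hσ hout
  rintro σ - ⟨hσ, hout⟩
  simp only [holds_cons] at hσ
  have hlen : ∀ h, (subsetSums u h p.d).length ≤ p.n := fun h => by rwa [length_subsetSums]
  refine Computes.seq (Q := fun σ' => (∀ j < reps.length,
      σ'.mem (p.n + j) = (reps.map (cellSum u p.d)).getD j 0) ∧
      σ'.reg 19 = (reps.map (cellSum u p.d)).sum) ?_ ?_
  · refine Computes.conseq (Computes.forDo (fun j σ' => σ'.reg 16 = 13 + p.d + (p.d + p.cells) * j ∧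
      σ'.reg 18 = p.n + j ∧ σ'.reg 19 = ((reps.take j).map (cellSum u p.d)).sum ∧
      ∀ i < j, σ'.mem (p.n + i) = (reps.map (cellSum u p.d)).getD i 0) p.reps rfl rfl (by decide)
      htM hσ.2.1 (by simp [hσ]) (by simp [hσ]) ?_) ?_
    · rintro j σ' hj hF h1 ⟨k1, k2, k3, k4⟩
      rw [← hreps.1] at hj
      obtain ⟨q1, q2, q3⟩ := hreps.2 _ (List.getElem_mem hj)
      have e0 : σ'.reg 0 = 0 := by rw [hF.1 0 rfl, hσ.1]
      have e11 : σ'.reg 11 = p.d := by rw [hF.1 11 rfl, hσ.2.2.2.1]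
      have e14 : σ'.reg 14 = p.cells := by rw [hF.1 14 rfl]; simp [hσ]
      have hblock : ∀ i < p.d + p.cells, inp.getD (13 + p.d + (p.d + p.cells) * j + i) 0 =
          (reps[j].1 ++ reps[j].2).getD i 0 := by
        intro i hi
        rw [← hreps.getD_encodeOutput hj hi p.reps p.cells p.offset, ← hget]
        congr 1
        omega
      refine Computes.seq (subsetsP_spec (u := u) (h := reps[j].1) (n := p.n) e0 h1 e11 k1 hdM hnM
        hbits (fun i hi => ?_) (hlen _)) ?_
      · rw [hblock i (by omega), List.getD_append _ _ _ _ (by omega)]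
      rintro σ'' hF' ⟨m1, m2, m3, m4⟩
      refine Samples.block_singleton (Computes.conseq (sumP_spec (c := reps[j].2) (T := p.cells)
        ((hF'.1 0 rfl).trans e0) ((hF'.1 1 rfl).trans h1) ((hF'.1 14 rfl).trans e14) m2
        ((hF'.1 18 rfl).trans k2) ((hF'.1 19 rfl).trans k3) m1 ((hlen _).trans hnM) m3 ?_) ?_)
      · intro v hv
        obtain ⟨Z, hZ, rfl⟩ := exists_of_mem_subsetSums hv
        have := hashVal_lt hd0 q2 (hZ.trans (Finset.filter_subset _ _))
        rw [show 13 + p.d + (p.d + p.cells) * j + p.d + hashVal reps[j].1 Z =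
          13 + p.d + (p.d + p.cells) * j + (p.d + hashVal reps[j].1 Z) by omega,
          hblock _ (by rw [Params.cells]; omega), List.getD_append_right _ _ _ _ (by omega), q1]
        congr 1
        omega
      · rintro σ₃ - ⟨r1, r2, r3, r4⟩ v
        refine ⟨?_, ?_, ?_, fun i hi => ?_⟩
        · simp [r2]; ring
        · simp [r1]; ring
        · rw [show reps.take (j + 1) = reps.take j ++ [reps[j]] by simp, List.map_append,
            List.sum_append]
          simp [r3, cellSum]
        · rw [State.set_mem, r4]
          rcases Nat.lt_succ_iff_lt_or_eq.1 hi with hlt | rfl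
          · rw [Function.update_of_ne (by omega), m4 _ (by omega), k4 i hlt]
          · rw [Function.update_self, List.getD_eq_getElem _ _ (by simpa using hj),
              List.getElem_map, cellSum]
    · rintro σ' - ⟨k1, k2, k3, k4⟩
      rw [← hreps.1] at k4 k3
      rw [List.take_length] at k3
      exact ⟨k4, k3⟩
  · rintro σ' hF ⟨k1, k2⟩
    have e0 : σ'.reg 0 = 0 := by rw [hF.1 0 rfl, hσ.1]
    have e1 : σ'.reg 1 = 1 := by rw [hF.1 1 rfl, hσ.2.1]
    have e10 : σ'.reg 10 = p.n := by rw [hF.1 10 rfl, hσ.2.2.1]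
    have e13 : σ'.reg 13 = p.reps := by rw [hF.1 13 rfl]; simp [hσ]
    have e15 : σ'.reg 15 = p.offset := by rw [hF.1 15 rfl]; simp [hσ]
    refine Computes.seq (medianP_spec (V := reps.map (cellSum u p.d)) e0 e1 e10
      (by simpa [hreps.1] using e13) k2 (by simpa [hreps.1] using htM) (by simpa using k1)) ?_
    rintro σ'' hF' m
    have f0 : σ''.reg 0 = 0 := by rw [hF'.1 0 rfl, e0]
    have f10 : σ''.reg 10 = p.n := by rw [hF'.1 10 rfl, e10]
    have f15 : σ''.reg 15 = p.offset := by rw [hF'.1 15 rfl, e15]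
    have fo : σ''.out = [] := by rw [hF'.2.2 rfl, hF.2.2 rfl, hout]
    refine Computes.straight rfl ?_
    simp [block, Program.exec, m, f0, f10, f15, fo, answerNum]
    omega

theorem evalP_trivial {M b : ℕ} {p : Params} {bits : List ℕ} (hb : bits.length = p.d) :
    Computes M (evalIn p bits [0, b]) evalP ⟨fun _ => 0, fun _ => 0, []⟩ fun σ =>
      σ.out = [b, 0, 1] := by
  have h0 := getD_evalIn p (bits := bits) (r := [0, b]) 0
  have h1 := getD_evalIn p (bits := bits) (r := [0, b]) 1
  have hd : (evalIn p bits [0, b]).getD 1 0 = p.d := by simp [evalIn, Params.toList]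
  rw [hb] at h0 h1
  refine Computes.straight_seq rfl (Samples.block_singleton (Samples.cond (fun h => ?_) fun h => ?_))
  · simp [block, Program.exec, hd, -List.getD_eq_getElem?_getD] at h
    simp [-List.getD_eq_getElem?_getD] at h0
    exact absurd h0 h
  · refine Computes.straight rfl ?_
    simpa [block, Program.exec, hd, -List.getD_eq_getElem?_getD] using h1.trans (by simp)

theorem evalP_spec {M : ℕ} {p : Params} {bits : List ℕ} {reps : List (List ℕ × List ℕ)}
    (hreps : GoodReps p reps) (hb : bits.length = p.d) (hd0 : 0 < p.d)
    (hk : 2 ^ (zerosBelow (fun i => bits.getD i 0) p.d).card ≤ p.n)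
    (hdM : p.d ≤ M) (hnM : p.n ≤ M) (htM : p.reps ≤ M) :
    Computes M (evalIn p bits (encodeOutput p.reps p.cells p.offset reps)) evalP
      ⟨fun _ => 0, fun _ => 0, []⟩ fun σ => σ.out = [answerNum p.n p.offset
        (median (reps.map (cellSum (fun i => bits.getD i 0) p.d))), 0, 2 * p.n] := by
  set inp := evalIn p bits (encodeOutput p.reps p.cells p.offset reps) with hinp
  have h0 : inp.getD (9 + p.d) 0 = 1 := by
    have := getD_evalIn p (bits := bits) (r := encodeOutput p.reps p.cells p.offset reps) 0
    rw [hb] at this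
    exact this.trans (by simp [encodeOutput])
  have hn : inp.getD 0 0 = p.n := by simp [hinp, evalIn, Params.toList]
  have hd : inp.getD 1 0 = p.d := by simp [hinp, evalIn, Params.toList]
  refine Computes.straight_seq rfl (Samples.block_singleton (Samples.cond (fun h => ?_) fun h => ?_))
  · refine answerP_spec hreps hb hd0 hk hdM hnM htM ?_ rfl
    simp [block, Program.exec, hd, hn, -List.getD_eq_getElem?_getD]
  · simp [block, Program.exec, hd, h0, -List.getD_eq_getElem?_getD] at h

/-! ### Expectations -/

/-- The expectation of a nonnegative function. -/
noncomputable def PMF.expect {α : Type*} (μ : PMF α) (f : α → ℝ≥0∞) : ℝ≥0∞ := ∑' a, μ a * f a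

namespace PMF

variable {α β : Type*} (μ : PMF α)

theorem expect_pure (a : α) (f : α → ℝ≥0∞) : (PMF.pure a).expect f = f a := by
  rw [expect, tsum_eq_single a fun b hb => by simp [hb]]
  simp

theorem expect_bind (ν : α → PMF β) (f : β → ℝ≥0∞) :
    (μ.bind ν).expect f = μ.expect fun a => (ν a).expect f := by
  simp only [expect, bind_apply, ← ENNReal.tsum_mul_right, ← ENNReal.tsum_mul_left]
  rw [ENNReal.tsum_comm]
  simp only [mul_assoc]

theorem expect_map (g : α → β) (f : β → ℝ≥0∞) : (μ.map g).expect f = μ.expect (f ∘ g) := by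
  rw [← bind_pure_comp, expect_bind]
  simp only [Function.comp_apply, expect_pure]
  rfl

theorem expect_mono {f g : α → ℝ≥0∞} (h : ∀ a ∈ μ.support, f a ≤ g a) :
    μ.expect f ≤ μ.expect g := by
  refine ENNReal.tsum_le_tsum fun a => ?_
  by_cases ha : a ∈ μ.support
  · gcongr; exact h a ha
  · rw [(apply_eq_zero_iff μ a).2 ha]; simp

theorem expect_const (c : ℝ≥0∞) : μ.expect (fun _ => c) = c := by
  rw [expect, ENNReal.tsum_mul_right, tsum_coe, one_mul]

theorem expect_mul_const (c : ℝ≥0∞) (f : α → ℝ≥0∞) :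
    μ.expect (fun a => f a * c) = μ.expect f * c := by
  simp only [expect, ← ENNReal.tsum_mul_right, mul_assoc]

theorem expect_add (f g : α → ℝ≥0∞) :
    μ.expect (fun a => f a + g a) = μ.expect f + μ.expect g := by
  simp only [expect, ← ENNReal.tsum_add, mul_add]

theorem toOuterMeasure_eq_expect (A : Set α) :
    μ.toOuterMeasure A = μ.expect (A.indicator fun _ => 1) := by
  rw [toOuterMeasure_apply, expect]
  refine tsum_congr fun a => ?_
  by_cases ha : a ∈ A <;> simp [ha]

theorem toOuterMeasure_le_one (A : Set α) : μ.toOuterMeasure A ≤ 1 := by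
  rw [toOuterMeasure_eq_expect]
  refine (μ.expect_mono fun a _ => ?_).trans (expect_const μ 1).le
  exact Set.indicator_le_self' (fun _ _ => zero_le) a

theorem toOuterMeasure_le_expect {A : Set α} {f : α → ℝ≥0∞}
    (h : ∀ a ∈ μ.support, a ∈ A → 1 ≤ f a) : μ.toOuterMeasure A ≤ μ.expect f := by
  rw [toOuterMeasure_eq_expect]
  refine μ.expect_mono fun a ha => ?_
  by_cases hA : a ∈ A
  · simpa [hA] using h a ha hA
  · simp [hA]

theorem toOuterMeasure_bind_eq_expect (ν : α → PMF β) (A : Set β) :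
    (μ.bind ν).toOuterMeasure A = μ.expect fun a => (ν a).toOuterMeasure A := by
  simp only [toOuterMeasure_eq_expect, expect_bind]

end PMF

theorem coin_expect (f : ℕ → ℝ≥0∞) : coin.expect f = (f 0 + f 1) / 2 := by
  rw [coin, PMF.expect_map, PMF.expect, tsum_bool]
  simp [PMF.uniformOfFintype_apply]
  rw [ENNReal.div_eq_inv_mul, mul_add]

theorem coin_bind_apply {α : Type*} (f : ℕ → PMF α) (x : α) :
    coin.bind f x = (f 0 x + f 1 x) / 2 := by
  rw [PMF.bind_apply]
  exact coin_expect fun b => f b x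

/-! ### Closeness of laws -/

/-- The inequality of differential privacy. -/
def Close {α : Type*} (K δ : ℝ≥0∞) (μ μ' : PMF α) : Prop :=
  ∀ A : Set α, μ.toOuterMeasure A ≤ K * μ'.toOuterMeasure A + δ

namespace Close

variable {α β : Type*} {K K₁ K₂ δ δ₁ δ₂ : ℝ≥0∞} {μ μ' : PMF α}

theorem refl (μ : PMF α) : Close 1 0 μ μ := fun A => by simp

theorem mono (h : Close K₁ δ₁ μ μ') (hK : K₁ ≤ K₂) (hδ : δ₁ ≤ δ₂) : Close K₂ δ₂ μ μ' :=
  fun A => (h A).trans (by gcongr)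

theorem map (h : Close K δ μ μ') (f : α → β) : Close K δ (μ.map f) (μ'.map f) := fun A => by
  rw [PMF.toOuterMeasure_map_apply, PMF.toOuterMeasure_map_apply]
  exact h _

theorem of_pointwise (B : Set α) (hB : μ.toOuterMeasure B ≤ δ)
    (h : ∀ a ∉ B, μ a ≤ K * μ' a) : Close K δ μ μ' := fun A => by
  refine le_trans ?_ (add_le_add_right hB _)
  simp only [PMF.toOuterMeasure_apply, ← ENNReal.tsum_mul_left, ← ENNReal.tsum_add]
  refine ENNReal.tsum_le_tsum fun a => ?_
  by_cases hA : a ∈ A <;> by_cases hB : a ∈ B <;> simp [hA, hB]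
  exact h a hB

theorem expect_le (h : Close K δ μ μ') (hK : K ≠ ∞) {f : α → ℝ≥0∞} (hf : ∀ a, f a ≤ 1) :
    μ.expect f ≤ K * μ'.expect f + δ := by
  set s : Set α := {a | K * μ' a ≤ μ a}
  have hD : ∑' a, (μ a - K * μ' a) ≤ δ := by
    have hsum : ∑' a, (μ a - K * μ' a) + K * μ'.toOuterMeasure s = μ.toOuterMeasure s := by
      simp only [PMF.toOuterMeasure_apply, ← ENNReal.tsum_mul_left, ← ENNReal.tsum_add]
      refine tsum_congr fun a => ?_
      by_cases ha : a ∈ s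
      · simp only [ha, Set.indicator_of_mem]
        exact tsub_add_cancel_of_le ha
      · simp only [ha, not_false_eq_true, Set.indicator_of_notMem, mul_zero, add_zero]
        exact tsub_eq_zero_of_le (not_le.1 ha).le
    have hfin : K * μ'.toOuterMeasure s ≠ ∞ :=
      ENNReal.mul_ne_top hK (ne_top_of_le_ne_top ENNReal.one_ne_top (μ'.toOuterMeasure_le_one s))
    have := h s
    rw [← hsum, add_comm] at this
    exact (ENNReal.add_le_add_iff_left hfin).1 this
  refine le_trans ?_ (add_le_add_right hD _)
  simp only [PMF.expect, ← ENNReal.tsum_mul_left, ← ENNReal.tsum_add]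
  refine ENNReal.tsum_le_tsum fun a => ?_
  calc μ a * f a ≤ (K * μ' a + (μ a - K * μ' a)) * f a := by
        gcongr
        exact le_add_tsub
    _ = K * (μ' a * f a) + (μ a - K * μ' a) * f a := by ring
    _ ≤ K * (μ' a * f a) + (μ a - K * μ' a) * 1 := by
        gcongr
        exact hf a
    _ = _ := by rw [mul_one]

theorem bind {ν ν' : α → PMF β} (h : Close K₁ δ₁ μ μ') (hK : K₁ ≠ ∞)
    (hν : ∀ a, Close K₂ δ₂ (ν a) (ν' a)) : Close (K₁ * K₂) (δ₁ + δ₂) (μ.bind ν) (μ'.bind ν') := by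
  intro A
  rw [PMF.toOuterMeasure_bind_eq_expect, PMF.toOuterMeasure_bind_eq_expect]
  calc (μ.expect fun a => (ν a).toOuterMeasure A)
      ≤ μ.expect fun a => min 1 (K₂ * (ν' a).toOuterMeasure A) + δ₂ := by
        refine μ.expect_mono fun a _ => ?_
        rw [← min_add_add_right]
        exact le_min ((PMF.toOuterMeasure_le_one _ _).trans le_self_add) (hν a A)
    _ = (μ.expect fun a => min 1 (K₂ * (ν' a).toOuterMeasure A)) + δ₂ := by
        rw [PMF.expect_add, PMF.expect_const]
    _ ≤ K₁ * (μ'.expect fun a => min 1 (K₂ * (ν' a).toOuterMeasure A)) + δ₁ + δ₂ := by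
        gcongr
        exact h.expect_le hK fun a => min_le_left _ _
    _ ≤ K₁ * (μ'.expect fun a => (ν' a).toOuterMeasure A * K₂) + δ₁ + δ₂ := by
        gcongr
        exact μ'.expect_mono fun a _ => (min_le_right _ _).trans (mul_comm _ _).le
    _ = _ := by
        rw [PMF.expect_mul_const]
        ring

theorem listLaw {f f' : ℕ → PMF α} {K δ : ℕ → ℝ≥0∞} (h : ∀ i, Close (K i) (δ i) (f i) (f' i))
    (hK : ∀ i, K i ≠ ∞) (m : ℕ) :
    Close (∏ i ∈ Finset.range m, K i) (∑ i ∈ Finset.range m, δ i) (listLaw f m)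
      (listLaw f' m) := by
  induction m with
  | zero =>
    rw [Finset.prod_range_zero, Finset.sum_range_zero]
    exact refl (PMF.pure [])
  | succ m ih =>
    rw [Finset.prod_range_succ, Finset.sum_range_succ]
    exact ih.bind (ENNReal.prod_ne_top fun i _ => hK i) fun l => (h m).map _

end Close

/-! ### Binomial noise -/

theorem binLaw_succ (N : ℕ) :
    binLaw (N + 1) = coin.bind fun b => (binLaw N).map fun v => v + b := by
  rw [binLaw, iterLaw]
  simp only [← PMF.bind_pure_comp]
  rw [PMF.bind_comm]
  rfl

theorem PMF.map_add_right_apply (μ : PMF ℕ) (j : ℕ) :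
    μ.map (fun v => v + 1) j = if j = 0 then 0 else μ (j - 1) := by
  rw [PMF.map_apply]
  refine (tsum_eq_single (j - 1) fun i hi => if_neg (by omega)).trans ?_
  by_cases hj : j = 0
  · simp [hj]
  · rw [if_pos (by omega), if_neg hj]

theorem binLaw_apply (N j : ℕ) : binLaw N j = N.choose j / 2 ^ N := by
  induction N generalizing j with
  | zero =>
    cases j <;> simp [binLaw, iterLaw]
  | succ N ih =>
    rw [binLaw_succ, coin_bind_apply, PMF.map_add_right_apply]
    simp only [add_zero]
    rw [show (binLaw N).map (fun v => v) = binLaw N from PMF.map_id _, ih]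
    have h2 : ((2 : ℝ≥0∞) ^ (N + 1))⁻¹ = (2 ^ N)⁻¹ * 2⁻¹ := by
      rw [pow_succ, ENNReal.mul_inv (by simp) (by simp)]
    cases j with
    | zero => simp [ENNReal.div_eq_inv_mul, h2, mul_comm]
    | succ j =>
      rw [if_neg (by omega), Nat.add_sub_cancel, ih, Nat.choose_succ_succ]
      simp only [div_eq_mul_inv, h2, Nat.cast_add]
      ring

theorem coin_expect_exp (lam x : ℝ) :
    coin.expect (fun b => ENNReal.ofReal (Real.exp (lam * (2 * b - 1)) * x)) =
      ENNReal.ofReal (Real.cosh lam * x) := by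
  rw [coin_expect, Real.cosh_eq]
  by_cases hx : 0 ≤ x
  · rw [← ENNReal.ofReal_add (by positivity) (by positivity),
      show (2 : ℝ≥0∞) = ENNReal.ofReal 2 by simp, ← ENNReal.ofReal_div_of_pos (by norm_num)]
    congr 1
    push_cast
    ring_nf
  · have hx' := (not_le.1 hx).le
    rw [ENNReal.ofReal_of_nonpos (mul_nonpos_of_nonneg_of_nonpos (by positivity) hx'),
      ENNReal.ofReal_of_nonpos (mul_nonpos_of_nonneg_of_nonpos (by positivity) hx'),
      ENNReal.ofReal_of_nonpos (mul_nonpos_of_nonneg_of_nonpos (by positivity) hx')]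
    simp

theorem binLaw_expect_exp (N : ℕ) (lam : ℝ) :
    (binLaw N).expect (fun v => ENNReal.ofReal (Real.exp (lam * (2 * v - N)))) =
      ENNReal.ofReal (Real.cosh lam ^ N) := by
  induction N with
  | zero => simp [binLaw, iterLaw, PMF.expect_pure]
  | succ N ih =>
    rw [binLaw, iterLaw, PMF.expect_bind]
    have : ∀ v : ℕ, (coin.map fun b => v + b).expect
        (fun v => ENNReal.ofReal (Real.exp (lam * (2 * v - (N + 1 : ℕ))))) =
        ENNReal.ofReal (Real.exp (lam * (2 * v - N))) * ENNReal.ofReal (Real.cosh lam) := by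
      intro v
      rw [← ENNReal.ofReal_mul (Real.exp_pos _).le, mul_comm (Real.exp _), ← coin_expect_exp,
        PMF.expect_map]
      congr 1
      ext b
      simp only [Function.comp_apply]
      rw [← Real.exp_add]
      congr 2
      push_cast
      ring
    simp only [this]
    rw [PMF.expect_mul_const]
    have h := ih
    rw [binLaw] at h
    rw [h, ← ENNReal.ofReal_mul (by positivity), pow_succ]

theorem binLaw_tail (N : ℕ) (lam : ℝ) :
    (binLaw N).toOuterMeasure {v | N * lam ^ 2 ≤ lam * (2 * v - N)} ≤
      ENNReal.ofReal (Real.exp (-(N * lam ^ 2 / 2))) := by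
  calc (binLaw N).toOuterMeasure {v | N * lam ^ 2 ≤ lam * (2 * v - N)}
      ≤ (binLaw N).expect fun v => ENNReal.ofReal (Real.exp (lam * (2 * v - N))) *
          ENNReal.ofReal (Real.exp (-(N * lam ^ 2))) := by
        refine PMF.toOuterMeasure_le_expect _ fun v _ hv => ?_
        rw [← ENNReal.ofReal_mul (Real.exp_pos _).le, ← Real.exp_add, ENNReal.one_le_ofReal]
        refine Real.one_le_exp ?_
        rw [Set.mem_ofPred_eq] at hv
        linarith
    _ = ENNReal.ofReal (Real.cosh lam ^ N * Real.exp (-(N * lam ^ 2))) := by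
        rw [PMF.expect_mul_const, binLaw_expect_exp, ← ENNReal.ofReal_mul (by positivity)]
    _ ≤ _ := by
        refine ENNReal.ofReal_le_ofReal ?_
        calc Real.cosh lam ^ N * Real.exp (-(N * lam ^ 2))
            ≤ Real.exp (lam ^ 2 / 2) ^ N * Real.exp (-(N * lam ^ 2)) := by
              gcongr
              exact Real.cosh_le_exp_half_sq lam
          _ = _ := by
              rw [← Real.exp_nat_mul, ← Real.exp_add]
              congr 1
              ring

theorem ENNReal.natCast_div_le {a b N : ℕ} {K : ℝ} (hK : 0 ≤ K) (h : (a : ℝ) ≤ K * b) :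
    (a : ℝ≥0∞) / 2 ^ N ≤ ENNReal.ofReal K * (b / 2 ^ N) := by
  rw [← mul_div_assoc]
  gcongr
  rw [← ENNReal.ofReal_natCast, ← ENNReal.ofReal_natCast b, ← ENNReal.ofReal_mul hK]
  exact ENNReal.ofReal_le_ofReal h

theorem binLaw_close_shift {N : ℕ} {ε : ℝ} (hε : 0 < ε) (hε1 : ε ≤ 1) (hN : 4 ≤ N * ε) :
    Close (ENNReal.ofReal (1 + ε)) (ENNReal.ofReal (Real.exp (-(N * ε ^ 2 / 72)))) (binLaw N)
      ((binLaw N).map fun v => v + 1) := by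
  have hN0 : (0 : ℝ) ≤ N := Nat.cast_nonneg N
  refine Close.of_pointwise {v | N * (-(ε / 6)) ^ 2 ≤ (-(ε / 6)) * (2 * v - N)} ?_ ?_
  · refine (binLaw_tail N (-(ε / 6))).trans (ENNReal.ofReal_le_ofReal ?_)
    rw [Real.exp_le_exp]
    ring_nf
    exact le_rfl
  · intro j hj
    rw [Set.mem_ofPred_eq, not_le] at hj
    have hj' : (N : ℝ) * (1 - ε / 6) < 2 * j := by
      have : ε / 6 * (N * (1 - ε / 6) - 2 * j) < 0 := by nlinarith
      by_contra h
      have := mul_nonneg (by positivity : 0 ≤ ε / 6) (by linarith : 0 ≤ N * (1 - ε / 6) - 2 * j)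
      linarith
    rw [PMF.map_add_right_apply]
    obtain _ | i := j
    · exfalso
      have : 0 ≤ (N : ℝ) * (1 - ε / 6) := mul_nonneg hN0 (by linarith)
      simp at hj'
      linarith
    · rw [if_neg (by omega), Nat.add_sub_cancel, binLaw_apply, binLaw_apply]
      refine ENNReal.natCast_div_le (by positivity) ?_
      have hch : (N.choose (i + 1) : ℝ) * (i + 1) = N.choose i * ((N - i : ℕ) : ℝ) := by
        exact_mod_cast Nat.choose_succ_right_eq N i
      have hsub : ((N - i : ℕ) : ℝ) ≤ (1 + ε) * (i + 1) := by
        by_cases hi : i ≤ N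
        · rw [Nat.cast_sub hi]
          push_cast at hj'
          nlinarith [mul_nonneg hN0 (mul_nonneg hε.le (sub_nonneg.2 hε1))]
        · rw [Nat.sub_eq_zero_of_le (by omega)]
          push_cast
          positivity
      have hpos : (0 : ℝ) < i + 1 := by positivity
      refine le_of_mul_le_mul_right ?_ hpos
      rw [hch]
      calc (N.choose i : ℝ) * ((N - i : ℕ) : ℝ) ≤ N.choose i * ((1 + ε) * (i + 1)) := by gcongr
        _ = _ := by ring

theorem binLaw_shift_close {N : ℕ} {ε : ℝ} (hε : 0 < ε) (hε1 : ε ≤ 1) (hN : 4 ≤ N * ε) :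
    Close (ENNReal.ofReal (1 + ε)) (ENNReal.ofReal (Real.exp (-(N * ε ^ 2 / 72))))
      ((binLaw N).map fun v => v + 1) (binLaw N) := by
  have hN0 : (0 : ℝ) ≤ N := Nat.cast_nonneg N
  refine Close.of_pointwise {v | ∃ j : ℕ, v = j + 1 ∧ N * (ε / 6) ^ 2 ≤ (ε / 6) * (2 * j - N)} ?_ ?_
  · rw [PMF.toOuterMeasure_map_apply]
    have : (fun v => v + 1) ⁻¹' {v : ℕ | ∃ j : ℕ, v = j + 1 ∧
        N * (ε / 6) ^ 2 ≤ (ε / 6) * (2 * j - N)} =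
        {j : ℕ | N * (ε / 6) ^ 2 ≤ (ε / 6) * (2 * j - N)} := by
      ext v; simp
    rw [this]
    refine (binLaw_tail N (ε / 6)).trans (ENNReal.ofReal_le_ofReal ?_)
    rw [Real.exp_le_exp]
    ring_nf
    exact le_rfl
  · intro j hj
    rw [PMF.map_add_right_apply]
    obtain _ | i := j
    · simp
    · have hi : ¬ (N * (ε / 6) ^ 2 ≤ (ε / 6) * (2 * i - N)) := fun h => hj ⟨i, rfl, h⟩
      rw [not_le] at hi
      have hi' : 2 * i < (N : ℝ) * (1 + ε / 6) := by
        by_contra h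
        have := mul_nonneg (by positivity : 0 ≤ ε / 6) (by linarith : 0 ≤ 2 * i - N * (1 + ε / 6))
        nlinarith
      rw [if_neg (by omega), Nat.add_sub_cancel, binLaw_apply, binLaw_apply]
      refine ENNReal.natCast_div_le (by positivity) ?_
      have hch : (N.choose (i + 1) : ℝ) * (i + 1) = N.choose i * ((N - i : ℕ) : ℝ) := by
        exact_mod_cast Nat.choose_succ_right_eq N i
      have hiN : (i : ℝ) < N := by nlinarith
      rw [Nat.cast_sub (by exact_mod_cast hiN.le)] at hch
      have hsub : (i : ℝ) + 1 ≤ (1 + ε) * (N - i) := by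
        nlinarith [mul_nonneg hN0 (mul_nonneg hε.le (sub_nonneg.2 hε1))]
      have hpos : (0 : ℝ) < N - i := by linarith
      refine le_of_mul_le_mul_right ?_ hpos
      rw [← hch]
      calc (N.choose (i + 1) : ℝ) * (i + 1) ≤ N.choose (i + 1) * ((1 + ε) * (N - i)) := by gcongr
        _ = _ := by ring

/-! ### Privacy of the mechanism -/

theorem Multiset.eq_or_cons_of_card_sub_add_sub_le {α : Type*} [DecidableEq α] {D D' : Multiset α}
    (h : ((D - D') + (D' - D)).card ≤ 1) : D = D' ∨ ∃ x, D = x ::ₘ D' ∨ D' = x ::ₘ D := by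
  have key : ∀ {D D' : Multiset α}, D - D' = 0 → (D' - D).card ≤ 1 → D = D' ∨ ∃ x, D' = x ::ₘ D := by
    intro D D' h0 h1
    have hle : D ≤ D' := tsub_eq_zero_iff_le.1 h0
    have hD' : D' - D + D = D' := tsub_add_cancel_of_le hle
    rcases Nat.le_one_iff_eq_zero_or_eq_one.1 h1 with h | h
    · rw [Multiset.card_eq_zero] at h
      rw [h, zero_add] at hD'
      exact Or.inl hD'
    · obtain ⟨x, hx⟩ := Multiset.card_eq_one.1 h
      rw [hx, Multiset.singleton_add] at hD'
      exact Or.inr ⟨x, hD'.symm⟩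
  rw [Multiset.card_add] at h
  by_cases h0 : (D - D').card = 0
  · rcases key (Multiset.card_eq_zero.1 h0) (by omega) with h | ⟨x, h⟩
    · exact Or.inl h
    · exact Or.inr ⟨x, Or.inr h⟩
  · rcases key (Multiset.card_eq_zero.1 (by omega : (D' - D).card = 0)) (by omega) with h | ⟨x, h⟩
    · exact Or.inl h.symm
    · exact Or.inr ⟨x, Or.inl h⟩

theorem tableLaw_close {cnt cnt' : ℕ → ℕ} {N T b₀ : ℕ} {ε : ℝ} (hε : 0 < ε) (hε1 : ε ≤ 1)
    (hN : 4 ≤ N * ε) (h : ∀ b, b ≠ b₀ → cnt b = cnt' b)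
    (h₀ : cnt' b₀ = cnt b₀ + 1 ∨ cnt b₀ = cnt' b₀ + 1) :
    Close (ENNReal.ofReal (1 + ε)) (ENNReal.ofReal (Real.exp (-(N * ε ^ 2 / 72))))
      (tableLaw cnt N T) (tableLaw cnt' N T) := by
  set K := ENNReal.ofReal (1 + ε)
  set δ := ENNReal.ofReal (Real.exp (-(N * ε ^ 2 / 72)))
  have h1K : 1 ≤ K := ENNReal.one_le_ofReal.2 (by linarith)
  refine (Close.listLaw (K := fun b => if b = b₀ then K else 1)
    (δ := fun b => if b = b₀ then δ else 0) (fun b => ?_) (fun b => ?_) T).mono ?_ ?_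
  · by_cases hb : b = b₀
    · subst hb
      simp only [if_true]
      rcases h₀ with h₀ | h₀
      · have := (binLaw_close_shift hε hε1 hN).map fun y => cnt b + y
        rw [PMF.map_comp] at this
        convert this using 2
        ext y
        rw [h₀, Function.comp_apply]
        ring
      · have := (binLaw_shift_close hε hε1 hN).map fun y => cnt' b + y
        rw [PMF.map_comp] at this
        convert this using 2
        ext y
        rw [h₀, Function.comp_apply]
        ring
    · rw [if_neg hb, if_neg hb, h b hb]
      exact Close.refl _
  · split_ifs
    · exact ENNReal.ofReal_ne_top
    · exact ENNReal.one_ne_top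
  · rw [Finset.prod_ite_eq']
    split_ifs
    · exact le_rfl
    · exact h1K
  · rw [Finset.sum_ite_eq']
    split_ifs
    · exact le_rfl
    · exact zero_le

theorem repLaw_close {d s N T : ℕ} {l l' : List (Fin d → Bool)} {ε : ℝ} (hε : 0 < ε) (hε1 : ε ≤ 1)
    (hN : 4 ≤ N * ε) {x : Fin d → Bool} (h : l'.Perm (x :: l) ∨ l.Perm (x :: l')) :
    Close (ENNReal.ofReal (1 + ε)) (ENNReal.ofReal (Real.exp (-(N * ε ^ 2 / 72))))
      (repLaw l s N T) (repLaw l' s N T) := by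
  rw [← one_mul (ENNReal.ofReal (1 + ε)),
    ← zero_add (ENNReal.ofReal (Real.exp (-(N * ε ^ 2 / 72))))]
  refine (Close.refl _).bind ENNReal.one_ne_top fun g => Close.map ?_ _
  refine tableLaw_close hε hε1 hN (b₀ := hashVal g (zeroSet x)) ?_ ?_
  · intro b hb
    rcases h with h | h
    · simp [cellCount, h.countP_eq, Ne.symm hb]
    · simp [cellCount, h.countP_eq, Ne.symm hb]
  · rcases h with h | h
    · left; simp [cellCount, h.countP_eq]
    · right; simp [cellCount, h.countP_eq]

theorem repLaw_perm {d s N T : ℕ} {l l' : List (Fin d → Bool)} (h : l.Perm l') :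
    repLaw l s N T = repLaw l' s N T := by
  have : cellCount l = cellCount l' := by
    ext g b
    exact h.countP_eq _
  rw [repLaw, repLaw, this]

theorem Params.le_of_defect {p : Params} (h : p.defect = 0) :
    p.n + 1 ≤ 2 * 2 ^ p.k ∧ p.d ≤ 2 ^ p.logDim ∧ p.b₂ ≤ p.b₁ * 2 ^ p.logConf ∧
      p.d₂ * p.reps ≤ p.d₁ * 2 ^ p.logDelta ∧ p.e₂ ≤ p.e₁ * 2 ^ p.logEps := by
  unfold Params.defect at h
  omega

theorem Params.reps_pos {p : Params} (h : p.defect = 0) : 0 < p.reps := by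
  obtain ⟨h1, h2, -⟩ := Params.le_of_defect h
  obtain ⟨h3, h4⟩ := Params.pos_of_defect h
  have hk : p.k ≠ 0 := fun h => by rw [h] at h1; omega
  have hd : p.logDim ≠ 0 := fun h => by rw [h] at h2; omega
  unfold Params.reps
  positivity

theorem Params.coins_ge {p : Params} (h : p.defect = 0) (he : 0 < p.e₁) (he2 : 0 < p.e₂) :
    128 * ((p.logDelta : ℝ) + 1) ≤ p.coins * ((p.e₁ : ℝ) / p.e₂ / p.reps) ^ 2 := by
  obtain ⟨-, -, -, -, h5⟩ := Params.le_of_defect h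
  have ht : (0 : ℝ) < p.reps := by exact_mod_cast Params.reps_pos h
  have he' : (0 : ℝ) < p.e₁ := by exact_mod_cast he
  have he2' : (0 : ℝ) < p.e₂ := by exact_mod_cast he2
  have h5' : (p.e₂ : ℝ) ≤ p.e₁ * 2 ^ p.logEps := by exact_mod_cast h5
  have h6 : 1 ≤ (2 : ℝ) ^ p.logEps * (p.e₁ / p.e₂) := by
    rw [← mul_div_assoc, one_le_div he2']
    linarith
  have : (p.coins : ℝ) * ((p.e₁ : ℝ) / p.e₂ / p.reps) ^ 2 =
      128 * ((p.logDelta : ℝ) + 1) * ((2 : ℝ) ^ p.logEps * (p.e₁ / p.e₂)) ^ 2 := by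
    rw [Params.coins]
    push_cast
    rw [pow_add, mul_comm 2 p.logEps, pow_mul]
    field_simp
    norm_num
  rw [this]
  exact le_mul_of_one_le_right (by positivity) (one_le_pow₀ h6)

theorem mechLaw_close {p : Params} {l l' : List (Fin p.d → Bool)}
    (he : 0 < p.e₁) (he2 : p.e₁ < p.e₂) (hd1 : 0 < p.d₁) (hd2 : 0 < p.d₂)
    (h : ((l : Multiset (Fin p.d → Bool)) - l' + (l' - l)).card ≤ 1) :
    Close (ENNReal.ofReal (Real.exp (p.e₁ / p.e₂))) (ENNReal.ofReal (p.d₁ / p.d₂))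
      (mechLaw p l) (mechLaw p l') := by
  have hK : (1 : ℝ≥0∞) ≤ ENNReal.ofReal (Real.exp (p.e₁ / p.e₂)) :=
    ENNReal.one_le_ofReal.2 (Real.one_le_exp (by positivity))
  unfold mechLaw
  by_cases hdef : p.defect = 0
  swap
  · rw [if_neg hdef, if_neg hdef]
    exact (Close.refl _).mono hK zero_le
  rw [if_pos hdef, if_pos hdef]
  refine Close.map ?_ _
  rcases Multiset.eq_or_cons_of_card_sub_add_sub_le h with h | ⟨x, h⟩
  · rw [repLaw_perm (Multiset.coe_eq_coe.1 h)]
    exact (Close.refl _).mono hK zero_le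
  have hperm : l'.Perm (x :: l) ∨ l.Perm (x :: l') := by
    rcases h with h | h
    · exact Or.inr (Multiset.coe_eq_coe.1 (by simpa using h))
    · exact Or.inl (Multiset.coe_eq_coe.1 (by simpa using h))
  have ht := Params.reps_pos hdef
  have ht' : (1 : ℝ) ≤ p.reps := by exact_mod_cast ht
  have ht0 : (0 : ℝ) < p.reps := by linarith
  have he' : (0 : ℝ) < p.e₁ := by exact_mod_cast he
  have he2' : (p.e₁ : ℝ) < p.e₂ := by exact_mod_cast he2
  have hd1' : (0 : ℝ) < p.d₁ := by exact_mod_cast hd1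
  have hd2' : (0 : ℝ) < p.d₂ := by exact_mod_cast hd2
  have hge := Params.coins_ge hdef he (by omega)
  set ε : ℝ := (p.e₁ : ℝ) / p.e₂ / p.reps with hε
  have hε0 : 0 < ε := by
    have : (0 : ℝ) < p.e₂ := by linarith
    positivity
  have hε1 : ε ≤ 1 := by
    rw [hε, div_le_one ht0]
    refine le_trans ?_ ht'
    rw [div_le_one (by linarith)]
    exact he2'.le
  have hN : 4 ≤ (p.coins : ℝ) * ε := by
    have h1 : (p.coins : ℝ) * ε ^ 2 ≤ p.coins * ε := by
      gcongr
      exact pow_le_of_le_one hε0.le hε1 two_ne_zero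
    have : (0 : ℝ) ≤ p.logDelta := Nat.cast_nonneg _
    linarith
  refine (Close.listLaw (fun _ => repLaw_close hε0 hε1 hN hperm) (fun _ => ENNReal.ofReal_ne_top)
    p.reps).mono ?_ ?_
  · rw [Finset.prod_const, Finset.card_range, ← ENNReal.ofReal_pow (by positivity)]
    refine ENNReal.ofReal_le_ofReal ?_
    calc (1 + ε) ^ p.reps ≤ Real.exp ε ^ p.reps := by
          gcongr
          rw [add_comm]
          exact Real.add_one_le_exp ε
      _ = Real.exp (p.e₁ / p.e₂) := by
          rw [← Real.exp_nat_mul, hε, mul_div_cancel₀ _ ht0.ne']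
  · rw [Finset.sum_const, Finset.card_range, nsmul_eq_mul, ← ENNReal.ofReal_natCast,
      ← ENNReal.ofReal_mul ht0.le]
    refine ENNReal.ofReal_le_ofReal ?_
    obtain ⟨-, -, -, h4, -⟩ := Params.le_of_defect hdef
    have h4' : (p.d₂ : ℝ) * p.reps ≤ p.d₁ * 2 ^ p.logDelta := by exact_mod_cast h4
    have h2 : Real.exp (-(p.coins * ε ^ 2 / 72)) ≤ ((2 : ℝ) ^ p.logDelta)⁻¹ := by
      rw [Real.exp_neg]
      gcongr
      calc (2 : ℝ) ^ p.logDelta ≤ Real.exp 1 ^ p.logDelta := by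
            gcongr
            linarith [Real.add_one_le_exp (1 : ℝ)]
        _ = Real.exp p.logDelta := by rw [← Real.exp_nat_mul, mul_one]
        _ ≤ _ := by
            rw [Real.exp_le_exp]
            have : (0 : ℝ) ≤ p.logDelta := Nat.cast_nonneg _
            linarith
    calc p.reps * Real.exp (-(p.coins * ε ^ 2 / 72)) ≤ p.reps * ((2 : ℝ) ^ p.logDelta)⁻¹ := by
          gcongr
      _ ≤ p.d₁ / p.d₂ := by
          rw [← div_eq_mul_inv, div_le_div_iff₀ (by positivity) hd2']
          linarith

/-! ### Independent samples -/

theorem length_of_mem_support_listLaw {A : Type*} {f : ℕ → PMF A} {m : ℕ} {l : List A}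
    (h : l ∈ (listLaw f m).support) : l.length = m := by
  induction m generalizing l with
  | zero =>
    obtain rfl : l = [] := by simpa [listLaw, iterLaw] using h
    rfl
  | succ m ih =>
    rw [listLaw, iterLaw, PMF.mem_support_bind_iff] at h
    obtain ⟨l', h1, h2⟩ := h
    obtain ⟨y, -, rfl⟩ := (PMF.mem_support_map_iff _ _ _).1 h2
    simp [ih h1]

theorem listLaw_succ_expect {A : Type*} (f : ℕ → PMF A) (m : ℕ) (g : List A → ℝ≥0∞) :
    (listLaw f (m + 1)).expect g =
      (listLaw f m).expect fun l => (f m).expect fun y => g (l ++ [y]) := by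
  rw [listLaw, iterLaw, PMF.expect_bind]
  simp only [PMF.expect_map]
  rfl

theorem PMF.expect_congr {α : Type*} (μ : PMF α) {f g : α → ℝ≥0∞}
    (h : ∀ a ∈ μ.support, f a = g a) : μ.expect f = μ.expect g :=
  le_antisymm (μ.expect_mono fun a ha => (h a ha).le) (μ.expect_mono fun a ha => (h a ha).ge)

theorem listLaw_expect_prod {A : Type*} (f : ℕ → PMF A) (m : ℕ) (g : ℕ → A → ℝ≥0∞) (a₀ : A) :
    (listLaw f m).expect (fun l => ∏ i ∈ Finset.range m, g i (l.getD i a₀)) =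
      ∏ i ∈ Finset.range m, (f i).expect (g i) := by
  induction m with
  | zero => simp [PMF.expect_const]
  | succ m ih =>
    rw [listLaw_succ_expect, Finset.prod_range_succ, ← ih, ← PMF.expect_mul_const]
    refine PMF.expect_congr _ fun l hl => ?_
    have hlen := length_of_mem_support_listLaw hl
    rw [mul_comm, ← PMF.expect_mul_const]
    refine PMF.expect_congr _ fun y _ => ?_
    rw [Finset.prod_range_succ, mul_comm]
    congr 1
    · rw [List.getD_append_right _ _ _ _ hlen.le, hlen]
      simp
    · refine Finset.prod_congr rfl fun i hi => ?_
      rw [List.getD_append _ _ _ _ (by rw [hlen]; exact Finset.mem_range.1 hi)]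

theorem listLaw_expect_map_prod {A : Type*} (μ : PMF A) (m : ℕ) (g : A → ℝ≥0∞) :
    (listLaw (fun _ => μ) m).expect (fun l => (l.map g).prod) = μ.expect g ^ m := by
  induction m with
  | zero => simp [listLaw, iterLaw, PMF.expect_pure]
  | succ m ih =>
    rw [listLaw_succ_expect, pow_succ, ← ih, ← PMF.expect_mul_const]
    refine PMF.expect_congr _ fun l _ => ?_
    rw [mul_comm, ← PMF.expect_mul_const]
    refine PMF.expect_congr _ fun y _ => ?_
    simp [mul_comm]

/-- If an event has probability at most `1 / 64`, then it is unlikely that it happens at least half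
of the time. -/
theorem listLaw_majority {A : Type*} (μ : PMF A) (bad : A → Prop) [DecidablePred bad]
    (h : μ.toOuterMeasure {a | bad a} ≤ 1 / 64) (m : ℕ) :
    (listLaw (fun _ => μ) m).toOuterMeasure {l | m ≤ 2 * l.countP bad} ≤ (1 / 4) ^ m := by
  have hcount : ∀ l : List A, (l.map fun a => if bad a then (64 : ℝ≥0∞) else 1).prod =
      64 ^ l.countP bad := by
    intro l
    induction l with
    | nil => simp
    | cons a l ih =>
      by_cases ha : bad a <;> simp [ha, ih, pow_succ, mul_comm]
  have hE : (μ.expect fun a => if bad a then (64 : ℝ≥0∞) else 1) ≤ 2 := by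
    calc (μ.expect fun a => if bad a then (64 : ℝ≥0∞) else 1)
        ≤ μ.expect fun a => 1 + {a | bad a}.indicator (fun _ => 1) a * 64 := by
          refine μ.expect_mono fun a _ => ?_
          by_cases ha : bad a <;> simp [ha]
      _ = 1 + μ.toOuterMeasure {a | bad a} * 64 := by
          rw [PMF.expect_add, PMF.expect_const, PMF.expect_mul_const,
            ← PMF.toOuterMeasure_eq_expect]
      _ ≤ 1 + 1 / 64 * 64 := by gcongr
      _ = 2 := by
          rw [ENNReal.div_mul_cancel (by norm_num) (by norm_num)]
          norm_num
  calc (listLaw (fun _ => μ) m).toOuterMeasure {l | m ≤ 2 * l.countP bad}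
      ≤ (listLaw (fun _ => μ) m).expect fun l =>
          (l.map fun a => if bad a then (64 : ℝ≥0∞) else 1).prod * (8 ^ m)⁻¹ := by
        refine PMF.toOuterMeasure_le_expect _ fun l _ hl => ?_
        rw [hcount, ← div_eq_mul_inv, ENNReal.le_div_iff_mul_le (by simp) (by simp), one_mul,
          show (64 : ℝ≥0∞) = 8 ^ 2 by norm_num, ← pow_mul]
        exact pow_le_pow_right₀ (by norm_num) hl
    _ = (μ.expect fun a => if bad a then (64 : ℝ≥0∞) else 1) ^ m * (8 ^ m)⁻¹ := by
        rw [PMF.expect_mul_const, listLaw_expect_map_prod]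
    _ ≤ 2 ^ m * (8 ^ m)⁻¹ := by gcongr
    _ = (1 / 4) ^ m := by
        rw [ENNReal.inv_pow, ← mul_pow]
        congr 1
        rw [show (8 : ℝ≥0∞) = 2 * 4 by norm_num, ENNReal.mul_inv (by simp) (by simp), ← mul_assoc,
          ENNReal.mul_inv_cancel (by simp) (by simp), one_mul, one_div]

/-! ### The median -/

theorem foldl_medianStep_le (V L : List ℕ) (b : ℕ) :
    L.foldl (medianStep V) b ≤ b ∧
      ∀ v ∈ L, V.length ≤ 2 * V.countP (· ≤ v) → L.foldl (medianStep V) b ≤ v := by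
  induction L generalizing b with
  | nil => simp
  | cons x L ih =>
    obtain ⟨h1, h2⟩ := ih (medianStep V b x)
    have hb : medianStep V b x ≤ b := by rw [medianStep]; split_ifs <;> simp
    rw [List.foldl_cons]
    refine ⟨h1.trans hb, fun v hv hc => ?_⟩
    rcases List.mem_cons.1 hv with rfl | hv
    · refine h1.trans ?_
      rw [medianStep, if_pos hc]
      exact min_le_right _ _
    · exact h2 v hv hc

theorem foldl_medianStep_eq (V L : List ℕ) (b : ℕ) :
    L.foldl (medianStep V) b = b ∨
      V.length ≤ 2 * V.countP (· ≤ L.foldl (medianStep V) b) := by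
  induction L generalizing b with
  | nil => simp
  | cons x L ih =>
    rw [List.foldl_cons]
    rcases ih (medianStep V b x) with h | h
    · rw [h, medianStep]
      split_ifs with hc
      · rcases min_choice b x with hm | hm <;> rw [hm]
        · exact Or.inl rfl
        · exact Or.inr hc
      · exact Or.inl rfl
    · exact Or.inr h

/-- If more than half of the values are close to `c`, then so is the median. -/
theorem abs_median_sub_lt {V : List ℕ} {c s : ℝ} {bad : ℕ → Prop} [DecidablePred bad]
    (hbad : ∀ v, ¬ bad v → |2 * (v : ℝ) - c| < s) (h : 2 * V.countP bad < V.length) :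
    |2 * (median V : ℝ) - c| < s := by
  have hgood : V.length = V.countP bad + V.countP (fun v => ¬ bad v) := by
    rw [List.length_eq_countP_add_countP (p := fun v => bad v) (l := V)]
    simp
  have hne : ((V.filter fun v => ¬ bad v).toFinset).Nonempty := by
    have : 0 < V.countP (fun v => ¬ bad v) := by omega
    obtain ⟨a, ha, hb⟩ := List.countP_pos_iff.1 this
    exact ⟨a, by simpa using ⟨ha, by simpa using hb⟩⟩
  obtain ⟨g, hg, hmax⟩ := Finset.exists_max_image _ id hne
  have hg' : g ∈ V ∧ ¬ bad g := by simpa using hg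
  have hmax' : ∀ v ∈ V, ¬ bad v → v ≤ g := fun v hv hb => hmax v (by simpa using ⟨hv, hb⟩)
  have hgs := abs_lt.1 (hbad g hg'.2)
  rw [abs_lt]
  constructor
  · by_contra hlow
    rw [not_lt] at hlow
    have hall : ∀ v ∈ V, v ≤ median V → bad v := by
      intro v _ hle
      by_contra hb
      have := abs_lt.1 (hbad v hb)
      have : (v : ℝ) ≤ median V := by exact_mod_cast hle
      linarith
    rcases foldl_medianStep_eq V V V.sum with hm | hm
    · refine hg'.2 (hall g hg'.1 ?_)
      rw [median, hm]
      exact List.le_sum_of_mem hg'.1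
    · have : V.countP (· ≤ median V) ≤ V.countP bad := by
        refine List.countP_mono_left fun v hv hle => ?_
        simpa using hall v hv (by simpa using hle)
      rw [← median] at hm
      omega
  · have : median V ≤ g := by
      refine (foldl_medianStep_le V V V.sum).2 g hg'.1 ?_
      have : V.countP (fun v => ¬ bad v) ≤ V.countP (· ≤ g) := by
        refine List.countP_mono_left fun v hv hb => ?_
        simpa using hmax' v hv (by simpa using hb)
      omega
    have : (median V : ℝ) ≤ g := by exact_mod_cast this
    linarith

/-! ### Collisions -/

theorem bitsLaw_apply_le (s v : ℕ) : bitsLaw s v ≤ (2 ^ s)⁻¹ := by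
  induction s generalizing v with
  | zero => simpa using (bitsLaw 0).coe_le_one v
  | succ s ih =>
    have hc : ∀ a : ℕ, (coin.map fun b => a + a + b) v ≤ if a = v / 2 then 2⁻¹ else 0 := by
      intro a
      rw [← PMF.bind_pure_comp, coin_bind_apply]
      simp only [Function.comp_apply, PMF.pure_apply]
      split_ifs <;> first | omega | simp
    have : bitsLaw (s + 1) v = ∑' a, bitsLaw s a * (coin.map fun b => a + a + b) v := by
      rw [bitsLaw, iterLaw, PMF.bind_apply]
      rfl
    rw [this]
    calc ∑' a, bitsLaw s a * (coin.map fun b => a + a + b) v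
        ≤ ∑' a, bitsLaw s a * if a = v / 2 then 2⁻¹ else 0 :=
          ENNReal.tsum_le_tsum fun a => by gcongr; exact hc a
      _ = bitsLaw s (v / 2) * 2⁻¹ := by
          rw [tsum_eq_single (v / 2) fun a ha => by simp [ha]]
          simp
      _ ≤ (2 ^ s)⁻¹ * 2⁻¹ := by gcongr; exact ih _
      _ = (2 ^ (s + 1))⁻¹ := by
          rw [pow_succ, ENNReal.mul_inv (by simp) (by simp)]

theorem hashVal_snoc {d : ℕ} {h : List ℕ} (hh : h.length = d) (y : ℕ) {Z : Finset ℕ}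
    (hZ : Z ⊆ Finset.range (d + 1)) :
    hashVal (h ++ [y]) Z = hashVal h (Z.erase d) + if d ∈ Z then y else 0 := by
  have h1 : ∀ i ∈ Z.erase d, (h ++ [y]).getD i 0 = h.getD i 0 := by
    intro i hi
    have := Finset.mem_range.1 (hZ (Finset.mem_of_mem_erase hi))
    have := Finset.ne_of_mem_erase hi
    exact List.getD_append _ _ _ _ (by omega)
  have h2 : (h ++ [y]).getD d 0 = y := by
    rw [List.getD_append_right _ _ _ _ hh.le, hh]; simp
  unfold hashVal
  split_ifs with hd
  · rw [← Finset.sum_erase_add _ _ hd, h2, Finset.sum_congr rfl h1]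
  · rw [Finset.erase_eq_of_notMem hd] at h1 ⊢
    rw [Finset.sum_congr rfl h1, add_zero]

theorem hashLaw_collision_le (d s : ℕ) {Z Y : Finset ℕ} (hZ : Z ⊆ Finset.range d)
    (hY : Y ⊆ Finset.range d) (hne : Z ≠ Y) :
    (hashLaw d s).toOuterMeasure {h | hashVal h Z = hashVal h Y} ≤ (2 ^ s)⁻¹ := by
  induction d generalizing Z Y with
  | zero =>
    rw [Finset.range_zero, Finset.subset_empty] at hZ hY
    exact absurd (hZ.trans hY.symm) hne
  | succ d ih =>
    rw [PMF.toOuterMeasure_eq_expect, hashLaw, listLaw_succ_expect]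
    have hsub : ∀ {Z : Finset ℕ}, Z ⊆ Finset.range (d + 1) → Z.erase d ⊆ Finset.range d := by
      intro Z hZ i hi
      have := Finset.mem_range.1 (hZ (Finset.mem_of_mem_erase hi))
      have := Finset.ne_of_mem_erase hi
      exact Finset.mem_range.2 (by omega)
    by_cases hd : d ∈ Z ↔ d ∈ Y
    · have hne' : Z.erase d ≠ Y.erase d := by
        intro he
        apply hne
        ext i
        by_cases hi : i = d
        · rw [hi]; exact hd
        · have := Finset.ext_iff.1 he i
          simpa [hi] using this
      refine le_trans ?_ (ih (hsub hZ) (hsub hY) hne')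
      rw [PMF.toOuterMeasure_eq_expect]
      refine PMF.expect_mono _ fun h hh => ?_
      have hlen := length_of_mem_support_listLaw hh
      refine ((PMF.expect_mono _ fun y _ => ?_).trans (PMF.expect_const (bitsLaw s) _).le)
      have hiff : hashVal (h ++ [y]) Z = hashVal (h ++ [y]) Y ↔
          hashVal h (Z.erase d) = hashVal h (Y.erase d) := by
        rw [hashVal_snoc hlen y hZ, hashVal_snoc hlen y hY]
        by_cases hdZ : d ∈ Z
        · rw [if_pos hdZ, if_pos (hd.1 hdZ), add_left_inj]
        · rw [if_neg hdZ, if_neg fun h => hdZ (hd.2 h), add_zero, add_zero]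
      simp only [Set.indicator_apply, Set.mem_ofPred_eq, hiff]
      exact le_rfl
    · have key : ∀ h ∈ (listLaw (fun _ => bitsLaw s) d).support, ∃ w, ∀ y,
          hashVal (h ++ [y]) Z = hashVal (h ++ [y]) Y → y = w := by
        intro h hh
        have hlen := length_of_mem_support_listLaw hh
        by_cases hdZ : d ∈ Z
        · have hdY : d ∉ Y := fun h => hd ⟨fun _ => h, fun _ => hdZ⟩
          refine ⟨hashVal h (Y.erase d) - hashVal h (Z.erase d), fun y hy => ?_⟩
          rw [hashVal_snoc hlen y hZ, hashVal_snoc hlen y hY, if_pos hdZ, if_neg hdY] at hy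
          omega
        · have hdY : d ∈ Y := by by_contra h; exact hd ⟨fun h' => absurd h' hdZ, fun h' => absurd h' h⟩
          refine ⟨hashVal h (Z.erase d) - hashVal h (Y.erase d), fun y hy => ?_⟩
          rw [hashVal_snoc hlen y hZ, hashVal_snoc hlen y hY, if_neg hdZ, if_pos hdY] at hy
          omega
      refine (PMF.expect_mono _ fun h hh => ?_).trans (PMF.expect_const (hashLaw d s) _).le
      obtain ⟨w, hw⟩ := key h hh
      refine le_trans ?_ (bitsLaw_apply_le s w)
      calc (bitsLaw s).expect (fun y => {h | hashVal h Z = hashVal h Y}.indicator (fun _ => 1)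
            (h ++ [y])) ≤ (bitsLaw s).expect fun y => if y = w then 1 else 0 := by
            refine PMF.expect_mono _ fun y _ => ?_
            by_cases hy : hashVal (h ++ [y]) Z = hashVal (h ++ [y]) Y
            · rw [if_pos (hw y hy)]
              exact Set.indicator_le_self' (fun _ _ => zero_le) _
            · simp [hy]
        _ = bitsLaw s w := by
            rw [PMF.expect, tsum_eq_single w fun y hy => by simp [hy]]
            simp

/-! ### Accuracy of one repetition -/

/-- The number of points of the database whose zeros are all in `T`. -/
def contained {d : ℕ} (l : List (Fin d → Bool)) (T : Finset ℕ) : ℕ :=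
  l.countP fun x => zeroSet x ⊆ T

/-- There are no collisions that affect the query that belongs to `T`. -/
def CollisionFree {d : ℕ} (l : List (Fin d → Bool)) (T : Finset ℕ) (h : List ℕ) : Prop :=
  ∀ Z ∈ T.powerset, ∀ Y ∈ T.powerset ∪ (l.map zeroSet).toFinset, Z ≠ Y → hashVal h Z ≠ hashVal h Y

theorem not_collisionFree_le {d s : ℕ} (l : List (Fin d → Bool)) {T : Finset ℕ}
    (hT : T ⊆ Finset.range d) :
    (hashLaw d s).toOuterMeasure {h | ¬ CollisionFree l T h} ≤
      ((2 ^ T.card * (2 ^ T.card + l.length) : ℕ) : ℝ≥0∞) * (2 ^ s)⁻¹ := by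
  set U := T.powerset ∪ (l.map zeroSet).toFinset
  have hU : ∀ Y ∈ U, Y ⊆ Finset.range d := by
    intro Y hY
    rcases Finset.mem_union.1 hY with h | h
    · exact (Finset.mem_powerset.1 h).trans hT
    · obtain ⟨x, -, rfl⟩ := List.mem_map.1 (List.mem_toFinset.1 h)
      exact zeroSet_subset x
  have hcard : U.card ≤ 2 ^ T.card + l.length := by
    refine (Finset.card_union_le _ _).trans ?_
    rw [Finset.card_powerset]
    gcongr
    exact (List.toFinset_card_le _).trans (by simp)
  have hsub : {h | ¬ CollisionFree l T h} ⊆ ⋃ q ∈ (T.powerset ×ˢ U).filter fun q => q.1 ≠ q.2,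
      {h | hashVal h q.1 = hashVal h q.2} := by
    intro h hh
    simp only [CollisionFree, Set.mem_ofPred_eq] at hh
    push Not at hh
    obtain ⟨Z, hZ, Y, hY, hne, he⟩ := hh
    simp only [Set.mem_iUnion]
    exact ⟨(Z, Y), Finset.mem_filter.2 ⟨Finset.mem_product.2 ⟨hZ, hY⟩, hne⟩, he⟩
  refine (MeasureTheory.measure_mono hsub).trans ((MeasureTheory.measure_biUnion_finset_le _ _).trans
    ((Finset.sum_le_sum (g := fun _ => (2 ^ s)⁻¹) fun q hq => ?_).trans ?_))
  · obtain ⟨h1, h2⟩ := Finset.mem_filter.1 hq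
    obtain ⟨h3, h4⟩ := Finset.mem_product.1 h1
    exact hashLaw_collision_le d s ((Finset.mem_powerset.1 h3).trans hT) (hU _ h4) h2
  · rw [Finset.sum_const, nsmul_eq_mul]
    gcongr
    refine (Finset.card_filter_le _ _).trans ?_
    rw [Finset.card_product, Finset.card_powerset]
    gcongr

theorem sum_cellCount {d : ℕ} {l : List (Fin d → Bool)} {T : Finset ℕ} {h : List ℕ}
    (hh : CollisionFree l T h) :
    ∑ Z ∈ T.powerset, cellCount l h (hashVal h Z) = contained l T := by
  have key : ∀ l' : List (Fin d → Bool), (∀ x ∈ l', x ∈ l) →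
      ∑ Z ∈ T.powerset, cellCount l' h (hashVal h Z) = contained l' T := by
    intro l' hl'
    induction l' with
    | nil => simp [cellCount, contained]
    | cons x l' ih =>
      have ih' := ih fun y hy => hl' y (by simp [hy])
      simp only [cellCount, contained, List.countP_cons, Finset.sum_add_distrib] at ih' ⊢
      rw [ih']
      congr 1
      have hx : ∀ Z ∈ T.powerset,
          (if decide (hashVal h (zeroSet x) = hashVal h Z) = true then 1 else 0) =
          if Z = zeroSet x then 1 else 0 := by
        intro Z hZ
        by_cases hZx : Z = zeroSet x
        · simp [hZx]
        · have := hh Z hZ (zeroSet x) (Finset.mem_union_right _ (by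
            simpa using ⟨x, hl' x (by simp), rfl⟩)) hZx
          simp [hZx, this.symm]
      rw [Finset.sum_congr rfl hx, Finset.sum_ite_eq']
      simp
  exact key l fun _ h => h

theorem tableLaw_expect_exp (cnt : ℕ → ℕ) (N T : ℕ) {W : Finset ℕ} (hW : W ⊆ Finset.range T)
    (lam : ℝ) :
    (tableLaw cnt N T).expect (fun c => ENNReal.ofReal
      (Real.exp (lam * ∑ b ∈ W, (2 * ((c.getD b 0 : ℕ) - cnt b : ℝ) - N)))) =
      ENNReal.ofReal (Real.cosh lam ^ (N * W.card)) := by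
  have := listLaw_expect_prod (fun b => (binLaw N).map fun y => cnt b + y) T
    (fun b y => if b ∈ W then ENNReal.ofReal (Real.exp (lam * (2 * ((y : ℕ) - cnt b : ℝ) - N)))
      else 1) 0
  convert this using 1
  · rw [tableLaw]
    congr 1
    ext c
    rw [Finset.prod_ite_mem, Finset.inter_eq_right.2 hW, Finset.mul_sum, Real.exp_sum,
      ENNReal.ofReal_prod_of_nonneg fun _ _ => (Real.exp_pos _).le]
  · have hb : ∀ b, ((binLaw N).map fun y => cnt b + y).expect (fun y => if b ∈ W then
        ENNReal.ofReal (Real.exp (lam * (2 * ((y : ℕ) - cnt b : ℝ) - N))) else 1) =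
        if b ∈ W then ENNReal.ofReal (Real.cosh lam ^ N) else 1 := by
      intro b
      rw [PMF.expect_map]
      split_ifs with h
      · rw [← binLaw_expect_exp N lam]
        congr 1
        ext y
        simp
      · exact PMF.expect_const _ _
    simp only [hb]
    rw [Finset.prod_ite_mem, Finset.inter_eq_right.2 hW, Finset.prod_const, pow_mul,
      ENNReal.ofReal_pow (by positivity)]

theorem tableLaw_tail (cnt : ℕ → ℕ) (N T : ℕ) {W : Finset ℕ} (hW : W ⊆ Finset.range T)
    (lam : ℝ) :
    (tableLaw cnt N T).toOuterMeasure {c | (N * W.card : ℝ) * lam ^ 2 ≤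
      lam * ∑ b ∈ W, (2 * ((c.getD b 0 : ℕ) - cnt b : ℝ) - N)} ≤
      ENNReal.ofReal (Real.exp (-((N * W.card : ℝ) * lam ^ 2 / 2))) := by
  calc _ ≤ (tableLaw cnt N T).expect fun c => ENNReal.ofReal
          (Real.exp (lam * ∑ b ∈ W, (2 * ((c.getD b 0 : ℕ) - cnt b : ℝ) - N))) *
          ENNReal.ofReal (Real.exp (-((N * W.card : ℝ) * lam ^ 2))) := by
        refine PMF.toOuterMeasure_le_expect _ fun c _ hc => ?_
        rw [← ENNReal.ofReal_mul (Real.exp_pos _).le, ← Real.exp_add, ENNReal.one_le_ofReal]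
        refine Real.one_le_exp ?_
        rw [Set.mem_ofPred_eq] at hc
        linarith
    _ = ENNReal.ofReal (Real.cosh lam ^ (N * W.card) *
          Real.exp (-((N * W.card : ℝ) * lam ^ 2))) := by
        rw [PMF.expect_mul_const, tableLaw_expect_exp cnt N T hW,
          ← ENNReal.ofReal_mul (by positivity)]
    _ ≤ _ := by
        refine ENNReal.ofReal_le_ofReal ?_
        calc Real.cosh lam ^ (N * W.card) * Real.exp (-((N * W.card : ℝ) * lam ^ 2))
            ≤ Real.exp (lam ^ 2 / 2) ^ (N * W.card) *
                Real.exp (-((N * W.card : ℝ) * lam ^ 2)) := by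
              gcongr
              exact Real.cosh_le_exp_half_sq lam
          _ = _ := by
              rw [← Real.exp_nat_mul, ← Real.exp_add]
              congr 1
              push_cast
              ring

theorem tableLaw_abs_tail (cnt : ℕ → ℕ) {N T : ℕ} {W : Finset ℕ} (hW : W ⊆ Finset.range T)
    (hv : 0 < N * W.card) :
    (tableLaw cnt N T).toOuterMeasure {c | 4 * Real.sqrt (N * W.card) ≤
      |∑ b ∈ W, (2 * ((c.getD b 0 : ℕ) - cnt b : ℝ) - N)|} ≤ 1 / 128 := by
  set v : ℝ := N * W.card with hvdef
  have hv' : 0 < v := by rw [hvdef]; exact_mod_cast hv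
  have hs : 0 < Real.sqrt v := Real.sqrt_pos.2 hv'
  have hss : Real.sqrt v * Real.sqrt v = v := Real.mul_self_sqrt hv'.le
  have hlam : v * (4 / Real.sqrt v) ^ 2 = 16 := by
    rw [div_pow, Real.sq_sqrt hv'.le]
    field_simp
    norm_num
  have hsub : {c : List ℕ | 4 * Real.sqrt v ≤
      |∑ b ∈ W, (2 * ((c.getD b 0 : ℕ) - cnt b : ℝ) - N)|} ⊆
      {c | v * (4 / Real.sqrt v) ^ 2 ≤
        4 / Real.sqrt v * ∑ b ∈ W, (2 * ((c.getD b 0 : ℕ) - cnt b : ℝ) - N)} ∪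
      {c | v * (-(4 / Real.sqrt v)) ^ 2 ≤
        -(4 / Real.sqrt v) * ∑ b ∈ W, (2 * ((c.getD b 0 : ℕ) - cnt b : ℝ) - N)} := by
    intro c hc
    rw [Set.mem_ofPred_eq] at hc
    rw [Set.mem_union, Set.mem_ofPred_eq, Set.mem_ofPred_eq, neg_sq, hlam]
    generalize ∑ b ∈ W, (2 * ((c.getD b 0 : ℕ) - cnt b : ℝ) - N) = x at hc ⊢
    rcases le_abs.1 hc with h | h
    · left
      rw [div_mul_eq_mul_div, le_div_iff₀ hs]
      nlinarith
    · right
      rw [neg_mul, ← mul_neg, div_mul_eq_mul_div, le_div_iff₀ hs]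
      nlinarith
  have hexp : ENNReal.ofReal (Real.exp (-(16 / 2))) ≤ 1 / 256 := by
    rw [show (1 : ℝ≥0∞) / 256 = ENNReal.ofReal (1 / 256) by
      rw [ENNReal.ofReal_div_of_pos (by norm_num)]; simp]
    refine ENNReal.ofReal_le_ofReal ?_
    rw [Real.exp_neg, ← one_div]
    refine one_div_le_one_div_of_le (by norm_num) ?_
    calc (256 : ℝ) = 2 ^ 8 := by norm_num
      _ ≤ Real.exp 1 ^ 8 := by
          gcongr
          linarith [Real.add_one_le_exp (1 : ℝ)]
      _ = Real.exp (16 / 2) := by rw [← Real.exp_nat_mul]; norm_num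
  calc _ ≤ _ := MeasureTheory.measure_mono hsub
    _ ≤ _ := MeasureTheory.measure_union_le _ _
    _ ≤ 1 / 256 + 1 / 256 := by
        refine add_le_add ((tableLaw_tail cnt N T hW _).trans ?_)
          ((tableLaw_tail cnt N T hW _).trans ?_)
        · rw [hlam]; exact hexp
        · rw [neg_sq, hlam]; exact hexp
    _ = 1 / 128 := by
        rw [ENNReal.div_add_div_same, show (1 : ℝ≥0∞) + 1 = 1 * 2 by norm_num,
          show (256 : ℝ≥0∞) = 128 * 2 by norm_num,
          ENNReal.mul_div_mul_right _ _ (by norm_num) (by norm_num)]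

/-- One repetition answers the query that belongs to the zeros of `u` inaccurately. -/
def BadSum {d : ℕ} (l : List (Fin d → Bool)) (N : ℕ) (T : Finset ℕ) (v : ℕ) : Prop :=
  4 * Real.sqrt (N * 2 ^ T.card) ≤ |2 * (v : ℝ) - (N * 2 ^ T.card + 2 * contained l T)|

theorem repLaw_bad_le {d s N : ℕ} (l : List (Fin d → Bool)) (u : ℕ → ℕ) (hN : 0 < N)
    (hd : 0 < d) (hs : 128 * (2 ^ (zerosBelow u d).card * (2 ^ (zerosBelow u d).card + l.length))
      ≤ 2 ^ s) :
    (repLaw l s N (2 ^ s * d)).toOuterMeasure {r | BadSum l N (zerosBelow u d) (cellSum u d r)} ≤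
      1 / 64 := by
  set T := zerosBelow u d with hTdef
  have hT : T ⊆ Finset.range d := Finset.filter_subset _ _
  have hcoll : (hashLaw d s).toOuterMeasure {h | ¬ CollisionFree l T h} ≤ 1 / 128 := by
    refine (not_collisionFree_le l hT).trans ?_
    rw [← div_eq_mul_inv]
    refine ENNReal.div_le_of_le_mul ?_
    rw [mul_comm (1 / 128 : ℝ≥0∞), mul_one_div, ENNReal.le_div_iff_mul_le (by simp) (by simp),
      mul_comm]
    exact_mod_cast hs
  have hlen : ∀ h ∈ (hashLaw d s).support, ∀ y ∈ h, y < 2 ^ s := by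
    intro h hh
    obtain ⟨κ, k1, k2, -⟩ := hashP_spec (M := d + s) (d := d) (s := s) (inp := [])
      (σ := ⟨fun i => if i = 0 then 0 else if i = 1 then 1 else if i = 11 then d else s,
        fun _ => 0, []⟩) rfl rfl rfl rfl (by omega) (by omega)
    rw [← k1] at hh
    obtain ⟨x, hx, rfl⟩ := (PMF.mem_support_map_iff _ _ _).1 hh
    exact (k2 x hx).1.2.2.1
  have htab : ∀ h ∈ (hashLaw d s).support, CollisionFree l T h →
      ((tableLaw (cellCount l h) N (2 ^ s * d)).map fun c => (h, c)).toOuterMeasure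
        {r | BadSum l N T (cellSum u d r)} ≤ 1 / 128 := by
    intro h hh hfree
    have hinj : Set.InjOn (hashVal h) T.powerset := by
      intro Z hZ Y hY he
      by_contra hne
      exact hfree Z hZ Y (Finset.mem_union_left _ hY) hne he
    have hcard : (T.powerset.image (hashVal h)).card = 2 ^ T.card := by
      rw [Finset.card_image_of_injOn hinj, Finset.card_powerset]
    have hW : T.powerset.image (hashVal h) ⊆ Finset.range (2 ^ s * d) := by
      intro b hb
      obtain ⟨Z, hZ, rfl⟩ := Finset.mem_image.1 hb
      exact Finset.mem_range.2 (hashVal_lt hd (hlen h hh) ((Finset.mem_powerset.1 hZ).trans hT))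
    rw [PMF.toOuterMeasure_map_apply]
    refine le_trans (MeasureTheory.measure_mono ?_) (tableLaw_abs_tail (cellCount l h) hW
      (by rw [hcard]; positivity))
    intro c hc
    simp only [Set.mem_preimage, Set.mem_ofPred_eq, BadSum] at hc
    rw [Set.mem_ofPred_eq, hcard, Finset.sum_image hinj]
    push_cast
    convert hc using 2
    rw [cellSum, sum_subsetSums, ← sum_cellCount hfree]
    push_cast
    rw [Finset.sum_sub_distrib, Finset.sum_const, Finset.card_powerset, ← Finset.mul_sum,
      Finset.sum_sub_distrib, nsmul_eq_mul]
    push_cast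
    ring
  rw [repLaw, PMF.toOuterMeasure_bind_eq_expect]
  calc _ ≤ (hashLaw d s).expect fun h => {h | ¬ CollisionFree l T h}.indicator (fun _ => 1) h +
          1 / 128 := by
        refine PMF.expect_mono _ fun h hh => ?_
        by_cases hfree : CollisionFree l T h
        · exact (htab h hh hfree).trans le_add_self
        · refine (PMF.toOuterMeasure_le_one _ _).trans ?_
          simp [hfree]
    _ ≤ 1 / 128 + 1 / 128 := by
        rw [PMF.expect_add, PMF.expect_const, ← PMF.toOuterMeasure_eq_expect]
        gcongr
    _ = 1 / 64 := by
        rw [ENNReal.div_add_div_same, show (1 : ℝ≥0∞) + 1 = 1 * 2 by norm_num,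
          show (128 : ℝ≥0∞) = 64 * 2 by norm_num,
          ENNReal.mul_div_mul_right _ _ (by norm_num) (by norm_num)]

theorem median_bad_le {d s N : ℕ} (l : List (Fin d → Bool)) (u : ℕ → ℕ) (hN : 0 < N)
    (hd : 0 < d) (hs : 128 * (2 ^ (zerosBelow u d).card * (2 ^ (zerosBelow u d).card + l.length))
      ≤ 2 ^ s) (t : ℕ) :
    (listLaw (fun _ => repLaw l s N (2 ^ s * d)) t).toOuterMeasure
      {reps | BadSum l N (zerosBelow u d) (median (reps.map (cellSum u d)))} ≤ (1 / 4) ^ t := by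
  classical
  refine le_trans ?_ (listLaw_majority _ _ (repLaw_bad_le l u hN hd hs) t)
  refine PMF.toOuterMeasure_mono _ ?_
  rintro reps ⟨hbad, hsupp⟩
  by_contra hlt
  rw [Set.mem_ofPred_eq, not_le] at hlt
  refine absurd hbad (not_le.2 (abs_median_sub_lt
    (bad := fun v => BadSum l N (zerosBelow u d) v) (fun v hv => not_le.1 hv) ?_))
  rw [List.countP_map, List.length_map, length_of_mem_support_listLaw hsupp]
  exact hlt

/-! ### Bounds for the parameters -/

namespace Params

variable {p : Params}

theorem two_pow_k_le (hn : 1 ≤ p.n) : 2 ^ p.k ≤ p.n := by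
  rcases Nat.eq_zero_or_pos p.k with h | h
  · rw [h]; simpa using hn
  · have := lt_of_lt_doublings (a := 2) (b := p.n + 1) (m := p.n) (i := p.k - 1)
      (by rw [← k]; omega)
    rw [← pow_succ', Nat.sub_add_cancel h] at this
    omega

theorem lt_two_pow_k : p.n < 2 ^ (p.k + 1) := by
  have := le_mul_pow_doublings (a := 2) (b := p.n + 1) (m := p.n) le_rfl (by
    have := Nat.lt_two_pow_self (n := p.n)
    omega)
  rw [← k, ← pow_succ'] at this
  omega

theorem k_eq (hn : 1 ≤ p.n) : p.k = Nat.log 2 p.n :=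
  (Nat.log_eq_of_pow_le_of_lt_pow (two_pow_k_le hn) lt_two_pow_k).symm

theorem bounded (hn : 1 ≤ p.n) {x : ℕ} (hx : p.n + p.d ≤ x) :
    p.Bounded (4096 * (x + 1) ^ 7) := by
  have hk : p.k ≤ p.n := doublings_le _ _ _
  have hld : p.logDim ≤ p.d := doublings_le _ _ _
  have hlb : p.logConf ≤ p.n := doublings_le _ _ _
  have hL : p.logDelta ≤ 4 * p.n := doublings_le _ _ _
  have hle : p.logEps ≤ p.k + 1 := doublings_le _ _ _
  have h2k := two_pow_k_le hn
  have hle2 : 2 ^ p.logEps ≤ 2 * p.n := by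
    calc 2 ^ p.logEps ≤ 2 ^ (p.k + 1) := Nat.pow_le_pow_right (by norm_num) hle
      _ ≤ 2 * p.n := by rw [pow_succ]; omega
  set y := x + 1 with hy
  have ht : p.reps ≤ y ^ 2 := by
    calc p.reps ≤ p.d * p.n + p.n := by unfold reps; gcongr
      _ ≤ y * y := by
        have : (p.d + 1) * p.n ≤ y * y := Nat.mul_le_mul (by omega) (by omega)
        linarith
      _ = y ^ 2 := by ring
  have hy1 : 1 ≤ y := by omega
  have hy7 : y ^ 2 ≤ y ^ 7 := Nat.pow_le_pow_right hy1 (by norm_num)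
  have hy3 : y ^ 3 ≤ y ^ 7 := Nat.pow_le_pow_right hy1 (by norm_num)
  have hyy : y ≤ y ^ 7 := Nat.le_self_pow (by norm_num) y
  have hbits : p.bits = 2 * p.k + 10 := rfl
  refine ⟨by omega, by omega, ?_, ?_⟩
  · calc p.coins = p.reps * p.reps * (p.logDelta + 1) * (2 ^ p.logEps * 2 ^ p.logEps * 128) := by
          rw [coins, pow_add, two_mul, pow_add]; norm_num
      _ ≤ y ^ 2 * y ^ 2 * (4 * y) * ((2 * y) * (2 * y) * 128) := by
          have h1 : p.logDelta + 1 ≤ 4 * y := by omega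
          have h2 : 2 ^ p.logEps ≤ 2 * y := by omega
          gcongr
      _ = 2048 * y ^ 7 := by ring
      _ ≤ 4096 * y ^ 7 := by gcongr; norm_num
  · calc p.cells = 2 ^ p.k * 2 ^ p.k * 1024 * p.d := by
          rw [cells, bits, pow_add, two_mul, pow_add]; norm_num
      _ ≤ y * y * 1024 * y := by gcongr <;> omega
      _ = 1024 * y ^ 3 := by ring
      _ ≤ 4096 * y ^ 7 := by omega

theorem doublings_sub_one_mul_log_lt {a b m : ℕ} (ha : 0 < a) (h : 0 < doublings a b m) :
    ((doublings a b m : ℝ) - 1) * Real.log 2 < Real.log (b / a) := by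
  have h1 := lt_of_lt_doublings (a := a) (b := b) (m := m) (i := doublings a b m - 1) (by omega)
  have ha' : (0 : ℝ) < a := by exact_mod_cast ha
  have h2 : (2 : ℝ) ^ (doublings a b m - 1) < b / a := by
    rw [lt_div_iff₀ ha', mul_comm]
    exact_mod_cast h1
  have h3 := Real.log_lt_log (by positivity) h2
  rw [Real.log_pow, Nat.cast_sub h] at h3
  simpa using h3

theorem regime {ln A s E r q : ℝ} (hln : 0 ≤ ln) (hA : 0.47 < A) (hr : 0 < r) (hr1 : r ≤ 1)
    (hs : r ≤ s) (hE : 1 ≤ E) (hH : 1000 * (1 + ln) * A * s * E < r * q) :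
    E < q ∧ 1000 * A < q ∧ s < q := by
  have hs0 : 0 < s := hr.trans_le hs
  have h1 : 1000 * (A * s * E) < r * q := by
    refine lt_of_le_of_lt ?_ hH
    have : 0 ≤ A * s * E := by positivity
    have := mul_nonneg hln this
    linarith
  have hAE : 1000 * (A * E) < q := by
    have h2 : r * (1000 * (A * E)) < r * q := by
      refine lt_of_le_of_lt ?_ h1
      have := mul_le_mul_of_nonneg_right hs (by positivity : 0 ≤ 1000 * (A * E))
      linarith
    exact lt_of_mul_lt_mul_left h2 hr.le
  have hA1 : A ≤ A * E := le_mul_of_one_le_right (by linarith) hE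
  have hE1 : 0.47 * E ≤ A * E := mul_le_mul_of_nonneg_right hA.le (by linarith)
  have hAs : A * s ≤ A * s * E := le_mul_of_one_le_right (by positivity) hE
  have hs1 : 0.47 * s ≤ A * s := mul_le_mul_of_nonneg_right hA.le hs0.le
  have hrq : r * q ≤ q := mul_le_of_le_one_left (by linarith) hr1
  exact ⟨by linarith, by linarith, by linarith⟩

theorem log_two_le_log {x : ℕ} (hx : 2 ≤ x) : Real.log 2 ≤ Real.log x :=
  Real.log_le_log (by norm_num) (by exact_mod_cast hx)

theorem log_mul_log_gt (hn : 2 ≤ p.n) (hd : 2 ≤ p.d) : 0.47 < Real.log p.n * Real.log p.d := by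
  have h2 := Real.log_two_gt_d9
  have h3 : (0.69 : ℝ) * 0.69 ≤ Real.log p.n * Real.log p.d :=
    mul_le_mul (by linarith [log_two_le_log hn]) (by linarith [log_two_le_log hd]) (by norm_num)
      (by linarith [log_two_le_log hn])
  linarith

theorem reps_le (hn : 2 ≤ p.n) (hd : 2 ≤ p.d) (hb₁ : 0 < p.b₁) (hb : p.b₁ < p.b₂) :
    (p.reps : ℝ) ≤ 7 * (Real.log p.n * Real.log p.d + Real.log (p.b₂ / p.b₁)) := by
  have h2 := Real.log_two_gt_d9
  have h2' := Real.log_two_lt_d9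
  have hln := log_two_le_log hn
  have hld := log_two_le_log hd
  have hmul := log_mul_log_gt hn hd
  have hLβ0 : 0 ≤ Real.log (p.b₂ / p.b₁) := Real.log_nonneg (by
    rw [one_le_div (by exact_mod_cast hb₁)]
    exact_mod_cast hb.le)
  have hkl : p.k * Real.log 2 ≤ Real.log p.n := by
    rw [← Real.log_pow]
    refine Real.log_le_log (by positivity) ?_
    exact_mod_cast two_pow_k_le (p := p) (by omega)
  have hdim : p.logDim * Real.log 2 ≤ 2 * Real.log p.d := by
    rcases Nat.eq_zero_or_pos p.logDim with h | h
    · rw [h]; push_cast; linarith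
    · have := doublings_sub_one_mul_log_lt one_pos h
      rw [← logDim, Nat.cast_one, div_one] at this
      linarith
  have hconf : p.logConf * Real.log 2 ≤ Real.log (p.b₂ / p.b₁) + Real.log 2 := by
    rcases Nat.eq_zero_or_pos p.logConf with h | h
    · rw [h]; push_cast; linarith
    · have := doublings_sub_one_mul_log_lt hb₁ h
      rw [← logConf] at this
      linarith
  have hprod : (p.logDim : ℝ) * p.k * (Real.log 2 * Real.log 2) ≤
      2 * (Real.log p.n * Real.log p.d) := by
    calc (p.logDim : ℝ) * p.k * (Real.log 2 * Real.log 2) =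
        (p.logDim * Real.log 2) * (p.k * Real.log 2) := by ring
      _ ≤ (2 * Real.log p.d) * Real.log p.n :=
        mul_le_mul hdim hkl (by positivity) (by linarith)
      _ = _ := by ring
  have h47 : (0.47 : ℝ) ≤ Real.log 2 * Real.log 2 := by
    have : (0.69 : ℝ) * 0.69 ≤ Real.log 2 * Real.log 2 :=
      mul_le_mul (by linarith) (by linarith) (by norm_num) (by linarith)
    linarith
  have hx : (p.logDim : ℝ) * p.k * 0.47 ≤ 2 * (Real.log p.n * Real.log p.d) :=
    le_trans (mul_le_mul_of_nonneg_left h47 (by positivity)) hprod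
  have hy : (p.logConf : ℝ) * 0.69 ≤ Real.log (p.b₂ / p.b₁) + Real.log 2 :=
    le_trans (mul_le_mul_of_nonneg_left (by linarith) (by positivity)) hconf
  unfold reps
  push_cast
  linarith

theorem logDelta_le (hd₁ : 0 < p.d₁) (hd₂ : 0 < p.d₂) (ht : 0 < p.reps) (htn : p.reps ≤ p.n)
    {r : ℝ} (hr : 0 < r) (hr1 : r ≤ 1) (hδ : r ≤ Real.sqrt (Real.log (p.d₂ / p.d₁))) :
    (p.logDelta : ℝ) + 1 ≤
      (2 * (1 + Real.log p.n) * (Real.sqrt (Real.log (p.d₂ / p.d₁)) / r)) ^ 2 := by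
  have hd₁' : (0 : ℝ) < p.d₁ := by exact_mod_cast hd₁
  have hd₂' : (0 : ℝ) < p.d₂ := by exact_mod_cast hd₂
  have ht' : (0 : ℝ) < p.reps := by exact_mod_cast ht
  have htn' : (p.reps : ℝ) ≤ p.n := by exact_mod_cast htn
  have hl2 := Real.log_two_gt_d9
  have hl2' := Real.log_two_lt_d9
  have hlogt : Real.log p.reps ≤ Real.log p.n := Real.log_le_log ht' htn'
  have hln : 0 ≤ Real.log p.n := Real.log_natCast_nonneg _
  generalize Real.log p.n = ln at *
  have hu : 1 ≤ Real.sqrt (Real.log (p.d₂ / p.d₁)) / r := by rwa [one_le_div hr]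
  have hL0 : 0 < Real.log (p.d₂ / p.d₁) := Real.sqrt_pos.1 (hr.trans_le hδ)
  have h2 : (p.logDelta : ℝ) * Real.log 2 ≤ ln + Real.log (p.d₂ / p.d₁) + Real.log 2 := by
    rcases Nat.eq_zero_or_pos p.logDelta with h | h
    · rw [h]; push_cast; linarith
    · have := doublings_sub_one_mul_log_lt hd₁ h
      rw [← logDelta, Nat.cast_mul, mul_comm (p.d₂ : ℝ), mul_div_assoc,
        Real.log_mul ht'.ne' (by positivity)] at this
      linarith
  have h3 : (p.logDelta : ℝ) * 0.69 ≤ ln + Real.log (p.d₂ / p.d₁) + Real.log 2 :=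
    le_trans (mul_le_mul_of_nonneg_left (by linarith) (by positivity)) h2
  have hLs : Real.log (p.d₂ / p.d₁) ≤ (Real.sqrt (Real.log (p.d₂ / p.d₁)) / r) ^ 2 := by
    rw [div_pow, Real.sq_sqrt hL0.le]
    exact le_div_self hL0.le (by positivity) (pow_le_one₀ hr.le hr1)
  generalize Real.sqrt (Real.log (p.d₂ / p.d₁)) / r = u at *
  have hu2 : 1 ≤ u ^ 2 := one_le_pow₀ hu
  have h5 := mul_nonneg hln (sub_nonneg.2 hu2)
  have h4 : (p.logDelta : ℝ) + 1 ≤ 4 * ((1 + ln) * u ^ 2) := by linarith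
  refine h4.trans ?_
  have : (2 * (1 + ln) * u) ^ 2 = 4 * ((1 + ln) * u ^ 2) * (1 + ln) := by ring
  rw [this]
  exact le_mul_of_one_le_right (by positivity) (by linarith)

theorem two_pow_logEps_le (he₁ : 0 < p.e₁) (he : p.e₁ < p.e₂) :
    (2 : ℝ) ^ p.logEps ≤ 2 * (p.e₂ / p.e₁) := by
  have he₁' : (0 : ℝ) < p.e₁ := by exact_mod_cast he₁
  have hE1 : (1 : ℝ) ≤ p.e₂ / p.e₁ := by
    rw [one_le_div he₁']
    exact_mod_cast he.le
  rcases Nat.eq_zero_or_pos p.logEps with h | h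
  · rw [h, pow_zero]; linarith
  · have := lt_of_lt_doublings (a := p.e₁) (b := p.e₂) (m := p.k + 1) (i := p.logEps - 1)
      (by rw [← logEps]; omega)
    have h3 : (p.e₁ : ℝ) * 2 ^ (p.logEps - 1) < p.e₂ := by exact_mod_cast this
    rw [mul_comm, ← lt_div_iff₀ he₁'] at h3
    rw [← Nat.sub_add_cancel h, pow_succ]
    linarith

theorem sqrt_offset_le (hn : 1 ≤ p.n) {D E : ℝ} (hD0 : 0 ≤ D) (hE0 : 0 ≤ E)
    (hD : (p.logDelta : ℝ) + 1 ≤ D ^ 2) (hE : (2 : ℝ) ^ p.logEps ≤ E) :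
    Real.sqrt p.offset ≤ 12 * p.reps * D * E * Real.sqrt p.n := by
  refine Real.sqrt_le_iff.2 ⟨by positivity, ?_⟩
  have h2k : (2 : ℝ) ^ p.k ≤ p.n := by exact_mod_cast two_pow_k_le hn
  calc (p.offset : ℝ) = 128 * (p.reps * p.reps) * ((p.logDelta : ℝ) + 1) *
        ((2 : ℝ) ^ p.logEps) ^ 2 * 2 ^ p.k := by
        rw [offset, coins]
        push_cast
        rw [pow_add, mul_comm 2 p.logEps, pow_mul]
        norm_num
        ring
    _ ≤ 144 * (p.reps * p.reps) * D ^ 2 * E ^ 2 * p.n := by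
        gcongr
        norm_num
    _ = _ := by
        have := Real.mul_self_sqrt (Nat.cast_nonneg (α := ℝ) p.n)
        calc _ = 144 * (p.reps * p.reps) * D ^ 2 * E ^ 2 * (Real.sqrt p.n * Real.sqrt p.n) := by
              rw [this]
          _ = _ := by ring

theorem defect_eq_zero (hn : 2 ≤ p.n) (hd : 2 ≤ p.d) (he₁ : 0 < p.e₁) (hd₁ : 0 < p.d₁)
    (hd₂ : 0 < p.d₂) (hb₁ : 0 < p.b₁) (hb₂ : 0 < p.b₂) (hE : (p.e₂ : ℝ) / p.e₁ ≤ p.n)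
    (hδ : Real.log (p.d₂ / p.d₁) ≤ p.n) (hβ : Real.log (p.b₂ / p.b₁) ≤ p.n * Real.log 2)
    (htn : p.reps ≤ p.n) : p.defect = 0 := by
  have he₁' : (0 : ℝ) < p.e₁ := by exact_mod_cast he₁
  have hd₁' : (0 : ℝ) < p.d₁ := by exact_mod_cast hd₁
  have hd₂' : (0 : ℝ) < p.d₂ := by exact_mod_cast hd₂
  have hb₁' : (0 : ℝ) < p.b₁ := by exact_mod_cast hb₁
  have hb₂' : (0 : ℝ) < p.b₂ := by exact_mod_cast hb₂
  have hge_k := lt_two_pow_k (p := p)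
  have hdimle : p.d ≤ 1 * 2 ^ p.logDim := le_mul_pow_doublings (m := p.d) le_rfl (by
    rw [one_mul]; exact Nat.lt_two_pow_self.le)
  have hkle : p.n + 1 ≤ 2 * 2 ^ p.k := by rw [← pow_succ']; omega
  have hEle : p.e₂ ≤ p.e₁ * 2 ^ p.logEps := by
    refine le_mul_pow_doublings (m := p.k + 1) le_rfl ?_
    rw [div_le_iff₀ he₁', mul_comm] at hE
    have h1' : p.e₂ ≤ p.e₁ * p.n := by exact_mod_cast hE
    exact h1'.trans (Nat.mul_le_mul_left _ hge_k.le)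
  have hconfle : p.b₂ ≤ p.b₁ * 2 ^ p.logConf := by
    refine le_mul_pow_doublings (m := p.n) le_rfl ?_
    rw [← Real.log_pow] at hβ
    have h2 := (Real.log_le_log_iff (by positivity) (by positivity)).1 hβ
    rw [div_le_iff₀ hb₁', mul_comm] at h2
    exact_mod_cast h2
  have hδle : p.d₂ * p.reps ≤ p.d₁ * 2 ^ p.logDelta := by
    refine le_mul_pow_doublings (m := 4 * p.n) le_rfl ?_
    have h1 : (p.d₂ : ℝ) / p.d₁ ≤ 4 ^ p.n := by
      calc (p.d₂ : ℝ) / p.d₁ = Real.exp (Real.log (p.d₂ / p.d₁)) := by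
            rw [Real.exp_log (by positivity)]
        _ ≤ Real.exp p.n := Real.exp_le_exp.2 hδ
        _ = Real.exp 1 ^ p.n := by rw [← Real.exp_nat_mul, mul_one]
        _ ≤ 4 ^ p.n := by
            gcongr
            linarith [Real.exp_one_lt_d9]
    rw [div_le_iff₀ hd₁'] at h1
    have h2 : p.d₂ ≤ 4 ^ p.n * p.d₁ := by exact_mod_cast h1
    calc p.d₂ * p.reps ≤ (4 ^ p.n * p.d₁) * 4 ^ p.n :=
          Nat.mul_le_mul h2 (htn.trans (Nat.lt_pow_self (by norm_num)).le)
      _ = p.d₁ * 2 ^ (4 * p.n) := by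
          rw [show 4 * p.n = 2 * p.n + 2 * p.n by ring, pow_add, pow_mul]
          norm_num
          ring
  unfold defect
  omega

/-- If the bound of the theorem is not trivial, then the mechanism uses the data, and the noise is
within this bound. -/
theorem noise_le (hn : 2 ≤ p.n) (hd : 2 ≤ p.d) (he₁ : 0 < p.e₁) (he : p.e₁ < p.e₂)
    (hd₁ : 0 < p.d₁) (hd₂ : 0 < p.d₂) (hb₁ : 0 < p.b₁) (hb : p.b₁ < p.b₂) {r α : ℝ} (hr₀ : 0 < r)
    (hr₁ : r ≤ 1) (hδ : r ≤ Real.sqrt (Real.log (p.d₂ / p.d₁)))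
    (hα : α = 1000 / r * (1 + Real.log p.n) *
      ((Real.log p.n * Real.log p.d + Real.log (p.b₂ / p.b₁)) *
        Real.sqrt (Real.log (p.d₂ / p.d₁)) / (p.e₁ / p.e₂ * Real.sqrt p.n))) (hα1 : α < 1) :
    p.defect = 0 ∧ 2 * Real.sqrt p.offset / p.n ≤ α := by
  have hn' : (2 : ℝ) ≤ p.n := by exact_mod_cast hn
  have he₁' : (0 : ℝ) < p.e₁ := by exact_mod_cast he₁
  have he₂' : (0 : ℝ) < p.e₂ := by exact_mod_cast he₁.trans he
  have hb₁' : (0 : ℝ) < p.b₁ := by exact_mod_cast hb₁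
  have hE1 : (1 : ℝ) ≤ p.e₂ / p.e₁ := by rw [one_le_div he₁']; exact_mod_cast he.le
  have hLβ0 : 0 ≤ Real.log (p.b₂ / p.b₁) := Real.log_nonneg (by
    rw [one_le_div hb₁']
    exact_mod_cast hb.le)
  have hqq : Real.sqrt p.n * Real.sqrt p.n = p.n := Real.mul_self_sqrt (by linarith)
  have hq1 : 1 ≤ Real.sqrt p.n := Real.one_le_sqrt.2 (by linarith)
  have hqn : Real.sqrt p.n ≤ p.n := by
    have := mul_le_mul_of_nonneg_right hq1 (by linarith : 0 ≤ Real.sqrt p.n)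
    linarith
  have hLδ0 : 0 < Real.log (p.d₂ / p.d₁) := Real.sqrt_pos.1 (hr₀.trans_le hδ)
  have hln : 0 ≤ Real.log p.n := Real.log_natCast_nonneg _
  have hmul := log_mul_log_gt hn hd
  have hreps := reps_le hn hd hb₁ hb
  have hss : Real.sqrt (Real.log (p.d₂ / p.d₁)) * Real.sqrt (Real.log (p.d₂ / p.d₁)) =
    Real.log (p.d₂ / p.d₁) := Real.mul_self_sqrt hLδ0.le
  obtain ⟨A, hA⟩ : ∃ A, A = Real.log p.n * Real.log p.d + Real.log (p.b₂ / p.b₁) := ⟨_, rfl⟩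
  have hA0 : 0.47 < A := by linarith
  have hαeq : α = 1000 * (1 + Real.log p.n) * A * Real.sqrt (Real.log (p.d₂ / p.d₁)) *
      (p.e₂ / p.e₁) / (r * Real.sqrt p.n) := by
    rw [hα, ← hA]
    field_simp
  rw [← hA] at hreps
  have hH : 1000 * (1 + Real.log p.n) * A * Real.sqrt (Real.log (p.d₂ / p.d₁)) *
      (p.e₂ / p.e₁) < r * Real.sqrt p.n := by
    rw [hαeq, div_lt_one (by positivity)] at hα1
    exact hα1
  obtain ⟨hEn, hAn, hsn⟩ := regime hln hA0 hr₀ hr₁ hδ hE1 hH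
  have hLδn : Real.log (p.d₂ / p.d₁) ≤ p.n := by
    rw [← hss, ← hqq]
    exact mul_self_le_mul_self (Real.sqrt_nonneg _) hsn.le
  have htn : p.reps ≤ p.n := by
    have : (p.reps : ℝ) ≤ p.n := by linarith
    exact_mod_cast this
  have hβn : Real.log (p.b₂ / p.b₁) ≤ p.n * Real.log 2 := by
    have := mul_le_mul_of_nonneg_left Real.log_two_gt_d9.le (by linarith : (0 : ℝ) ≤ p.n)
    linarith
  have hdef := defect_eq_zero hn hd he₁ hd₁ hd₂ hb₁ (hb₁.trans hb) (by linarith) hLδn hβn htn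
  refine ⟨hdef, ?_⟩
  have hsq := sqrt_offset_le (p := p) (by omega) (by positivity) (by positivity)
    (logDelta_le hd₁ hd₂ (reps_pos hdef) htn hr₀ hr₁ hδ) (two_pow_logEps_le he₁ he)
  rw [hαeq]
  generalize Real.sqrt (Real.log (p.d₂ / p.d₁)) = s at *
  generalize (p.e₂ : ℝ) / p.e₁ = E at *
  generalize Real.log p.n = ln at *
  generalize Real.sqrt p.n = q at *
  have hs0 : 0 < s := hr₀.trans_le hδ
  have hX : 0 ≤ (1 + ln) * s * E := by positivity
  calc 2 * Real.sqrt p.offset / p.n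
      ≤ 2 * (12 * p.reps * (2 * (1 + ln) * (s / r)) * (2 * E) * q) / p.n := by gcongr
    _ = 96 * (p.reps * ((1 + ln) * s * E)) / (r * q) := by
        rw [← hqq]
        field_simp
        ring
    _ ≤ 96 * ((7 * A) * ((1 + ln) * s * E)) / (r * q) := by gcongr
    _ ≤ 1000 * (1 + ln) * A * s * E / (r * q) := by
        refine div_le_div_of_nonneg_right ?_ (by positivity)
        have : 0 ≤ A * ((1 + ln) * s * E) := mul_nonneg (by linarith) hX
        linarith

end Params

/-! ### Conjunctions and sets of zeros -/

theorem mem_zeroSet {d : ℕ} {x : Fin d → Bool} {j : ℕ} :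
    j ∈ zeroSet x ↔ ∃ h : j < d, x ⟨j, h⟩ = false := by
  rw [zeroSet, Finset.mem_filter, Finset.mem_range]
  constructor
  · rintro ⟨h, hx⟩
    refine ⟨h, ?_⟩
    simpa [encodePoint, h] using hx
  · rintro ⟨h, hx⟩
    exact ⟨h, by simp [encodePoint, h, hx]⟩

theorem card_zeroSet_indicator {d : ℕ} (S : Finset (Fin d)) :
    S.card + (zeroSet fun i => decide (i ∈ S)).card = d := by
  have : (zeroSet fun i => decide (i ∈ S)) = Sᶜ.map Fin.valEmbedding := by
    ext j
    rw [mem_zeroSet]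
    simp only [decide_eq_false_iff_not, Finset.mem_map, Finset.mem_compl, Fin.valEmbedding_apply]
    constructor
    · rintro ⟨h, hj⟩
      exact ⟨_, hj, rfl⟩
    · rintro ⟨i, hi, rfl⟩
      exact ⟨i.2, hi⟩
  rw [this, Finset.card_map, Finset.card_add_card_compl, Fintype.card_fin]

theorem zeroSet_subset_indicator {d : ℕ} (S : Finset (Fin d)) (x : Fin d → Bool) :
    (zeroSet x ⊆ zeroSet fun i => decide (i ∈ S)) ↔ ∀ i ∈ S, x i = true := by
  constructor
  · intro h i hi
    by_contra hx
    obtain ⟨_, h'⟩ := mem_zeroSet.1 (h (mem_zeroSet.2 ⟨i.2, by simpa using hx⟩))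
    simp [hi] at h'
  · intro h j hj
    obtain ⟨hjd, hx⟩ := mem_zeroSet.1 hj
    refine mem_zeroSet.2 ⟨hjd, ?_⟩
    by_contra hS
    rw [h _ (by simpa using hS)] at hx
    exact absurd hx (by simp)

theorem conjunction_eq {d : ℕ} (S : Finset (Fin d)) (x : Fin d → Bool) :
    conjunction S x = if zeroSet x ⊆ (zeroSet fun i => decide (i ∈ S)) then 1 else 0 := by
  rw [conjunction]
  simp only [zeroSet_subset_indicator]
  split_ifs with h
  · exact Finset.prod_eq_one fun i hi => by rw [if_pos (h i hi)]
  · push Not at h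
    obtain ⟨i, hi, hx⟩ := h
    exact Finset.prod_eq_zero hi (if_neg hx)

theorem queryValue_conjunction {d : ℕ} (S : Finset (Fin d)) (l : List (Fin d → Bool)) :
    queryValue (conjunction S) l = contained l (zeroSet fun i => decide (i ∈ S)) / l.length := by
  rw [queryValue, Multiset.coe_card, Multiset.map_coe, Multiset.sum_coe]
  congr 1
  rw [contained]
  induction l with
  | nil => simp
  | cons x l ih =>
    rw [List.map_cons, List.sum_cons, ih, List.countP_cons, conjunction_eq]
    by_cases h : zeroSet x ⊆ (zeroSet fun i => decide (i ∈ S)) <;> simp [h, add_comm]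

theorem contained_le_length {d : ℕ} (l : List (Fin d → Bool)) (T : Finset ℕ) :
    contained l T ≤ l.length := List.countP_le_length

theorem queryValue_conjunction_mem {d : ℕ} (S : Finset (Fin d)) (l : List (Fin d → Bool)) :
    queryValue (conjunction S) l ∈ Set.Icc (0 : ℝ) 1 := by
  rw [queryValue_conjunction]
  refine ⟨by positivity, div_le_one_of_le₀ ?_ (by positivity)⟩
  exact_mod_cast contained_le_length _ _

/-! ### The data structures that the mechanism outputs -/

/-- The answer that `evalP` reads off from the noisy count tables. -/
noncomputable def answer (p : Params) (S : Finset (Fin p.d)) (reps : List (List ℕ × List ℕ)) : ℝ :=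
  answerNum p.n p.offset (median (reps.map (cellSum
    (fun i => (encodePoint fun i => decide (i ∈ S)).getD i 0) p.d))) / (2 * p.n)

theorem answer_mem (p : Params) (S : Finset (Fin p.d)) (reps : List (List ℕ × List ℕ)) :
    answer p S reps ∈ Set.Icc (0 : ℝ) 1 := by
  refine ⟨by unfold answer; positivity, div_le_one_of_le₀ ?_ (by positivity)⟩
  exact_mod_cast min_le_right _ _

theorem abs_clamp_sub_le {n W c v : ℕ} (hc : c ≤ n) :
    |(2 * c : ℝ) - answerNum n W v| ≤ |2 * (v : ℝ) - (W + 2 * c)| := by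
  have hc' : (c : ℝ) ≤ n := by exact_mod_cast hc
  unfold answerNum
  rcases le_total (2 * v) W with h | h
  · have h' : (2 * v : ℝ) ≤ W := by exact_mod_cast h
    rw [Nat.sub_eq_zero_of_le h, Nat.zero_min, Nat.cast_zero, sub_zero, abs_of_nonneg (by positivity),
      abs_of_nonpos (by linarith [Nat.cast_nonneg (α := ℝ) c])]
    linarith
  · rw [Nat.cast_min, Nat.cast_sub h]
    push_cast
    rcases le_total ((2 * v : ℝ) - W) (2 * n) with h' | h'
    · rw [min_eq_left h', abs_sub_comm]
      exact le_of_eq (by ring_nf)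
    · rw [min_eq_right h', abs_of_nonpos (by linarith), abs_of_nonneg (by linarith)]
      linarith

theorem abs_queryValue_sub_answer_le {p : Params} (hn : 0 < p.n) {S : Finset (Fin p.d)}
    (hS : S ∈ conjunctionsOmitting p.d p.k) {l : List (Fin p.d → Bool)} (hl : l.length = p.n)
    {reps : List (List ℕ × List ℕ)}
    (h : ¬ BadSum l p.coins (zeroSet fun i => decide (i ∈ S)) (median (reps.map (cellSum
      (fun i => (encodePoint fun i => decide (i ∈ S)).getD i 0) p.d)))) :
    |queryValue (conjunction S) l - answer p S reps| ≤ 2 * Real.sqrt p.offset / p.n := by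
  have hcard : (zeroSet fun i => decide (i ∈ S)).card = p.k := by
    have h1 := card_zeroSet_indicator S
    have h2 : S.card + p.k = p.d := hS
    omega
  have hn' : (0 : ℝ) < p.n := by exact_mod_cast hn
  rw [BadSum, not_le, hcard] at h
  have hoff : (p.coins : ℝ) * 2 ^ p.k = (p.offset : ℕ) := by simp [Params.offset]
  rw [hoff] at h
  rw [queryValue_conjunction, hl, answer]
  have h1 := (abs_clamp_sub_le (n := p.n) (W := p.offset) (hl ▸ contained_le_length l
    (zeroSet fun i => decide (i ∈ S)))).trans h.le
  rw [show ∀ a b : ℝ, a / p.n - b / (2 * p.n) = (2 * a - b) / (2 * p.n) from fun a b => by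
    field_simp, abs_div, abs_of_pos (by positivity : (0 : ℝ) < 2 * p.n), div_le_div_iff₀
    (by positivity) hn']
  have := mul_le_mul_of_nonneg_right h1 hn'.le
  linarith

theorem exists_bad_le {p : Params} (hdef : p.defect = 0) (hb₁ : 0 < p.b₁) (hb₂ : 0 < p.b₂)
    {l : List (Fin p.d → Bool)} (hl : l.length = p.n) :
    (listLaw (fun _ => repLaw l p.bits p.coins p.cells) p.reps).toOuterMeasure
      {reps | ∃ S ∈ conjunctionsOmitting p.d p.k,
        BadSum l p.coins (zeroSet fun i => decide (i ∈ S)) (median (reps.map (cellSum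
          (fun i => (encodePoint fun i => decide (i ∈ S)).getD i 0) p.d)))} ≤
      ENNReal.ofReal (p.b₁ / p.b₂) := by
  obtain ⟨hn2, hd2⟩ := Params.pos_of_defect hdef
  obtain ⟨-, h2, h3, -⟩ := Params.le_of_defect hdef
  have hreps := Params.reps_pos hdef
  have hcoins : 0 < p.coins := by unfold Params.coins; positivity
  have hone : ∀ S ∈ Finset.powersetCard (p.d - p.k) (Finset.univ : Finset (Fin p.d)),
      (listLaw (fun _ => repLaw l p.bits p.coins p.cells) p.reps).toOuterMeasure
        {reps | S ∈ conjunctionsOmitting p.d p.k ∧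
          BadSum l p.coins (zeroSet fun i => decide (i ∈ S)) (median (reps.map (cellSum
            (fun i => (encodePoint fun i => decide (i ∈ S)).getD i 0) p.d)))} ≤
        (1 / 4) ^ p.reps := by
    intro S _
    by_cases hS : S ∈ conjunctionsOmitting p.d p.k
    swap
    · simp [hS]
    have hcard : (zeroSet fun i => decide (i ∈ S)).card = p.k := by
      have h1 := card_zeroSet_indicator S
      have h2 : S.card + p.k = p.d := hS
      omega
    simp only [hS, true_and]
    refine median_bad_le l (fun i => (encodePoint fun i => decide (i ∈ S)).getD i 0) hcoins
      (by omega) ?_ p.reps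
    change 128 * (2 ^ (zeroSet fun i => decide (i ∈ S)).card *
      (2 ^ (zeroSet fun i => decide (i ∈ S)).card + l.length)) ≤ 2 ^ p.bits
    have hlt := Params.lt_two_pow_k (p := p)
    rw [hcard, hl, Params.bits, pow_add, two_mul, pow_add]
    rw [pow_succ] at hlt
    calc 128 * (2 ^ p.k * (2 ^ p.k + p.n)) ≤ 128 * (2 ^ p.k * (2 ^ p.k + 2 ^ p.k * 2)) := by gcongr
      _ = 2 ^ p.k * 2 ^ p.k * 384 := by ring
      _ ≤ 2 ^ p.k * 2 ^ p.k * 2 ^ 10 := by gcongr; norm_num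
  calc _ ≤ (listLaw (fun _ => repLaw l p.bits p.coins p.cells) p.reps).toOuterMeasure
        (⋃ S ∈ Finset.powersetCard (p.d - p.k) (Finset.univ : Finset (Fin p.d)),
          {reps | S ∈ conjunctionsOmitting p.d p.k ∧
            BadSum l p.coins (zeroSet fun i => decide (i ∈ S)) (median (reps.map (cellSum
              (fun i => (encodePoint fun i => decide (i ∈ S)).getD i 0) p.d)))}) := by
        refine MeasureTheory.measure_mono ?_
        rintro reps ⟨S, hS, hbad⟩
        refine Set.mem_biUnion (x := S) ?_ ⟨hS, hbad⟩
        rw [Finset.mem_coe, Finset.mem_powersetCard_univ]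
        have h2 : S.card + p.k = p.d := hS
        omega
    _ ≤ ∑ S ∈ Finset.powersetCard (p.d - p.k) (Finset.univ : Finset (Fin p.d)),
          (1 / 4) ^ p.reps :=
        (MeasureTheory.measure_biUnion_finset_le _ _).trans (Finset.sum_le_sum hone)
    _ ≤ ENNReal.ofReal (p.b₁ / p.b₂) := ?_
  rw [Finset.sum_const, Finset.card_powersetCard, Finset.card_univ, Fintype.card_fin, nsmul_eq_mul]
  have hb₁' : (0 : ℝ) < p.b₁ := by exact_mod_cast hb₁
  have hb₂' : (0 : ℝ) < p.b₂ := by exact_mod_cast hb₂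
  have hcount : p.d.choose (p.d - p.k) ≤ 2 ^ (p.logDim * p.k) := by
    rcases le_total p.k p.d with h | h
    · rw [Nat.choose_symm h, pow_mul]
      exact (Nat.choose_le_pow _ _).trans (Nat.pow_le_pow_left h2 _)
    · rw [Nat.sub_eq_zero_of_le h, Nat.choose_zero_right]
      exact Nat.one_le_two_pow
  have hreal : (p.d.choose (p.d - p.k) : ℝ) * (1 / 4) ^ p.reps ≤ p.b₁ / p.b₂ := by
    have e1 : (p.d.choose (p.d - p.k) : ℝ) ≤ 2 ^ (p.logDim * p.k) := by exact_mod_cast hcount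
    have e2 : (p.b₂ : ℝ) ≤ p.b₁ * 2 ^ p.logConf := by exact_mod_cast h3
    calc (p.d.choose (p.d - p.k) : ℝ) * (1 / 4) ^ p.reps
        ≤ 2 ^ (p.logDim * p.k) * (1 / 2) ^ p.reps := by gcongr; norm_num
      _ = 1 / 2 ^ p.logConf := by
          rw [Params.reps, pow_add, ← mul_assoc, ← mul_pow]
          norm_num
          rw [one_div, inv_pow]
      _ ≤ p.b₁ / p.b₂ := by
          rw [div_le_div_iff₀ (by positivity) hb₂']
          linarith
  calc (p.d.choose (p.d - p.k) : ℝ≥0∞) * (1 / 4) ^ p.reps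
      = ENNReal.ofReal ((p.d.choose (p.d - p.k) : ℝ) * (1 / 4) ^ p.reps) := by
        rw [ENNReal.ofReal_mul (by positivity), ENNReal.ofReal_natCast,
          ENNReal.ofReal_pow (by norm_num), ENNReal.ofReal_div_of_pos (by norm_num)]
        norm_num
    _ ≤ _ := ENNReal.ofReal_le_ofReal hreal

/-! ### The running time -/

/-- A bound for the running times of `mechP` and `evalP`. -/
noncomputable def runtime : Polynomial ℕ :=
  (mechP.cost + evalP.cost).comp (4096 * (Polynomial.X + 1) ^ 7)

theorem runtime_eval (x : ℕ) :
    runtime.eval x = mechP.cost.eval (4096 * (x + 1) ^ 7) + evalP.cost.eval (4096 * (x + 1) ^ 7) := by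
  simp [runtime]

theorem mechP_halts {p : Params} (hn : 1 ≤ p.n) (l : List (Fin p.d → Bool)) :
    mechP.HaltsWithin (p.toList ++ [l.length] ++ l.flatMap encodePoint)
        (runtime.eval (p.n + p.d + l.length)) ∧
      mechP.outputLaw (p.toList ++ [l.length] ++ l.flatMap encodePoint)
        (runtime.eval (p.n + p.d + l.length)) = mechLaw p l := by
  have hl : l.length ≤ 4096 * (p.n + p.d + l.length + 1) ^ 7 := by
    have := Nat.le_self_pow (by norm_num : 7 ≠ 0) (p.n + p.d + l.length + 1)
    omega
  have := Samples.halts (enc := id) (mechP_spec (Params.bounded hn le_self_add) hl)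
    (t := runtime.eval (p.n + p.d + l.length)) (by rw [runtime_eval]; exact Nat.le_add_right _ _)
  rwa [PMF.map_id] at this

theorem Program.Returns.unique {p : Program} {inp o o' : List ℕ} {t : ℕ} (h : p.Returns inp t o)
    (h' : p.Returns inp t o') : o = o' := by
  obtain ⟨c, hc⟩ := (p.run inp t).support_nonempty
  rw [← (h c hc).2, (h' c hc).2]

open Classical in
/-- The value that `evalP` computes for the query `S` on the data structure `r`. -/
noncomputable def evalValue (p : Params) (S : Finset (Fin p.d)) (r : List ℕ) : ℝ :=
  if h : ∃ o, evalP.Returns (evalIn p (encodePoint fun i => decide (i ∈ S)) r)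
    (runtime.eval (p.n + p.d)) o then decodeAnswer h.choose else 0

theorem decodeAnswer_eq_evalValue {p : Params} {S : Finset (Fin p.d)} {r o : List ℕ}
    (h : evalP.Returns (evalIn p (encodePoint fun i => decide (i ∈ S)) r)
      (runtime.eval (p.n + p.d)) o) : decodeAnswer o = evalValue p S r := by
  have hex : ∃ o, evalP.Returns (evalIn p (encodePoint fun i => decide (i ∈ S)) r)
    (runtime.eval (p.n + p.d)) o := ⟨o, h⟩
  rw [evalValue, dif_pos hex, h.unique hex.choose_spec]

theorem evalP_returns_trivial (p : Params) (S : Finset (Fin p.d)) (b : ℕ) :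
    evalP.Returns (evalIn p (encodePoint fun i => decide (i ∈ S)) [0, b])
      (runtime.eval (p.n + p.d)) [b, 0, 1] :=
  (evalP_trivial (by simp [encodePoint])).returns
    (by rw [runtime_eval]; exact Nat.le_add_left _ _)

theorem evalValue_trivial (p : Params) (S : Finset (Fin p.d)) (b : ℕ) :
    evalValue p S [0, b] = b := by
  simp [← decodeAnswer_eq_evalValue (evalP_returns_trivial p S b), decodeAnswer]

theorem evalP_returns_release {p : Params} (hdef : p.defect = 0) {S : Finset (Fin p.d)}
    (hS : S ∈ conjunctionsOmitting p.d p.k) {reps : List (List ℕ × List ℕ)}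
    (hreps : GoodReps p reps) :
    evalP.Returns (evalIn p (encodePoint fun i => decide (i ∈ S))
        (encodeOutput p.reps p.cells p.offset reps)) (runtime.eval (p.n + p.d))
      [answerNum p.n p.offset (median (reps.map (cellSum
        (fun i => (encodePoint fun i => decide (i ∈ S)).getD i 0) p.d))), 0, 2 * p.n] := by
  obtain ⟨hn, hd⟩ := Params.pos_of_defect hdef
  have hM := (Params.bounded (p := p) (by omega) le_rfl).1
  have hcard : (zeroSet fun i => decide (i ∈ S)).card = p.k := by
    have h1 := card_zeroSet_indicator S
    have h2 : S.card + p.k = p.d := hS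
    omega
  refine (evalP_spec (M := 4096 * (p.n + p.d + 1) ^ 7) hreps (by simp [encodePoint]) (by omega) ?_ (by omega) (by omega)
    (by omega)).returns (by rw [runtime_eval]; exact Nat.le_add_left _ _)
  change 2 ^ (zeroSet fun i => decide (i ∈ S)).card ≤ p.n
  rw [hcard]
  exact Params.two_pow_k_le (by omega)

theorem evalValue_release {p : Params} (hdef : p.defect = 0) {S : Finset (Fin p.d)}
    (hS : S ∈ conjunctionsOmitting p.d p.k) {reps : List (List ℕ × List ℕ)}
    (hreps : GoodReps p reps) :
    evalValue p S (encodeOutput p.reps p.cells p.offset reps) = answer p S reps := by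
  simp [← decodeAnswer_eq_evalValue (evalP_returns_release hdef hS hreps), decodeAnswer, answer]

/-- The possible outputs of the mechanism. -/
theorem mem_support_mechLaw {p : Params} {l : List (Fin p.d → Bool)} {r : List ℕ}
    (hr : r ∈ (mechLaw p l).support) :
    (p.defect = 0 ∧ ∃ reps, GoodReps p reps ∧ r = encodeOutput p.reps p.cells p.offset reps) ∨
      ∃ b ≤ 1, (1 < p.n → b = 1) ∧ r = [0, b] := by
  rw [mechLaw] at hr
  split_ifs at hr with hdef hn
  · obtain ⟨reps, h, rfl⟩ := (PMF.mem_support_map_iff _ _ _).1 hr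
    exact Or.inl ⟨hdef, reps, goodReps_of_mem_support
      (by have := (Params.pos_of_defect hdef).2; omega) h, rfl⟩
  · obtain ⟨b, h, rfl⟩ := (PMF.mem_support_map_iff _ _ _).1 hr
    obtain ⟨c, -, rfl⟩ := (PMF.mem_support_map_iff _ _ _).1 h
    exact Or.inr ⟨_, Bool.toNat_le c, fun h => by omega, rfl⟩
  · obtain ⟨b, -, rfl⟩ := (PMF.mem_support_map_iff _ _ _).1 hr
    exact Or.inr ⟨1, le_rfl, fun _ => rfl, rfl⟩

theorem exists_returns {p : Params} {l : List (Fin p.d → Bool)} {r : List ℕ}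
    (hr : r ∈ (mechLaw p l).support) {S : Finset (Fin p.d)}
    (hS : S ∈ conjunctionsOmitting p.d p.k) :
    ∃ o, evalP.Returns (evalIn p (encodePoint fun i => decide (i ∈ S)) r)
      (runtime.eval (p.n + p.d)) o ∧ decodeAnswer o = evalValue p S r := by
  rcases mem_support_mechLaw hr with ⟨hdef, reps, hreps, rfl⟩ | ⟨b, -, -, rfl⟩
  · exact ⟨_, evalP_returns_release hdef hS hreps,
      decodeAnswer_eq_evalValue (evalP_returns_release hdef hS hreps)⟩
  · exact ⟨_, evalP_returns_trivial p S b, decodeAnswer_eq_evalValue (evalP_returns_trivial p S b)⟩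

theorem evalValue_mem {p : Params} {l : List (Fin p.d → Bool)} {r : List ℕ}
    (hr : r ∈ (mechLaw p l).support) {S : Finset (Fin p.d)}
    (hS : S ∈ conjunctionsOmitting p.d p.k) : evalValue p S r ∈ Set.Icc (0 : ℝ) 1 := by
  rcases mem_support_mechLaw hr with ⟨hdef, reps, hreps, rfl⟩ | ⟨b, hb, -, rfl⟩
  · rw [evalValue_release hdef hS hreps]
    exact answer_mem p S reps
  · rw [evalValue_trivial]
    exact ⟨by positivity, by exact_mod_cast hb⟩

/-! ### Accuracy of the mechanism -/

theorem PMF.ofReal_one_sub_le {α : Type*} (μ : PMF α) {good bad : Set α} {β : ℝ} (hβ : 0 ≤ β)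
    (hbad : μ.toOuterMeasure bad ≤ ENNReal.ofReal β)
    (h : ∀ a ∈ μ.support, a ∉ bad → a ∈ good) :
    ENNReal.ofReal (1 - β) ≤ μ.toOuterMeasure good := by
  rw [ENNReal.ofReal_sub _ hβ, ENNReal.ofReal_one, tsub_le_iff_right]
  calc (1 : ℝ≥0∞) = μ.toOuterMeasure Set.univ :=
        ((μ.toOuterMeasure_apply_eq_one_iff _).2 (Set.subset_univ _)).symm
    _ ≤ μ.toOuterMeasure (good ∪ bad) := by
        refine PMF.toOuterMeasure_mono _ ?_
        rintro a ⟨-, ha⟩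
        by_cases hb : a ∈ bad
        · exact Or.inr hb
        · exact Or.inl (h a ha hb)
    _ ≤ μ.toOuterMeasure good + μ.toOuterMeasure bad := MeasureTheory.measure_union_le _ _
    _ ≤ μ.toOuterMeasure good + ENNReal.ofReal β := by gcongr

theorem coin_apply {c : ℕ} (hc : c ≤ 1) : coin c = 1 / 2 := by
  have := coin_expect fun x => if x = c then 1 else 0
  rw [PMF.expect, tsum_eq_single c fun x hx => by simp [hx]] at this
  interval_cases c <;> simpa using this

/-- If `n = 1`, then all queries have the same value, and a random bit is a good enough answer if
`β ≥ 1 / 2`. -/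
theorem mechLaw_accurate_of_eq_one {p : Params} (hn : p.n = 1) {l : List (Fin p.d → Bool)}
    (hl : l.length = p.n) {α β : ℝ} (hα : 0 ≤ α) (hβ : 1 / 2 ≤ β) :
    ENNReal.ofReal (1 - β) ≤ (mechLaw p l).toOuterMeasure {r | ∀ S ∈ conjunctionsOmitting p.d p.k,
      |queryValue (conjunction S) l - evalValue p S r| ≤ α} := by
  have hdef : p.defect ≠ 0 := fun h => by have := (Params.pos_of_defect h).1; omega
  have hk : p.k = 0 := by rw [Params.k_eq hn.ge, hn, Nat.log_one_right]
  have hc : contained l ∅ ≤ 1 := (contained_le_length l ∅).trans (by omega)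
  calc ENNReal.ofReal (1 - β) ≤ ENNReal.ofReal (1 / 2) := ENNReal.ofReal_le_ofReal (by linarith)
    _ = coin (contained l ∅) := by
        rw [coin_apply hc, ENNReal.ofReal_div_of_pos (by norm_num)]
        simp
    _ = coin.toOuterMeasure {contained l ∅} := by rw [PMF.toOuterMeasure_apply_singleton]
    _ ≤ _ := by
        rw [mechLaw, if_neg hdef, PMF.toOuterMeasure_map_apply]
        refine MeasureTheory.measure_mono ?_
        rintro b rfl S hS
        have hT : (zeroSet fun i => decide (i ∈ S)) = ∅ := by
          have h1 := card_zeroSet_indicator S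
          have h2 : S.card + p.k = p.d := hS
          exact Finset.card_eq_zero.1 (by omega)
        dsimp only
        rw [if_pos hn.le, evalValue_trivial, queryValue_conjunction, hT, hl, hn]
        simpa using hα

/-- If `d ≤ 1`, then the only query, if there is any, has the value `1`. -/
theorem queryValue_eq_one {d k : ℕ} (hk : 0 < k) (hd : d ≤ 1) {S : Finset (Fin d)}
    (hS : S ∈ conjunctionsOmitting d k) {l : List (Fin d → Bool)} (hl : l.length ≠ 0) :
    queryValue (conjunction S) l = 1 := by
  have h : S.card + k = d := hS
  obtain rfl : S = ∅ := Finset.card_eq_zero.1 (by omega)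
  rw [queryValue_conjunction, div_eq_one_iff_eq (by exact_mod_cast hl), Nat.cast_inj, contained,
    List.countP_eq_length]
  intro x _
  exact decide_eq_true ((zeroSet_subset_indicator _ _).2 (by simp))

theorem mechLaw_accurate {p : Params} (hn : 1 ≤ p.n) (he₁ : 0 < p.e₁) (he : p.e₁ < p.e₂)
    (hd₁ : 0 < p.d₁) (hd₂ : 0 < p.d₂) (hb₁ : 0 < p.b₁) (hb : p.b₁ < p.b₂) {r α : ℝ} (hr₀ : 0 < r)
    (hr₁ : r ≤ 1) (hδ : r ≤ Real.sqrt (Real.log (p.d₂ / p.d₁)))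
    (hα : α = 1000 / r * (1 + Real.log p.n) *
      ((Real.log p.n * Real.log p.d + Real.log (p.b₂ / p.b₁)) *
        Real.sqrt (Real.log (p.d₂ / p.d₁)) / (p.e₁ / p.e₂ * Real.sqrt p.n)))
    {l : List (Fin p.d → Bool)} (hl : l.length = p.n) :
    ENNReal.ofReal (1 - p.b₁ / p.b₂) ≤
      (mechLaw p l).toOuterMeasure {r | ∀ S ∈ conjunctionsOmitting p.d p.k,
        |queryValue (conjunction S) l - evalValue p S r| ≤ α} := by
  have hb₁' : (0 : ℝ) < p.b₁ := by exact_mod_cast hb₁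
  have hb₂' : (0 : ℝ) < p.b₂ := by exact_mod_cast hb₁.trans hb
  have he₁' : (0 : ℝ) < p.e₁ := by exact_mod_cast he₁
  have he₂' : (0 : ℝ) < p.e₂ := by exact_mod_cast he₁.trans he
  have hβ0 : (0 : ℝ) ≤ p.b₁ / p.b₂ := by positivity
  have hLβ : 0 ≤ Real.log (p.b₂ / p.b₁) := Real.log_nonneg (by
    rw [one_le_div hb₁']
    exact_mod_cast hb.le)
  have hα0 : 0 ≤ α := by
    have h1 := Real.log_natCast_nonneg p.n
    have h2 := Real.log_natCast_nonneg p.d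
    rw [hα]
    positivity
  rcases le_or_gt 1 α with hα1 | hα1
  · refine PMF.ofReal_one_sub_le _ (bad := ∅) hβ0 (by simp) fun r hr _ S hS => ?_
    obtain ⟨h1, h2⟩ := queryValue_conjunction_mem S l
    obtain ⟨h3, h4⟩ := evalValue_mem hr hS
    exact (abs_sub_le_iff.2 ⟨by linarith, by linarith⟩).trans hα1
  rcases hn.eq_or_lt with hn1 | hn2
  · refine mechLaw_accurate_of_eq_one hn1.symm hl hα0 ?_
    have h1 : 1000 * Real.log (p.b₂ / p.b₁) ≤ α := by
      have e : α = 1000 * Real.log (p.b₂ / p.b₁) *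
          (Real.sqrt (Real.log (p.d₂ / p.d₁)) / r * (p.e₂ / p.e₁)) := by
        rw [hα, ← hn1]
        simp
        field_simp
      rw [e]
      refine le_mul_of_one_le_right (by positivity) (one_le_mul_of_one_le_of_one_le ?_ ?_)
      · rwa [one_le_div hr₀]
      · rw [one_le_div he₁']
        exact_mod_cast he.le
    have h2 : Real.log (p.b₂ / p.b₁) < Real.log 2 := by linarith [Real.log_two_gt_d9]
    have h3 := (Real.log_lt_log_iff (by positivity) (by norm_num)).1 h2
    rw [div_lt_iff₀ hb₁'] at h3
    rw [div_le_div_iff₀ (by norm_num) hb₂']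
    linarith
  rcases le_or_gt p.d 1 with hd1 | hd2
  · have hk : 0 < p.k := by
      rw [Params.k_eq hn]
      exact Nat.log_pos (by norm_num) hn2
    refine PMF.ofReal_one_sub_le _ (bad := ∅) hβ0 (by simp) fun r hr _ S hS => ?_
    rw [queryValue_eq_one hk hd1 hS (by omega)]
    rcases mem_support_mechLaw hr with ⟨hdef, -⟩ | ⟨b, -, hb, rfl⟩
    · have := (Params.pos_of_defect hdef).2
      omega
    · rw [evalValue_trivial, hb hn2]
      simpa using hα0
  obtain ⟨hdef, hnoise⟩ := Params.noise_le hn2 hd2 he₁ he hd₁ hd₂ hb₁ hb hr₀ hr₁ hδ hα hα1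
  have hbad := exists_bad_le hdef hb₁ (hb₁.trans hb) hl
  rw [mechLaw, if_pos hdef, PMF.toOuterMeasure_map_apply]
  refine PMF.ofReal_one_sub_le _ hβ0 hbad fun reps hreps hgood S hS => ?_
  rw [evalValue_release hdef hS (goodReps_of_mem_support (by omega) hreps)]
  refine (abs_queryValue_sub_answer_le (by omega) hS hl fun h => hgood ⟨S, hS, h⟩).trans hnoise

theorem Rat.cast_eq_num_toNat_div {q : ℚ} (hq : 0 < q) :
    0 < q.num.toNat ∧ (q : ℝ) = q.num.toNat / q.den := by
  have h := Rat.num_pos.2 hq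
  refine ⟨by omega, ?_⟩
  rw [Rat.cast_def]
  congr 1
  exact_mod_cast (Int.toNat_of_nonneg h.le).symm

theorem Rat.num_toNat_lt_den {q : ℚ} (hq : q < 1) : q.num.toNat < q.den := by
  have := (Rat.lt_iff _ _).1 hq
  rw [Rat.num_one, Rat.den_one, one_mul, Nat.cast_one, mul_one] at this
  have := q.den_pos
  omega

theorem mainTheorem6 :
    ∃ (mech eval : Program) (P : Polynomial ℕ),
      ∀ δ₀ : ℝ, δ₀ < 1 → ∃ C : ℝ, 0 < C ∧
        ∀ (n d : ℕ) (ε δ β : ℚ), 1 ≤ n → 0 < ε → ε < 1 → 0 < δ → (δ : ℝ) ≤ δ₀ → 0 < β → β < 1 →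
          -- the mechanism runs in polynomial time
          (∀ l : List (Fin d → Bool),
            mech.HaltsWithin (mechanismInput n ε δ β l) (P.eval (n + d + l.length))) ∧
          -- it is differentially private
          IsDifferentiallyPrivate
            (fun l : List (Fin d → Bool) =>
              mech.outputLaw (mechanismInput n ε δ β l) (P.eval (n + d + l.length)))
            (ε : ℝ) (δ : ℝ) ∧
          ∃ Eval : Finset (Fin d) → List ℕ → ℝ,
            -- queries are evaluated in polynomial time on the data structures that it outputs
            (∀ l : List (Fin d → Bool), l.length = n →
              ∀ r ∈ (mech.outputLaw (mechanismInput n ε δ β l)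
                  (P.eval (n + d + l.length))).support,
              ∀ S ∈ conjunctionsOmitting d (Nat.log 2 n),
                ∃ o : List ℕ, eval.Returns (evalInput n ε δ β S r) (P.eval (n + d)) o ∧
                  decodeAnswer o = Eval S r) ∧
            -- and the answers are accurate
            IsAccurate n
              (fun l : List (Fin d → Bool) =>
                mech.outputLaw (mechanismInput n ε δ β l) (P.eval (n + d + l.length)))
              conjunction (conjunctionsOmitting d (Nat.log 2 n)) Eval
              (C * (1 + Real.log n) *
                ((Real.log n * Real.log d + Real.log (1 / (β : ℝ))) *
                  Real.sqrt (Real.log (1 / (δ : ℝ))) / ((ε : ℝ) * Real.sqrt n)))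
              (β : ℝ) := by
  refine ⟨mechP, evalP, runtime, fun δ₀ hδ₀ => ?_⟩
  have hδ₁ : max δ₀ (1 / 2) < 1 := max_lt hδ₀ (by norm_num)
  have hδ₂ : 1 / 2 ≤ max δ₀ (1 / 2) := le_max_right _ _
  have hlog : 0 < Real.log (1 / max δ₀ (1 / 2)) :=
    Real.log_pos (by rw [lt_div_iff₀ (by linarith)]; linarith)
  have hlog1 : Real.log (1 / max δ₀ (1 / 2)) ≤ 1 := by
    refine (Real.log_le_sub_one_of_pos (by positivity)).trans ?_
    have : 1 / max δ₀ (1 / 2) ≤ 2 := by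
      rw [div_le_iff₀ (by linarith)]
      linarith
    linarith
  have hr₀ := Real.sqrt_pos.2 hlog
  refine ⟨1000 / Real.sqrt (Real.log (1 / max δ₀ (1 / 2))), by positivity, ?_⟩
  intro n d ε δ β hn hε hε1 hδ hδδ₀ hβ hβ1
  obtain ⟨he₁, he⟩ := Rat.cast_eq_num_toNat_div hε
  obtain ⟨hd₁, hd⟩ := Rat.cast_eq_num_toNat_div hδ
  obtain ⟨hb₁, hb⟩ := Rat.cast_eq_num_toNat_div hβ
  have hδ' : (0 : ℝ) < δ := by exact_mod_cast hδ
  have hr : Real.sqrt (Real.log (1 / max δ₀ (1 / 2))) ≤ Real.sqrt (Real.log (1 / δ)) := by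
    refine Real.sqrt_le_sqrt (Real.log_le_log (by positivity) ?_)
    exact one_div_le_one_div_of_le hδ' (hδδ₀.trans (le_max_left _ _))
  let p : Params := ⟨n, d, ε.num.toNat, ε.den, δ.num.toNat, δ.den, β.num.toNat, β.den⟩
  have hk : p.k = Nat.log 2 n := Params.k_eq hn
  have hmech (l : List (Fin d → Bool)) : mechP.HaltsWithin (mechanismInput n ε δ β l)
      (runtime.eval (n + d + l.length)) ∧ mechP.outputLaw (mechanismInput n ε δ β l)
        (runtime.eval (n + d + l.length)) = mechLaw p l := mechP_halts (p := p) hn l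
  refine ⟨fun l => (hmech l).1, ?_, evalValue p, ?_, ?_⟩
  · intro l l' hll A
    simp only [hmech]
    rw [he, hd]
    exact mechLaw_close (p := p) he₁ (Rat.num_toNat_lt_den hε1) hd₁ δ.den_pos hll A
  · intro l _ r hr S hS
    rw [(hmech l).2] at hr
    rw [← hk] at hS
    exact exists_returns (p := p) hr hS
  · intro l hl
    simp only [hmech]
    rw [← hk, hb]
    rw [hd, one_div_div] at hr
    refine mechLaw_accurate (p := p) hn he₁ (Rat.num_toNat_lt_den hε1) hd₁ δ.den_pos hb₁
      (Rat.num_toNat_lt_den hβ1) hr₀ (Real.sqrt_le_one.2 hlog1) hr ?_ hl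
    rw [he, hd, one_div_div, one_div_div]
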